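/- Write points of $\mathbb{R}^2\times\mathbb{R}$ as $(\xi,\tau)$, and put $\langle a\rangle=1+|a|$, $\langle\xi\rangle=1+|\xi|$, $\langle(\xi,\tau)\rangle=1+(|\tau|+|\xi|^2)^{1/2}$. For integers $j,d\ge 0$ let $$A_j=\{2^j\le\langle\xi\rangle<2^{j+1}\},\qquad B_d=\{2^d\le\langle\tau-|\xi|^2\rangle<2^{d+1}\},\qquad K=\bigcup_{j\ge 0}\ \bigcup_{0\le d\le 2j-4}(A_j\cap B_d),$$ and let $K^c$ be the complement of $K$. For $f:\mathbb{R}^2\times\mathbb{R}\to\mathbb{C}$ put $f^K=\chi_Kf$, $f^{K^c}=\chi_{K^c}f$, and define norms with values in $[0,\infty]$ by $$\|f\|_{\hat X^{s,\frac12,1}}=\Big(\sum_j2^{2sj}\Big(\sum_d2^{d/2}\|\chi_{A_j\cap B_d}f\|_{L^2}\Big)^2\Big)^{1/2},\qquad \|f\|_{Y^s}=\|\langle\xi\rangle^sf\|_{L^2_\xi L^1_\tau}+\|\langle(\xi,\tau)\rangle^{s+1}f\|_{L^2},$$ $$\|f\|_{Z^s}=\inf\{\|f_1\|_{\hat X^{s,\frac12,1}}+\|f_2\|_{Y^s}:\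 f=f_1+f_2\ \text{a.e.},\ f_1,f_2\text{ measurable}\},\qquad \|f\|_{W^s}=\|wf\|_{Z^s},$$ where $w(\xi,\tau)=\max(1,-\tau)^{10}$. Let $*$ denote convolution on $\mathbb{R}^2\times\mathbb{R}$. **Proposition 2.2.** Let $-1<s<0$. There is a constant $C$ depending only on $s$ such that the following holds. For all non-negative smooth functions $f,g$ on $\mathbb{R}^2\times\mathbb{R}$, $$\Big\|\frac{w}{\langle\tau-|\xi|^2\rangle}\Big(\frac{f^{K^c}}{w}*\frac{g^{K^c}}{w}\Big)\Big\|_{Z^s}\le C\,\|f^{K^c}\|_{Y^s}\|g^{K^c}\|_{Y^s},$$ $$\Big\|\frac{w}{\langle\tau-|\xi|^2\rangle}\Big(\frac{f^{K}}{w}*\frac{g^{K}}{w}\Big)\Big\|_{Z^s}\le C\,\|f^{K}\|_{\hat X^{s,\frac12,1}}\|g^{K}\|_{\hat X^{s,\frac12,1}},$$ $$\Big\|\frac{\chi_K\,w}{\langle\tau-|\xi|^2\rangle}\Big(\frac{f^{K}}{w}*\frac{g^{K^c}}{w}\Big)\Big\|_{\hat X^{s,\frac12,1}}\le C\,\|f^{K}\|_{\hat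 X^{s,\frac12,1}}\|g^{K^c}\|_{Y^s},$$ $$\Big\|\frac{(1-\chi_K)\,w}{\langle\tau-|\xi|^2\rangle}\Big(\frac{f^{K}}{w}*\frac{g^{K^c}}{w}\Big)\Big\|_{Y^s}\le C\,\|f^{K}\|_{\hat X^{s,\frac12,1}}\|g^{K^c}\|_{Y^s};$$ in each estimate, if both norms on the right are finite, then the convolution integral on the left converges absolutely at every point. Consequently, for all $f,g:\mathbb{R}^2\times\mathbb{R}\to\mathbb{C}$ with $\|f\|_{W^s},\|g\|_{W^s}<\infty$, the convolution integral $f*g$ converges absolutely at every point, and $$\|\langle\tau-|\xi|^2\rangle^{-1}\,(f*g)\|_{W^s}\le C\,\|f\|_{W^s}\|g\|_{W^s}.$$ -/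

import Mathlib

open MeasureTheory
open scoped ENNReal NNReal Convolution

noncomputable section

namespace QNLS

/-- Space-time frequency space: points `(ξ, τ)` with `ξ ∈ ℝ²` (Euclidean norm) and `τ ∈ ℝ`,
with Lebesgue measure. -/
abbrev Freq : Type := EuclideanSpace ℝ (Fin 2) × ℝ

/-- The bracket `⟨a⟩ = 1 + |a|`. -/
def bracket (a : ℝ) : ℝ := 1 + |a|

/-- `⟨ξ⟩`. -/
def bracketXi (z : Freq) : ℝ := bracket ‖z.1‖

/-- `⟨τ - |ξ|²⟩`. -/
def bracketMod (z : Freq) : ℝ := bracket (z.2 - ‖z.1‖ ^ 2)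

/-- `⟨(ξ, τ)⟩`, where `|(ξ, τ)| = (|τ| + |ξ|²)^{1/2}`. -/
def bracketPar (z : Freq) : ℝ := bracket (Real.sqrt (|z.2| + ‖z.1‖ ^ 2))

/-- The annulus `A_j`. -/
def annulus (j : ℕ) : Set Freq :=
  {z | (2 : ℝ) ^ j ≤ bracketXi z ∧ bracketXi z < (2 : ℝ) ^ (j + 1)}

/-- The parabolic neighbourhood `B_d`. -/
def parNhd (d : ℕ) : Set Freq :=
  {z | (2 : ℝ) ^ d ≤ bracketMod z ∧ bracketMod z < (2 : ℝ) ^ (d + 1)}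

/-- The region `K = ⋃_j (A_j ∩ B_{≤ 2j-4})`, with `j, d` ranging over the nonnegative integers
(so that the sets with `2j - 4 < 0` are empty). -/
def regionK : Set Freq :=
  {z | ∃ j d : ℕ, d + 4 ≤ 2 * j ∧ z ∈ annulus j ∩ parNhd d}

/-- The weight `w(ξ, τ) = max(1, -τ)^{10}`. -/
def weight (z : Freq) : ℝ := max 1 (-z.2) ^ 10

/-- The norm of `X̂^{s,b,1}`, with values in `[0, ∞]`:
`(∑_j 2^{2sj} (∑_d 2^{bd} ‖f_{j,d}‖_{L²})²)^{1/2}` with `f_{j,d} = χ_{A_j ∩ B_d} f`. -/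
def xNorm (s b : ℝ) (f : Freq → ℂ) : ℝ≥0∞ :=
  (∑' j : ℕ, ENNReal.ofReal ((2 : ℝ) ^ (2 * s * j)) *
    (∑' d : ℕ, ENNReal.ofReal ((2 : ℝ) ^ (b * d)) *
      eLpNorm ((annulus j ∩ parNhd d).indicator f) 2 volume) ^ 2) ^ (1 / 2 : ℝ)

/-- The mixed norm of `L²_ξ L¹_τ`, with values in `[0, ∞]`. -/
def mixedNorm (f : Freq → ℂ) : ℝ≥0∞ :=
  (∫⁻ ξ : EuclideanSpace ℝ (Fin 2), (∫⁻ τ : ℝ, ‖f (ξ, τ)‖ₑ) ^ 2) ^ (1 / 2 : ℝ)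

/-- The norm of `Y^s`, with values in `[0, ∞]`. -/
def yNorm (s : ℝ) (f : Freq → ℂ) : ℝ≥0∞ :=
  mixedNorm (fun z => (bracketXi z ^ s : ℝ) • f z) +
    eLpNorm (fun z => (bracketPar z ^ (s + 1) : ℝ) • f z) 2 volume

/-- The norm of `Z^s = X̂^{s,1/2,1} + Y^s`, with values in `[0, ∞]`: the infimum over all
decompositions into measurable functions (identified when they agree almost everywhere). Those in
which one of the two norms is infinite do not affect the infimum, so it is the infimum over
`f₁ ∈ X̂^{s,1/2,1}` and `f₂ ∈ Y^s`; it is `∞` when `f` has no such decomposition. -/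
def zNorm (s : ℝ) (f : Freq → ℂ) : ℝ≥0∞ :=
  ⨅ (f₁ : Freq → ℂ) (f₂ : Freq → ℂ) (_ : AEStronglyMeasurable f₁ volume)
    (_ : AEStronglyMeasurable f₂ volume) (_ : f =ᵐ[volume] f₁ + f₂),
    xNorm s (1 / 2) f₁ + yNorm s f₂

/-- The norm of `W^s`: `‖f‖_{W^s} = ‖w f‖_{Z^s}`. -/
def wNorm (s : ℝ) (f : Freq → ℂ) : ℝ≥0∞ :=
  zNorm s (fun z => (weight z : ℂ) * f z)

/-- `χ_S f` for a real-valued `f`, as a complex-valued function. -/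
def cut (S : Set Freq) (f : Freq → ℝ) : Freq → ℂ :=
  S.indicator (fun z => (f z : ℂ))

/-- `u / w`. -/
def divW (u : Freq → ℂ) : Freq → ℂ := fun z => u z / (weight z : ℂ)

/-- The space-time convolution integral of `u` and `v` converges absolutely at every point. -/
def ConvDefined (u v : Freq → ℂ) : Prop :=
  ConvolutionExists u v (ContinuousLinearMap.mul ℝ ℂ) volume

/-- Space-time convolution `u * v`. -/
def conv (u v : Freq → ℂ) : Freq → ℂ :=
  u ⋆[ContinuousLinearMap.mul ℝ ℂ, volume] v

/-- `(w / ⟨τ - |ξ|²⟩) (u/w * v/w)`. -/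
def wConv (u v : Freq → ℂ) : Freq → ℂ :=
  fun z => ((weight z / bracketMod z : ℝ) : ℂ) * conv (divW u) (divW v) z

end QNLS

end

/-!
The estimates are proved for measurable functions with values in `[0, ∞]`: `l2`, `mixN`, `xN` and
`yN` are the norms of `L²`, `L²_ξ L¹_τ`, `X̂^{s,1/2,1}` and `Y^s` of such functions, `lconv` is
convolution, and `weightedConv` is convolution with the kernel `w(z) / (w(y) w(z - y))`. Complex
functions enter only at the end, through their absolute values. Throughout, `y` and `z - y` are the
two input frequencies, and `a = ⟨ξ⟩`, `b = ⟨τ - |ξ|²⟩`, `p = ⟨(ξ, τ)⟩`.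

*The sum space.* On `K` one has `p ≤ 2a` and off `K` one has `p² ≤ 130 b`. Hence `Y^s` embeds into
`X̂^{s,1/2,1}` for functions supported in `K`, and `X̂^{s,1/2,1}` into `Y^s` for functions supported
off `K`, so that the norm of `Z^s` is equivalent to the sum `pN` of the `X̂` norm of the part in `K`
and the `Y^s` norm of the part off `K` (`zNorm_le_pN`, `exists_pN_le_zNorm`). All estimates thus
split according to whether the inputs and the output lie in `K`.

*The weight.* The kernel of `weightedConv` is bounded. Points of `K` have `τ ≥ 7/9 |ξ|²`, so that a
large input in `K` whose output is small forces the other input to have a very negative time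
frequency, where the weight is large: the kernel is at most a constant times
`min(1, (p(z) / a(y))²)` if `y` lies in `K` (`weight_le_of_mem_regionK`). If both inputs lie in `K`,
then `a(y), a(z - y) ≤ 2 p(z)` (`bracketXi_le_two_mul_bracketPar`).

*Two inputs in the `L²` part of `Y^s`* (`exists_pN_weightedConv_le`). Of the weight, only the
boundedness of the kernel is used. Subadditivity of `p^{s+1}` reduces the bound to Cauchy–Schwarz
and the convergence of `∫ ⟨ξ⟩^{-(1-s)} ⟨ξ - η⟩^{-2(s+1)} dξ`, uniformly in `η`.

*Two inputs in `K`* (`exists_pN_weightedConv_regionK_le`). The output on `K` is controlled by the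
bilinear estimate `exists_l2_indicator_lconv_le` for pieces at distances `2^{d₁}`, `2^{d₂}`, `2^d`
from the paraboloid: by the identity `2 ξ₁·ξ₂ = σ(y) + σ(z - y) - σ(z)` with `σ = τ - |ξ|²`, either
one of the distances is at least a multiple of `2^{j₁+j₂}`, or `ξ₁` and `ξ₂` are almost orthogonal
and the paraboloids intersect transversally. Off `K`, the large factor `b` in the denominator suffices.

*One input in `K` and one in the `L²` part of `Y^s`* (`exists_xN_weightedConv_le`,
`exists_yN_weightedConv_le`). Off `K`, the gain of the weight leaves a kernel `outKernel` in the
spatial frequencies only, to which Young's inequality in `τ` and Schur's test in `ξ` apply. On `K`,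
the bilinear estimates for a piece near the paraboloid and one in an annulus are summed with Schur's
test for sequences; the gain of the weight supplies the decay `2^{s|j-j₁|}` for inputs larger than
the output.

The convolution integrals converge at every point because `weightedConv` is finite there, by
Cauchy–Schwarz and the same gains at a fixed output frequency (`weightedConv_ne_top` and its
variants).
-/

noncomputable section

namespace QNLS

set_option linter.unusedSectionVars false

instance : (volume : Measure Freq).IsAddHaarMeasure :=
  inferInstanceAs
    ((volume : Measure (EuclideanSpace ℝ (Fin 2))).prod (volume : Measure ℝ)).IsAddHaarMeasure

instance : (volume : Measure Freq).IsNegInvariant :=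
  Measure.IsAddHaarMeasure.isNegInvariant_of_innerRegular volume

/-! ### The `L²` norm of `[0, ∞]`-valued functions and bilinear Schur tests -/

section L2

variable {α : Type*} [MeasureSpace α]

/-- The `L²` norm of a function with values in `[0, ∞]`. -/
def l2 (F : α → ℝ≥0∞) : ℝ≥0∞ := (∫⁻ x, F x ^ 2) ^ (1 / 2 : ℝ)

theorem rpow_half_sq (x : ℝ≥0∞) : (x ^ (1 / 2 : ℝ)) ^ 2 = x := by
  rw [← ENNReal.rpow_natCast, ← ENNReal.rpow_mul]; norm_num

theorem sq_rpow_half (x : ℝ≥0∞) : (x ^ 2) ^ (1 / 2 : ℝ) = x := by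
  rw [← ENNReal.rpow_natCast, ← ENNReal.rpow_mul]; norm_num

theorem sq_le_sq_ennreal {x y : ℝ≥0∞} : x ^ 2 ≤ y ^ 2 ↔ x ≤ y := by
  constructor
  · intro h
    have := ENNReal.rpow_le_rpow h (z := 1 / 2) (by norm_num)
    rwa [sq_rpow_half, sq_rpow_half] at this
  · intro h; gcongr

theorem rpow_half_le {x y : ℝ≥0∞} : x ^ (1 / 2 : ℝ) ≤ y ↔ x ≤ y ^ 2 := by
  rw [← sq_le_sq_ennreal, rpow_half_sq]

theorem l2_sq (F : α → ℝ≥0∞) : l2 F ^ 2 = ∫⁻ x, F x ^ 2 := rpow_half_sq _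

theorem l2_le_iff {F : α → ℝ≥0∞} {A : ℝ≥0∞} : l2 F ≤ A ↔ ∫⁻ x, F x ^ 2 ≤ A ^ 2 := rpow_half_le

theorem l2_mono_ae {F G : α → ℝ≥0∞} (h : ∀ᵐ x, F x ≤ G x) : l2 F ≤ l2 G := by
  refine l2_le_iff.2 ?_
  rw [l2_sq]
  refine lintegral_mono_ae ?_
  filter_upwards [h] with x hx
  gcongr

theorem l2_mono {F G : α → ℝ≥0∞} (h : ∀ x, F x ≤ G x) : l2 F ≤ l2 G :=
  l2_mono_ae (Filter.Eventually.of_forall h)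

theorem l2_const_mul (c : ℝ≥0∞) {F : α → ℝ≥0∞} (hF : Measurable F) :
    l2 (fun x => c * F x) = c * l2 F := by
  rw [l2, l2]
  simp_rw [mul_pow]
  rw [lintegral_const_mul _ (hF.pow_const 2), ENNReal.mul_rpow_of_nonneg _ _ (by norm_num),
    sq_rpow_half]

theorem lintegral_mul_le_l2 {F G : α → ℝ≥0∞} (hF : AEMeasurable F) (hG : AEMeasurable G) :
    ∫⁻ x, F x * G x ≤ l2 F * l2 G := by
  have h := ENNReal.lintegral_mul_le_Lp_mul_Lq volume Real.HolderConjugate.two_two hF hG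
  simpa [l2] using h

theorem lintegral_mul_sq_le {F G : α → ℝ≥0∞} (hF : AEMeasurable F) (hG : AEMeasurable G) :
    (∫⁻ x, F x * G x) ^ 2 ≤ (∫⁻ x, F x ^ 2) * ∫⁻ x, G x ^ 2 := by
  rw [← l2_sq, ← l2_sq, ← mul_pow]
  gcongr
  exact lintegral_mul_le_l2 hF hG

theorem l2_add_le {F G : α → ℝ≥0∞} (hF : AEMeasurable F) (hG : AEMeasurable G) :
    l2 (fun x => F x + G x) ≤ l2 F + l2 G := by
  have h := ENNReal.lintegral_Lp_add_le hF hG (p := 2) (by norm_num)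
  simpa [l2] using h

theorem l2_sum_le {ι : Type*} (s : Finset ι) {F : ι → α → ℝ≥0∞} (hF : ∀ i, Measurable (F i)) :
    l2 (fun x => ∑ i ∈ s, F i x) ≤ ∑ i ∈ s, l2 (F i) := by
  classical
  induction s using Finset.induction_on with
  | empty => simp [l2]
  | insert i s hi ih =>
    simp_rw [Finset.sum_insert hi]
    exact (l2_add_le (hF i).aemeasurable
      (Finset.measurable_sum s fun i _ => hF i).aemeasurable).trans (by gcongr)

theorem l2_tsum_le {F : ℕ → α → ℝ≥0∞} (hF : ∀ i, Measurable (F i)) :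
    l2 (fun x => ∑' i, F i x) ≤ ∑' i, l2 (F i) := by
  have hm : ∀ n : ℕ, Measurable fun x => ∑ i ∈ Finset.range n, F i x := fun n =>
    Finset.measurable_sum _ fun i _ => hF i
  have hmono : Monotone fun (n : ℕ) (x : α) => (∑ i ∈ Finset.range n, F i x) ^ 2 := by
    intro m n hmn x
    dsimp only
    gcongr
  have key : ∀ x, (∑' i, F i x) ^ 2 = ⨆ n : ℕ, (∑ i ∈ Finset.range n, F i x) ^ 2 := by
    intro x
    rw [ENNReal.tsum_eq_iSup_nat]
    refine (ENNReal.iSup_pow _ _)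
  rw [l2_le_iff]
  simp_rw [key]
  rw [lintegral_iSup (fun n => (hm n).pow_const 2) hmono]
  refine iSup_le fun n => ?_
  rw [← l2_sq]
  gcongr
  exact (l2_sum_le _ hF).trans (ENNReal.sum_le_tsum _)

/-- Minkowski's integral inequality in `L²`. -/
theorem l2_lintegral_le {β : Type*} [MeasureSpace β] [SFinite (volume : Measure α)]
    [SFinite (volume : Measure β)] {k : α → β → ℝ≥0∞} (hk : Measurable (Function.uncurry k)) :
    l2 (fun x => ∫⁻ y, k x y) ≤ ∫⁻ y, l2 (fun x => k x y) := by
  have hkx : ∀ x, Measurable (k x) := fun x => hk.comp measurable_prodMk_left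
  have hky : ∀ y, Measurable fun x => k x y := fun y => hk.comp measurable_prodMk_right
  have hl : Measurable fun y => l2 (fun x => k x y) :=
    (Measurable.lintegral_prod_left' (f := fun p : α × β => k p.1 p.2 ^ 2)
      (hk.pow_const 2)).pow_const _
  have h3 : Measurable fun p : α × (β × β) => k p.1 p.2.1 * k p.1 p.2.2 :=
    (hk.comp (measurable_fst.prodMk measurable_snd.fst)).mul
      (hk.comp (measurable_fst.prodMk measurable_snd.snd))
  rw [l2_le_iff]
  calc ∫⁻ x, (∫⁻ y, k x y) ^ 2
      = ∫⁻ x, ∫⁻ p : β × β, k x p.1 * k x p.2 := by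
        refine lintegral_congr fun x => ?_
        rw [sq, Measure.volume_eq_prod, lintegral_prod_mul (hkx x).aemeasurable
          (hkx x).aemeasurable]
    _ = ∫⁻ p : β × β, ∫⁻ x, k x p.1 * k x p.2 := by
        rw [Measure.volume_eq_prod, lintegral_lintegral_swap h3.aemeasurable]
    _ ≤ ∫⁻ p : β × β, l2 (fun x => k x p.1) * l2 (fun x => k x p.2) :=
        lintegral_mono fun p => lintegral_mul_le_l2 (hky _).aemeasurable (hky _).aemeasurable
    _ = (∫⁻ y, l2 (fun x => k x y)) ^ 2 := by
        rw [sq, Measure.volume_eq_prod, lintegral_prod_mul hl.aemeasurable hl.aemeasurable]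

end L2

section Schur

variable {α : Type*} [AddCommGroup α] [MeasureSpace α] [MeasurableAdd α] [MeasurableSub₂ α]
  [MeasurableNeg α] [(volume : Measure α).IsAddLeftInvariant]
  [(volume : Measure α).IsNegInvariant] [SFinite (volume : Measure α)]

/-- The bilinear operator `∫ m(z, y) F(y) G(z - y) dy` with kernel `m`. -/
def bil (m : α → α → ℝ≥0∞) (F G : α → ℝ≥0∞) (z : α) : ℝ≥0∞ := ∫⁻ y, m z y * (F y * G (z - y))

/-- The convolution of two functions with values in `[0, ∞]`. -/
def lconv (F G : α → ℝ≥0∞) (z : α) : ℝ≥0∞ := ∫⁻ y, F y * G (z - y)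

theorem lconv_comm (F G : α → ℝ≥0∞) (z : α) : lconv F G z = lconv G F z := by
  unfold lconv
  rw [← lintegral_sub_left_eq_self _ z]
  simp [mul_comm]

theorem measurable_sub_snd {G : α → ℝ≥0∞} (hG : Measurable G) :
    Measurable fun p : α × α => G (p.1 - p.2) :=
  hG.comp (measurable_fst.sub measurable_snd)

theorem measurable_bil {m : α → α → ℝ≥0∞} {F G : α → ℝ≥0∞} (hm : Measurable (Function.uncurry m))
    (hF : Measurable F) (hG : Measurable G) : Measurable (bil m F G) :=
  Measurable.lintegral_prod_right' (f := fun p : α × α => m p.1 p.2 * (F p.2 * G (p.1 - p.2)))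
    (hm.mul ((hF.comp measurable_snd).mul (measurable_sub_snd hG)))

theorem bil_one (F G : α → ℝ≥0∞) : bil (fun _ _ => 1) F G = lconv F G := by
  funext z
  simp only [bil, lconv, one_mul]

theorem measurable_lconv {F G : α → ℝ≥0∞} (hF : Measurable F) (hG : Measurable G) :
    Measurable (lconv F G) :=
  bil_one F G ▸ measurable_bil measurable_const hF hG

/-- Schur test in which the square of the kernel is integrated over the output variable. -/
theorem lintegral_bil_sq_le_of_left {m : α → α → ℝ≥0∞} {F G : α → ℝ≥0∞}
    (hm : Measurable (Function.uncurry m)) (hF : Measurable F) (hG : Measurable G) {A : ℝ≥0∞}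
    (h : ∀ y, ∫⁻ z, m z y ^ 2 ≤ A) :
    ∫⁻ z, bil m F G z ^ 2 ≤ A * ((∫⁻ y, F y ^ 2) * ∫⁻ y, G y ^ 2) := by
  have hmz : ∀ z, Measurable (m z) := fun z => hm.comp measurable_prodMk_left
  have h1 : ∀ z, bil m F G z ^ 2 ≤ (∫⁻ y, m z y ^ 2 * F y ^ 2) * ∫⁻ y, G y ^ 2 := by
    intro z
    have := lintegral_mul_sq_le (F := fun y => m z y * F y) (G := fun y => G (z - y))
      ((hmz z).mul hF).aemeasurable
      (hG.comp (measurable_const.sub measurable_id)).aemeasurable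
    rw [lintegral_sub_left_eq_self (fun y => G y ^ 2) z] at this
    simpa only [bil, mul_pow, mul_assoc] using this
  have hm2 : Measurable (Function.uncurry fun z y => m z y ^ 2 * F y ^ 2) :=
    (hm.pow_const 2).mul ((hF.comp measurable_snd).pow_const 2)
  calc ∫⁻ z, bil m F G z ^ 2
      ≤ ∫⁻ z, (∫⁻ y, m z y ^ 2 * F y ^ 2) * ∫⁻ y, G y ^ 2 := lintegral_mono h1
    _ = (∫⁻ z, ∫⁻ y, m z y ^ 2 * F y ^ 2) * ∫⁻ y, G y ^ 2 :=
        lintegral_mul_const _ hm2.lintegral_prod_right'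
    _ = (∫⁻ y, (∫⁻ z, m z y ^ 2) * F y ^ 2) * ∫⁻ y, G y ^ 2 := by
        rw [lintegral_lintegral_swap hm2.aemeasurable]
        congr 1
        refine lintegral_congr fun y => ?_
        exact lintegral_mul_const _ ((hm.comp measurable_prodMk_right).pow_const 2)
    _ ≤ (∫⁻ y, A * F y ^ 2) * ∫⁻ y, G y ^ 2 := by
        gcongr with y
        exact h y
    _ = A * ((∫⁻ y, F y ^ 2) * ∫⁻ y, G y ^ 2) := by
        rw [lintegral_const_mul _ (hF.pow_const 2), mul_assoc]

theorem lintegral_lintegral_conv {F G : α → ℝ≥0∞} (hF : Measurable F) (hG : Measurable G) :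
    ∫⁻ z, ∫⁻ y, F y * G (z - y) = (∫⁻ y, F y) * ∫⁻ y, G y := by
  have hm2 : Measurable (Function.uncurry fun z y => F y * G (z - y)) :=
    (hF.comp measurable_snd).mul (measurable_sub_snd hG)
  rw [lintegral_lintegral_swap hm2.aemeasurable, ← lintegral_mul_const _ hF]
  refine lintegral_congr fun y => ?_
  have hGy : Measurable fun z => G (z - y) := hG.comp (measurable_id.sub measurable_const)
  rw [lintegral_const_mul _ hGy, lintegral_sub_right_eq_self]

/-- Schur test in which the square of the kernel is integrated over the input variable. -/
theorem lintegral_bil_sq_le_of_right {m : α → α → ℝ≥0∞} {F G : α → ℝ≥0∞}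
    (hm : Measurable (Function.uncurry m)) (hF : Measurable F) (hG : Measurable G) {A : ℝ≥0∞}
    (h : ∀ z, ∫⁻ y, m z y ^ 2 ≤ A) :
    ∫⁻ z, bil m F G z ^ 2 ≤ A * ((∫⁻ y, F y ^ 2) * ∫⁻ y, G y ^ 2) := by
  have hmz : ∀ z, Measurable (m z) := fun z => hm.comp measurable_prodMk_left
  have hFG : Measurable (Function.uncurry fun z y => F y ^ 2 * G (z - y) ^ 2) :=
    ((hF.comp measurable_snd).pow_const 2).mul ((measurable_sub_snd hG).pow_const 2)
  have h1 : ∀ z, bil m F G z ^ 2 ≤ A * ∫⁻ y, F y ^ 2 * G (z - y) ^ 2 := by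
    intro z
    have := lintegral_mul_sq_le (F := m z) (G := fun y => F y * G (z - y)) (hmz z).aemeasurable
      (hF.mul (hG.comp (measurable_const.sub measurable_id))).aemeasurable
    simp only [mul_pow] at this
    refine this.trans ?_
    gcongr
    exact h z
  calc ∫⁻ z, bil m F G z ^ 2
      ≤ ∫⁻ z, A * ∫⁻ y, F y ^ 2 * G (z - y) ^ 2 := lintegral_mono h1
    _ = A * ∫⁻ z, ∫⁻ y, F y ^ 2 * G (z - y) ^ 2 :=
        lintegral_const_mul _ hFG.lintegral_prod_right'
    _ = A * ((∫⁻ y, F y ^ 2) * ∫⁻ y, G y ^ 2) := by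
        rw [lintegral_lintegral_conv (hF.pow_const 2) (hG.pow_const 2)]

theorem mul_le_of_sq {a b c d : ℝ≥0∞} : 2 * ((a * b) * (c * d)) ≤ a ^ 2 * d ^ 2 + c ^ 2 * b ^ 2 := by
  have key : ∀ x y : ℝ≥0∞, 2 * (x * y) ≤ x ^ 2 + y ^ 2 := by
    intro x y
    rcases eq_or_ne x ⊤ with rfl | hx
    · simp
    rcases eq_or_ne y ⊤ with rfl | hy
    · simp
    lift x to ℝ≥0 using hx
    lift y to ℝ≥0 using hy
    exact_mod_cast (by simpa [mul_assoc] using two_mul_le_add_sq x y)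
  have := key (a * d) (c * b)
  simp only [mul_pow] at this
  calc 2 * ((a * b) * (c * d)) = 2 * ((a * d) * (c * b)) := by ring
    _ ≤ _ := this

/-- Schur test obtained by expanding the square of the bilinear operator and pairing the first
input of one factor with the second input of the other. The kernel is only integrated over the
output variable, with the first input variable of one copy and the second input variable of the
other one fixed. -/
theorem lintegral_bil_sq_le_of_cross {m : α → α → ℝ≥0∞} {F G : α → ℝ≥0∞}
    (hm : Measurable (Function.uncurry m)) (hF : Measurable F) (hG : Measurable G) {A : ℝ≥0∞}
    (h : ∀ y x, ∫⁻ z, m z y * m z (z - x) ≤ A) :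
    ∫⁻ z, bil m F G z ^ 2 ≤ A * ((∫⁻ y, F y ^ 2) * ∫⁻ y, G y ^ 2) := by
  have hmz : ∀ z, Measurable (m z) := fun z => hm.comp measurable_prodMk_left
  have hGz : ∀ z, Measurable fun y => G (z - y) := fun z =>
    hG.comp (measurable_const.sub measurable_id)
  set I : α → ℝ≥0∞ := fun z => ∫⁻ y, ∫⁻ y', m z y * m z y' * (F y ^ 2 * G (z - y') ^ 2) with hI
  have h1 : ∀ z, bil m F G z ^ 2 ≤ I z := by
    intro z
    have hB : Measurable fun y => m z y * (F y * G (z - y)) := (hmz z).mul (hF.mul (hGz z))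
    have hm1 : Measurable fun p : α × α => m z p.1 * m z p.2 * (F p.1 ^ 2 * G (z - p.2) ^ 2) :=
      (((hmz z).comp measurable_fst).mul ((hmz z).comp measurable_snd)).mul
        (((hF.comp measurable_fst).pow_const 2).mul (((hGz z).comp measurable_snd).pow_const 2))
    have hm2 : Measurable fun p : α × α => m z p.1 * m z p.2 * (F p.2 ^ 2 * G (z - p.1) ^ 2) :=
      (((hmz z).comp measurable_fst).mul ((hmz z).comp measurable_snd)).mul
        (((hF.comp measurable_snd).pow_const 2).mul (((hGz z).comp measurable_fst).pow_const 2))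
    have e2 : 2 * bil m F G z ^ 2 ≤ 2 * I z := by
      calc 2 * bil m F G z ^ 2
          = ∫⁻ y, ∫⁻ y', 2 * ((m z y * (F y * G (z - y))) * (m z y' * (F y' * G (z - y')))) := by
            rw [sq]
            unfold bil
            rw [← lintegral_lintegral_mul hB.aemeasurable hB.aemeasurable,
              ← lintegral_const_mul]
            · refine lintegral_congr fun y => ?_
              rw [lintegral_const_mul _ (show Measurable fun y' =>
                (m z y * (F y * G (z - y))) * (m z y' * (F y' * G (z - y'))) from
                measurable_const.mul hB)]
            · exact Measurable.lintegral_prod_right'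
                (f := fun p : α × α => (m z p.1 * (F p.1 * G (z - p.1))) *
                  (m z p.2 * (F p.2 * G (z - p.2))))
                ((hB.comp measurable_fst).mul (hB.comp measurable_snd))
        _ ≤ ∫⁻ y, ∫⁻ y', (m z y * m z y' * (F y ^ 2 * G (z - y') ^ 2) +
              m z y * m z y' * (F y' ^ 2 * G (z - y) ^ 2)) := by
            refine lintegral_mono fun y => lintegral_mono fun y' => ?_
            have := mul_le_of_sq (a := F y) (b := G (z - y)) (c := F y') (d := G (z - y'))
            calc 2 * ((m z y * (F y * G (z - y))) * (m z y' * (F y' * G (z - y'))))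
                = m z y * m z y' * (2 * ((F y * G (z - y)) * (F y' * G (z - y')))) := by ring
              _ ≤ m z y * m z y' * (F y ^ 2 * G (z - y') ^ 2 + F y' ^ 2 * G (z - y) ^ 2) := by
                  gcongr
              _ = _ := by ring
        _ = I z + ∫⁻ y, ∫⁻ y', m z y * m z y' * (F y' ^ 2 * G (z - y) ^ 2) := by
            rw [hI, ← lintegral_add_left]
            · refine lintegral_congr fun y => ?_
              rw [lintegral_add_left]
              exact hm1.comp measurable_prodMk_left
            · exact hm1.lintegral_prod_right'
        _ = I z + I z := by
            congr 1
            rw [lintegral_lintegral_swap (f := fun y y' => m z y * m z y' *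
              (F y' ^ 2 * G (z - y) ^ 2)) hm2.aemeasurable]
            refine lintegral_congr fun y => lintegral_congr fun y' => ?_
            ring
        _ = 2 * I z := by ring
    exact (ENNReal.mul_le_mul_iff_right (by norm_num) (by norm_num)).1 e2
  have e3 : ∀ z, I z = ∫⁻ y, ∫⁻ x, m z y * m z (z - x) * (F y ^ 2 * G x ^ 2) := by
    intro z
    refine lintegral_congr fun y => ?_
    rw [← lintegral_sub_left_eq_self _ z]
    simp
  have hm3 : Measurable fun p : α × (α × α) =>
      m p.1 p.2.1 * m p.1 (p.1 - p.2.2) * (F p.2.1 ^ 2 * G p.2.2 ^ 2) := by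
    refine Measurable.mul (Measurable.mul ?_ ?_) (Measurable.mul ?_ ?_)
    · exact hm.comp (measurable_fst.prodMk measurable_snd.fst)
    · exact hm.comp (measurable_fst.prodMk (measurable_fst.sub measurable_snd.snd))
    · exact (hF.comp measurable_snd.fst).pow_const 2
    · exact (hG.comp measurable_snd.snd).pow_const 2
  calc ∫⁻ z, bil m F G z ^ 2
      ≤ ∫⁻ z, I z := lintegral_mono h1
    _ = ∫⁻ z, ∫⁻ p : α × α, m z p.1 * m z (z - p.2) * (F p.1 ^ 2 * G p.2 ^ 2) := by
        refine lintegral_congr fun z => ?_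
        rw [e3, Measure.volume_eq_prod, lintegral_prod _ (Measurable.aemeasurable ?_)]
        exact hm3.comp measurable_prodMk_left
    _ = ∫⁻ p : α × α, (∫⁻ z, m z p.1 * m z (z - p.2)) * (F p.1 ^ 2 * G p.2 ^ 2) := by
        rw [Measure.volume_eq_prod, lintegral_lintegral_swap hm3.aemeasurable]
        refine lintegral_congr fun p => ?_
        refine lintegral_mul_const _ (Measurable.mul ?_ ?_)
        · exact hm.comp measurable_prodMk_right
        · exact hm.comp (measurable_id.prodMk (measurable_id.sub measurable_const))
    _ ≤ ∫⁻ p : α × α, A * (F p.1 ^ 2 * G p.2 ^ 2) := by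
        gcongr with p
        exact h p.1 p.2
    _ = A * ((∫⁻ y, F y ^ 2) * ∫⁻ y, G y ^ 2) := by
        rw [lintegral_const_mul _ (show Measurable fun p : α × α => F p.1 ^ 2 * G p.2 ^ 2 from
          ((hF.comp measurable_fst).pow_const 2).mul ((hG.comp measurable_snd).pow_const 2)),
          Measure.volume_eq_prod,
          lintegral_prod_mul (hF.pow_const 2).aemeasurable (hG.pow_const 2).aemeasurable]

end Schur

/-- Young's inequality `L¹ * L² → L²` in the time frequency reduces a bilinear operator whose
kernel depends on the spatial frequencies only to one on `ℝ²`. -/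
theorem lintegral_bil_fst_sq_le {M : EuclideanSpace ℝ (Fin 2) → EuclideanSpace ℝ (Fin 2) → ℝ≥0∞}
    {F G : Freq → ℝ≥0∞} (hM : Measurable (Function.uncurry M)) (hF : Measurable F)
    (hG : Measurable G) :
    ∫⁻ z, bil (fun z y : Freq => M z.1 y.1) F G z ^ 2 ≤
      ∫⁻ ξ, bil M (fun ξ => ∫⁻ τ, F (ξ, τ)) (fun ξ => l2 fun τ => G (ξ, τ)) ξ ^ 2 := by
  have hm : Measurable (Function.uncurry fun z y : Freq => M z.1 y.1) :=
    hM.comp (measurable_fst.fst.prodMk measurable_snd.fst)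
  have hGl : Measurable fun ξ => l2 fun τ => G (ξ, τ) :=
    (Measurable.lintegral_prod_right' (f := fun p : Freq => G p ^ 2)
      (hG.pow_const 2)).pow_const _
  rw [Measure.volume_eq_prod, lintegral_prod _
    ((measurable_bil hm hF hG).pow_const 2).aemeasurable]
  refine lintegral_mono fun ξ => ?_
  rw [← l2_le_iff]
  have hk : Measurable (Function.uncurry fun (τ : ℝ) (y : Freq) =>
      M ξ y.1 * (F y * G ((ξ, τ) - y))) := by
    refine Measurable.mul ?_ (Measurable.mul ?_ ?_)
    · exact hM.comp (measurable_const.prodMk measurable_snd.fst)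
    · exact hF.comp measurable_snd
    · exact hG.comp ((measurable_const.prodMk measurable_fst).sub measurable_snd)
  refine (l2_lintegral_le hk).trans ?_
  have e : ∀ y : Freq, l2 (fun τ : ℝ => M ξ y.1 * (F y * G ((ξ, τ) - y))) =
      M ξ y.1 * (l2 fun τ => G (ξ - y.1, τ)) * F y := by
    intro y
    have hc : Measurable fun τ : ℝ => G ((ξ, τ) - y) :=
      hG.comp ((measurable_const.prodMk measurable_id).sub measurable_const)
    simp_rw [← mul_assoc]
    rw [l2_const_mul _ hc]
    have : l2 (fun τ : ℝ => G ((ξ, τ) - y)) = l2 fun τ => G (ξ - y.1, τ) := by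
      unfold l2
      rw [← lintegral_sub_right_eq_self (fun τ => G (ξ - y.1, τ) ^ 2) y.2]
      rfl
    rw [this]
    ring
  simp_rw [e]
  rw [Measure.volume_eq_prod, lintegral_prod]
  · unfold bil
    refine lintegral_mono fun η => ?_
    dsimp only
    rw [lintegral_const_mul _ (show Measurable fun τ => F (η, τ) from
      hF.comp measurable_prodMk_left)]
    exact le_of_eq (by ring)
  · refine Measurable.aemeasurable (Measurable.mul (Measurable.mul ?_ ?_) hF)
    · exact hM.comp (measurable_const.prodMk measurable_fst)
    · exact hGl.comp (measurable_const.sub measurable_fst)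

/-! ### Brackets, the region `K` and the weight -/

theorem one_le_bracket (a : ℝ) : 1 ≤ bracket a := by
  unfold bracket; linarith [abs_nonneg a]

theorem bracketXi_eq (z : Freq) : bracketXi z = 1 + ‖z.1‖ := by
  simp [bracketXi, bracket]

theorem one_le_bracketXi (z : Freq) : 1 ≤ bracketXi z := one_le_bracket _

theorem one_le_bracketMod (z : Freq) : 1 ≤ bracketMod z := one_le_bracket _

theorem one_le_bracketPar (z : Freq) : 1 ≤ bracketPar z := one_le_bracket _

theorem one_le_weight (z : Freq) : 1 ≤ weight z := one_le_pow₀ (le_max_left _ _)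

theorem bracketXi_pos (z : Freq) : 0 < bracketXi z := one_pos.trans_le (one_le_bracketXi z)

theorem bracketMod_pos (z : Freq) : 0 < bracketMod z := one_pos.trans_le (one_le_bracketMod z)

theorem bracketPar_pos (z : Freq) : 0 < bracketPar z := one_pos.trans_le (one_le_bracketPar z)

theorem weight_pos (z : Freq) : 0 < weight z := one_pos.trans_le (one_le_weight z)

theorem continuous_bracketXi : Continuous bracketXi := by
  unfold bracketXi bracket; fun_prop

theorem continuous_bracketMod : Continuous bracketMod := by
  unfold bracketMod bracket; fun_prop

theorem continuous_bracketPar : Continuous bracketPar := by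
  unfold bracketPar bracket; fun_prop

theorem continuous_weight : Continuous weight := by
  unfold weight; fun_prop

theorem measurableSet_annulus (j : ℕ) : MeasurableSet (annulus j) :=
  (measurableSet_le measurable_const continuous_bracketXi.measurable).inter
    (measurableSet_lt continuous_bracketXi.measurable measurable_const)

theorem measurableSet_parNhd (d : ℕ) : MeasurableSet (parNhd d) :=
  (measurableSet_le measurable_const continuous_bracketMod.measurable).inter
    (measurableSet_lt continuous_bracketMod.measurable measurable_const)

theorem measurableSet_regionK : MeasurableSet regionK := by
  have : regionK = ⋃ j : ℕ, ⋃ d : ℕ, ⋃ _ : d + 4 ≤ 2 * j, annulus j ∩ parNhd d := by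
    ext z; simp only [regionK, Set.mem_ofPred_eq, Set.mem_iUnion, exists_prop]
  rw [this]
  exact MeasurableSet.iUnion fun j => MeasurableSet.iUnion fun d => MeasurableSet.iUnion fun _ =>
    (measurableSet_annulus j).inter (measurableSet_parNhd d)

theorem exists_dyadic {x : ℝ} (hx : 1 ≤ x) : ∃ n : ℕ, (2 : ℝ) ^ n ≤ x ∧ x < (2 : ℝ) ^ (n + 1) :=
  exists_nat_pow_near hx one_lt_two

theorem dyadic_unique {x : ℝ} {m n : ℕ} (hm : (2 : ℝ) ^ m ≤ x ∧ x < (2 : ℝ) ^ (m + 1))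
    (hn : (2 : ℝ) ^ n ≤ x ∧ x < (2 : ℝ) ^ (n + 1)) : m = n := by
  have h1 : m < n + 1 := (pow_lt_pow_iff_right₀ (one_lt_two (α := ℝ))).1 (hm.1.trans_lt hn.2)
  have h2 : n < m + 1 := (pow_lt_pow_iff_right₀ (one_lt_two (α := ℝ))).1 (hn.1.trans_lt hm.2)
  omega

theorem exists_mem_annulus (z : Freq) : ∃ j, z ∈ annulus j := exists_dyadic (one_le_bracketXi z)

theorem exists_mem_parNhd (z : Freq) : ∃ d, z ∈ parNhd d := exists_dyadic (one_le_bracketMod z)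

theorem annulus_unique {z : Freq} {i j : ℕ} (hi : z ∈ annulus i) (hj : z ∈ annulus j) : i = j :=
  dyadic_unique hi hj

theorem parNhd_unique {z : Freq} {i j : ℕ} (hi : z ∈ parNhd i) (hj : z ∈ parNhd j) : i = j :=
  dyadic_unique hi hj

theorem le_of_mem_regionK {z : Freq} {j d : ℕ} (hz : z ∈ regionK) (hj : z ∈ annulus j)
    (hd : z ∈ parNhd d) : d + 4 ≤ 2 * j := by
  obtain ⟨j', d', h, hj', hd'⟩ := hz
  rw [annulus_unique hj hj', parNhd_unique hd hd']
  exact h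

theorem bracketMod_le_of_mem_regionK {z : Freq} (hz : z ∈ regionK) :
    bracketMod z ≤ bracketXi z ^ 2 / 8 ∧ 4 ≤ bracketXi z := by
  obtain ⟨j, d, h, hj, hd⟩ := hz
  constructor
  · have h1 : bracketMod z < (2 : ℝ) ^ (d + 1) := hd.2
    have h2 : (2 : ℝ) ^ (d + 1 + 3) ≤ (2 : ℝ) ^ (2 * j) :=
      pow_le_pow_right₀ one_le_two (by omega)
    have h3 : ((2 : ℝ) ^ j) ^ 2 ≤ bracketXi z ^ 2 := by
      gcongr
      exact hj.1
    rw [← pow_mul, mul_comm j 2] at h3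
    rw [pow_add _ _ 3] at h2
    linarith
  · have h2 : (2 : ℝ) ^ 2 ≤ (2 : ℝ) ^ j := pow_le_pow_right₀ one_le_two (by omega)
    have := hj.1
    linarith

theorem bracketXi_sq_le_of_notMem_regionK {z : Freq} (hz : z ∉ regionK) :
    bracketXi z ^ 2 ≤ 32 * bracketMod z := by
  obtain ⟨j, hj⟩ := exists_mem_annulus z
  obtain ⟨d, hd⟩ := exists_mem_parNhd z
  have h : 2 * j < d + 4 := by
    by_contra hc
    exact hz ⟨j, d, by omega, hj, hd⟩
  have h1 : bracketXi z ^ 2 ≤ ((2 : ℝ) ^ (j + 1)) ^ 2 := by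
    have := hj.2.le
    have := bracketXi_pos z
    gcongr
  have h2 : ((2 : ℝ) ^ (j + 1)) ^ 2 ≤ (2 : ℝ) ^ (d + 5) := by
    rw [← pow_mul]
    exact pow_le_pow_right₀ one_le_two (by omega)
  have h3 := hd.1
  rw [pow_add 2 d 5] at h2
  linarith

theorem bracketXi_le_bracketPar (z : Freq) : bracketXi z ≤ bracketPar z := by
  have h : ‖z.1‖ ≤ Real.sqrt (|z.2| + ‖z.1‖ ^ 2) :=
    Real.le_sqrt_of_sq_le (by linarith [abs_nonneg z.2])
  rw [bracketXi_eq, bracketPar, bracket, abs_of_nonneg (Real.sqrt_nonneg _)]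
  linarith

theorem bracketPar_eq (z : Freq) : bracketPar z = 1 + Real.sqrt (|z.2| + ‖z.1‖ ^ 2) := by
  rw [bracketPar, bracket, abs_of_nonneg (Real.sqrt_nonneg _)]

theorem one_add_le_bracketPar_sq (z : Freq) : 1 + (|z.2| + ‖z.1‖ ^ 2) ≤ bracketPar z ^ 2 := by
  rw [bracketPar_eq, add_sq, Real.sq_sqrt (by positivity)]
  nlinarith [Real.sqrt_nonneg (|z.2| + ‖z.1‖ ^ 2)]

theorem bracketPar_sq_le (z : Freq) : bracketPar z ^ 2 ≤ 2 * (1 + (|z.2| + ‖z.1‖ ^ 2)) := by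
  have h := Real.sq_sqrt (show 0 ≤ |z.2| + ‖z.1‖ ^ 2 by positivity)
  rw [bracketPar_eq]
  nlinarith [sq_nonneg (1 - Real.sqrt (|z.2| + ‖z.1‖ ^ 2))]

/-- The parabolic bracket is subadditive. -/
theorem bracketPar_le_add (z y : Freq) : bracketPar z ≤ bracketPar y + bracketPar (z - y) := by
  have h : Real.sqrt (|z.2| + ‖z.1‖ ^ 2) ≤ Real.sqrt (|y.2| + ‖y.1‖ ^ 2) +
      Real.sqrt (|(z - y).2| + ‖(z - y).1‖ ^ 2) := by
    have e1 : |z.2| ≤ |y.2| + |(z - y).2| := by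
      have := abs_add_le y.2 (z - y).2
      rwa [Prod.snd_sub, add_sub_cancel] at this
    have e2 : ‖z.1‖ ≤ ‖y.1‖ + ‖(z - y).1‖ := by
      have := norm_add_le y.1 (z - y).1
      rwa [Prod.fst_sub, add_sub_cancel] at this
    generalize (z - y).2 = t at *
    generalize ‖(z - y).1‖ = r at *
    have hr : ‖y.1‖ * r ≤ Real.sqrt (|y.2| + ‖y.1‖ ^ 2) * Real.sqrt (|t| + r ^ 2) := by
      rcases le_or_gt 0 r with h0 | h0
      · gcongr
        · exact Real.le_sqrt_of_sq_le (by linarith [abs_nonneg y.2])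
        · exact Real.le_sqrt_of_sq_le (by linarith [abs_nonneg t])
      · exact (mul_nonpos_of_nonneg_of_nonpos (norm_nonneg _) h0.le).trans (by positivity)
    refine Real.sqrt_le_iff.2 ⟨by positivity, ?_⟩
    rw [add_sq, Real.sq_sqrt (by positivity), Real.sq_sqrt (by positivity)]
    nlinarith [norm_nonneg z.1, norm_nonneg y.1]
  simp only [bracketPar_eq]
  linarith

theorem abs_sub_le_of_mem_regionK {z : Freq} (hz : z ∈ regionK) :
    |z.2 - ‖z.1‖ ^ 2| ≤ 2 / 9 * ‖z.1‖ ^ 2 ∧ 3 ≤ ‖z.1‖ := by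
  obtain ⟨h1, h2⟩ := bracketMod_le_of_mem_regionK hz
  rw [bracketXi_eq] at h1 h2
  unfold bracketMod bracket at h1
  constructor <;> nlinarith

theorem le_snd_of_mem_regionK {z : Freq} (hz : z ∈ regionK) : 7 / 9 * ‖z.1‖ ^ 2 ≤ z.2 := by
  have := (abs_le.1 (abs_sub_le_of_mem_regionK hz).1).1
  linarith

theorem bracketPar_le_of_mem_regionK {z : Freq} (hz : z ∈ regionK) :
    bracketPar z ≤ 2 * bracketXi z := by
  obtain ⟨h1, h2⟩ := abs_sub_le_of_mem_regionK hz
  have h3 := le_snd_of_mem_regionK hz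
  have h4 := (abs_le.1 h1).2
  rw [bracketXi_eq, bracketPar_eq, abs_of_nonneg (le_trans (by positivity) h3)]
  have : Real.sqrt (z.2 + ‖z.1‖ ^ 2) ≤ 1 + 2 * ‖z.1‖ :=
    Real.sqrt_le_iff.2 ⟨by positivity, by nlinarith⟩
  linarith

theorem bracketPar_sq_le_of_notMem_regionK {z : Freq} (hz : z ∉ regionK) :
    bracketPar z ^ 2 ≤ 130 * bracketMod z := by
  have h1 := bracketXi_sq_le_of_notMem_regionK hz
  have h2 := bracketPar_sq_le z
  have h3 : |z.2| ≤ |z.2 - ‖z.1‖ ^ 2| + ‖z.1‖ ^ 2 := by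
    have := abs_add_le (z.2 - ‖z.1‖ ^ 2) (‖z.1‖ ^ 2)
    rwa [sub_add_cancel, abs_of_nonneg (sq_nonneg ‖z.1‖)] at this
  have h4 : bracketMod z = 1 + |z.2 - ‖z.1‖ ^ 2| := rfl
  rw [bracketXi_eq] at h1
  nlinarith [norm_nonneg z.1]

/-- If both inputs lie in `K`, then the output is at least as large as either of them. -/
theorem bracketXi_le_two_mul_bracketPar {z y : Freq} (hy : y ∈ regionK) (hzy : z - y ∈ regionK) :
    bracketXi y ≤ 2 * bracketPar z ∧ bracketXi (z - y) ≤ 2 * bracketPar z := by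
  have h1 := le_snd_of_mem_regionK hy
  have h2 := le_snd_of_mem_regionK hzy
  have h3 : z.2 = y.2 + (z - y).2 := by simp
  have h4 := one_add_le_bracketPar_sq z
  have h5 := bracketPar_pos z
  have h6 := le_abs_self z.2
  simp only [bracketXi_eq]
  generalize ‖(z - y).1‖ = r at *
  generalize (z - y).2 = t at *
  constructor <;> refine abs_le_of_sq_le_sq' ?_ (by positivity) |>.2 <;>
    nlinarith [sq_nonneg (‖y.1‖ - 1), sq_nonneg (r - 1), sq_nonneg ‖z.1‖, sq_nonneg ‖y.1‖,
      sq_nonneg r]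

theorem weight_le (z y : Freq) : weight z ≤ 2 ^ 10 * (weight y * weight (z - y)) := by
  unfold weight
  rw [← mul_pow, ← mul_pow]
  have h : (z - y).2 = z.2 - y.2 := rfl
  rw [h]
  have h1 := le_max_left 1 (-y.2)
  have h2 := le_max_right 1 (-y.2)
  have h3 := le_max_left 1 (-(z.2 - y.2))
  have h4 := le_max_right 1 (-(z.2 - y.2))
  gcongr
  generalize max 1 (-y.2) = a at *
  generalize max 1 (-(z.2 - y.2)) = b at *
  refine max_le (by nlinarith) (by nlinarith)

/-- When one input lies in `K`, the weight of the output is controlled by the weight of the other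
input, with a gain when the output is small compared with the input in `K`. -/
theorem weight_le_of_mem_regionK {z y : Freq} (hy : y ∈ regionK) :
    weight z ≤ weight (z - y) ∧
      weight z * bracketXi y ^ 2 ≤ 16 * (weight (z - y) * bracketPar z ^ 2) := by
  have h1 := le_snd_of_mem_regionK hy
  have h0 := (abs_sub_le_of_mem_regionK hy).2
  have h2 : (0 : ℝ) ≤ y.2 := le_trans (by positivity) h1
  have h : (z - y).2 = z.2 - y.2 := rfl
  have hle : max 1 (-z.2) ≤ max 1 (-(z - y).2) := by
    rw [h]; exact max_le_max le_rfl (by linarith)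
  have hw : weight z ≤ weight (z - y) := by
    unfold weight; gcongr
  refine ⟨hw, ?_⟩
  have ha : bracketXi y ^ 2 ≤ 4 * y.2 := by
    rw [bracketXi_eq]; nlinarith
  have hp := one_add_le_bracketPar_sq z
  rcases le_or_gt (y.2 / 2) |z.2| with hz | hz
  · have : bracketXi y ^ 2 ≤ 16 * bracketPar z ^ 2 := by nlinarith [sq_nonneg ‖z.1‖]
    have hwp := weight_pos (z - y)
    nlinarith [sq_nonneg (bracketXi y)]
  · have hA : max 1 (-z.2) ≤ bracketPar z ^ 2 :=
      max_le (by nlinarith [abs_nonneg z.2, sq_nonneg ‖z.1‖])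
        (by nlinarith [neg_le_abs z.2, sq_nonneg ‖z.1‖])
    have hB : y.2 / 2 ≤ max 1 (-(z - y).2) := by
      refine le_max_of_le_right ?_
      rw [h]
      linarith [le_abs_self z.2]
    have hm : max 1 (-z.2) * bracketXi y ^ 2 ≤ 16 * (max 1 (-(z - y).2) * bracketPar z ^ 2) := by
      have h1z := le_max_left 1 (-z.2)
      have := sq_nonneg (bracketPar z)
      calc max 1 (-z.2) * bracketXi y ^ 2 ≤ bracketPar z ^ 2 * (4 * y.2) := by gcongr
        _ = 8 * (y.2 / 2 * bracketPar z ^ 2) := by ring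
        _ ≤ 16 * (max 1 (-(z - y).2) * bracketPar z ^ 2) := by
          have : y.2 / 2 * bracketPar z ^ 2 ≤ max 1 (-(z - y).2) * bracketPar z ^ 2 := by gcongr
          have h8 : 0 ≤ max 1 (-(z - y).2) * bracketPar z ^ 2 := by positivity
          linarith
    have h9 : max 1 (-z.2) ^ 9 ≤ max 1 (-(z - y).2) ^ 9 := by
      have := le_max_left 1 (-z.2)
      gcongr
    have h1z := le_max_left 1 (-z.2)
    have h1y := le_max_left 1 (-(z - y).2)
    unfold weight
    calc max 1 (-z.2) ^ 10 * bracketXi y ^ 2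
        = max 1 (-z.2) ^ 9 * (max 1 (-z.2) * bracketXi y ^ 2) := by ring
      _ ≤ max 1 (-(z - y).2) ^ 9 * (16 * (max 1 (-(z - y).2) * bracketPar z ^ 2)) := by
          gcongr
      _ = _ := by ring

/-! ### Areas of parallelograms and annuli, volumes of intersected paraboloid neighbourhoods -/

/-- The determinant of two vectors of the plane. -/
def cross (u v : EuclideanSpace ℝ (Fin 2)) : ℝ := u 0 * v 1 - u 1 * v 0

theorem inner_eq_coord (u v : EuclideanSpace ℝ (Fin 2)) :
    inner ℝ u v = u 0 * v 0 + u 1 * v 1 := by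
  simp [PiLp.inner_apply, Fin.sum_univ_two, mul_comm]

theorem norm_sq_eq_coord (u : EuclideanSpace ℝ (Fin 2)) : ‖u‖ ^ 2 = u 0 ^ 2 + u 1 ^ 2 := by
  rw [EuclideanSpace.norm_sq_eq, Fin.sum_univ_two]; simp

theorem cross_sq_add_inner_sq (u v : EuclideanSpace ℝ (Fin 2)) :
    cross u v ^ 2 + inner ℝ u v ^ 2 = (‖u‖ * ‖v‖) ^ 2 := by
  rw [mul_pow, norm_sq_eq_coord, norm_sq_eq_coord, inner_eq_coord, cross]; ring

theorem abs_cross_le (u v : EuclideanSpace ℝ (Fin 2)) : |cross u v| ≤ ‖u‖ * ‖v‖ := by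
  refine abs_le_of_sq_le_sq ?_ (by positivity)
  nlinarith [cross_sq_add_inner_sq u v, sq_nonneg (inner ℝ u v : ℝ)]

theorem volume_parallelogram_le {u v : EuclideanSpace ℝ (Fin 2)} (h : cross u v ≠ 0)
    (c c' A B : ℝ) :
    volume {ξ : EuclideanSpace ℝ (Fin 2) | |inner ℝ u ξ - c| ≤ A ∧ |inner ℝ v ξ - c'| ≤ B} ≤
      ENNReal.ofReal (2 * A) * ENNReal.ofReal (2 * B) / ENNReal.ofReal |cross u v| := by
  let M : Matrix (Fin 2) (Fin 2) ℝ := !![u 0, u 1; v 0, v 1]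
  have hdet : LinearMap.det (Matrix.toLin' M) = cross u v := by
    rw [LinearMap.det_toLin', Matrix.det_fin_two]
    simp [M, cross]
  let box : Set (Fin 2 → ℝ) := Set.Icc ![c - A, c' - B] ![c + A, c' + B]
  have hset : {ξ : EuclideanSpace ℝ (Fin 2) | |inner ℝ u ξ - c| ≤ A ∧ |inner ℝ v ξ - c'| ≤ B} =
      (fun ξ : EuclideanSpace ℝ (Fin 2) => ξ.ofLp) ⁻¹' (Matrix.toLin' M ⁻¹' box) := by
    ext ξ
    simp only [Set.mem_ofPred_eq, Set.mem_preimage, box, Set.mem_Icc, Pi.le_def,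
      Fin.forall_fin_two, Matrix.toLin'_apply, M, inner_eq_coord, abs_le]
    simp [Matrix.mulVec, dotProduct, Fin.sum_univ_two]
    constructor
    · rintro ⟨⟨h1, h2⟩, h3, h4⟩
      refine ⟨⟨?_, ?_⟩, ?_, ?_⟩ <;> linarith
    · rintro ⟨⟨h1, h2⟩, h3, h4⟩
      refine ⟨⟨?_, ?_⟩, ?_, ?_⟩ <;> linarith
  have hbox : MeasurableSet (Matrix.toLin' M ⁻¹' box) :=
    (LinearMap.continuous_of_finiteDimensional _).measurable measurableSet_Icc
  rw [hset, (PiLp.volume_preserving_ofLp (Fin 2)).measure_preimage hbox.nullMeasurableSet,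
    Measure.addHaar_preimage_linearMap _ (hdet ▸ h), hdet, Real.volume_Icc_pi]
  simp only [Fin.prod_univ_two, Matrix.cons_val_zero, Matrix.cons_val_one]
  rw [abs_inv, ENNReal.ofReal_inv_of_pos (abs_pos.2 h), mul_comm, ENNReal.div_eq_inv_mul, mul_comm]
  apply le_of_eq
  congr 3 <;> ring

theorem volume_norm_sq_mem_Icc_le (R D : ℝ) (hD : 0 ≤ D) :
    volume {y : EuclideanSpace ℝ (Fin 2) | R ≤ ‖y‖ ^ 2 ∧ ‖y‖ ^ 2 ≤ R + D} ≤
      ENNReal.ofReal (D * Real.pi) := by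
  have hπ := Real.pi_pos
  rcases lt_or_ge R 0 with hR | hR
  · refine (measure_mono (t := Metric.closedBall 0 (Real.sqrt D)) ?_).trans ?_
    · rintro y ⟨-, h⟩
      rw [mem_closedBall_zero_iff]
      exact Real.le_sqrt_of_sq_le (by linarith)
    · rw [Measure.addHaar_closedBall_eq_addHaar_ball, EuclideanSpace.volume_ball_fin_two,
        ← ENNReal.ofReal_pow (Real.sqrt_nonneg _), Real.sq_sqrt hD, ENNReal.ofReal_mul hD]
  · refine (measure_mono (t := Metric.closedBall 0 (Real.sqrt (R + D)) \
      Metric.ball 0 (Real.sqrt R)) ?_).trans ?_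
    · rintro y ⟨h1, h2⟩
      refine ⟨?_, ?_⟩
      · rw [mem_closedBall_zero_iff]
        exact Real.le_sqrt_of_sq_le h2
      · rw [mem_ball_zero_iff, not_lt]
        exact Real.sqrt_le_iff.2 ⟨norm_nonneg _, h1⟩
    · rw [measure_sdiff ((Metric.ball_subset_closedBall).trans
        (Metric.closedBall_subset_closedBall (Real.sqrt_le_sqrt (by linarith))))
        measurableSet_ball.nullMeasurableSet measure_ball_lt_top.ne,
        Measure.addHaar_closedBall_eq_addHaar_ball, EuclideanSpace.volume_ball_fin_two,
        EuclideanSpace.volume_ball_fin_two,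
        ← ENNReal.ofReal_pow (Real.sqrt_nonneg _), ← ENNReal.ofReal_pow (Real.sqrt_nonneg _),
        Real.sq_sqrt hR, Real.sq_sqrt (by linarith), ← ENNReal.ofReal_mul hR,
        ← ENNReal.ofReal_mul (by linarith), ← ENNReal.ofReal_sub _ (by positivity)]
      apply ENNReal.ofReal_le_ofReal
      linarith

/-- The distance to the paraboloid `τ = |ξ|²` in the direction of `τ`. -/
def modul (z : Freq) : ℝ := z.2 - ‖z.1‖ ^ 2

theorem continuous_modul : Continuous modul := by unfold modul; fun_prop

/-- A volume estimate in the coordinates `(ξ, τ - |ξ|²)`. -/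
theorem volume_le_of_modul {S : Set Freq} (hS : MeasurableSet S) {D : ℝ} {A : ℝ≥0∞}
    (hD : ∀ z ∈ S, |modul z| ≤ D)
    (hA : ∀ σ : ℝ, volume {ξ : EuclideanSpace ℝ (Fin 2) | (ξ, σ + ‖ξ‖ ^ 2) ∈ S} ≤ A) :
    volume S ≤ A * ENNReal.ofReal (2 * D) := by
  have hf : Measurable (S.indicator (1 : Freq → ℝ≥0∞)) := measurable_one.indicator hS
  have hg : Measurable fun p : EuclideanSpace ℝ (Fin 2) × ℝ =>
      S.indicator (1 : Freq → ℝ≥0∞) (p.1, p.2 + ‖p.1‖ ^ 2) :=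
    hf.comp (measurable_fst.prodMk (measurable_snd.add (measurable_fst.norm.pow_const 2)))
  calc volume S = ∫⁻ z, S.indicator (1 : Freq → ℝ≥0∞) z := (lintegral_indicator_one hS).symm
    _ = ∫⁻ ξ : EuclideanSpace ℝ (Fin 2), ∫⁻ τ : ℝ, S.indicator (1 : Freq → ℝ≥0∞) (ξ, τ) := by
        rw [Measure.volume_eq_prod, lintegral_prod _ hf.aemeasurable]
    _ = ∫⁻ ξ : EuclideanSpace ℝ (Fin 2), ∫⁻ σ : ℝ,
          S.indicator (1 : Freq → ℝ≥0∞) (ξ, σ + ‖ξ‖ ^ 2) := by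
        refine lintegral_congr fun ξ => ?_
        exact (lintegral_add_right_eq_self
          (fun τ : ℝ => S.indicator (1 : Freq → ℝ≥0∞) (ξ, τ)) (‖ξ‖ ^ 2)).symm
    _ = ∫⁻ σ : ℝ, ∫⁻ ξ : EuclideanSpace ℝ (Fin 2),
          S.indicator (1 : Freq → ℝ≥0∞) (ξ, σ + ‖ξ‖ ^ 2) :=
        lintegral_lintegral_swap hg.aemeasurable
    _ = ∫⁻ σ : ℝ, volume {ξ : EuclideanSpace ℝ (Fin 2) | (ξ, σ + ‖ξ‖ ^ 2) ∈ S} := by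
        refine lintegral_congr fun σ => ?_
        rw [← lintegral_indicator_one]
        · rfl
        · exact (measurable_id.prodMk (measurable_const.add (measurable_norm.pow_const 2))) hS
    _ ≤ ∫⁻ σ : ℝ, (Set.Icc (-D) D).indicator (fun _ => A) σ := by
        refine lintegral_mono fun σ => ?_
        by_cases hσ : σ ∈ Set.Icc (-D) D
        · rw [Set.indicator_of_mem hσ]; exact hA σ
        · have : {ξ : EuclideanSpace ℝ (Fin 2) | (ξ, σ + ‖ξ‖ ^ 2) ∈ S} = ∅ := by
            refine Set.eq_empty_of_forall_notMem fun ξ hξ => hσ ?_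
            have := hD _ hξ
            simp only [modul, add_sub_cancel_right] at this
            exact abs_le.1 this
          rw [this]; simp
    _ = A * ENNReal.ofReal (2 * D) := by
        rw [lintegral_indicator measurableSet_Icc, setLIntegral_const, Real.volume_Icc]
        congr 2; ring

theorem volume_modul_modul_sub_le (z : Freq) {D₁ D₂ : ℝ} (hD₂ : 0 ≤ D₂) :
    volume {y : Freq | |modul y| ≤ D₁ ∧ |modul (z - y)| ≤ D₂} ≤
      ENNReal.ofReal (D₂ * Real.pi) * ENNReal.ofReal (2 * D₁) := by
  refine volume_le_of_modul ?_ (fun y hy => hy.1) fun σ => ?_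
  · exact (measurableSet_le continuous_modul.measurable.abs measurable_const).inter
      (measurableSet_le (continuous_modul.comp (continuous_const.sub continuous_id)).measurable.abs
        measurable_const)
  · let c : EuclideanSpace ℝ (Fin 2) := (1 / 2 : ℝ) • z.1
    have key : ∀ ξ : EuclideanSpace ℝ (Fin 2),
        ‖ξ‖ ^ 2 + ‖z.1 - ξ‖ ^ 2 = 2 * ‖ξ - c‖ ^ 2 + ‖z.1‖ ^ 2 / 2 := by
      intro ξ
      simp only [norm_sq_eq_coord, c, PiLp.sub_apply, PiLp.smul_apply, smul_eq_mul]
      ring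
    set R : ℝ := (z.2 - σ - ‖z.1‖ ^ 2 / 2 - D₂) / 2 with hR
    refine (measure_mono (t := (fun ξ => ξ + -c) ⁻¹'
      {y : EuclideanSpace ℝ (Fin 2) | R ≤ ‖y‖ ^ 2 ∧ ‖y‖ ^ 2 ≤ R + D₂}) ?_).trans ?_
    · rintro ξ ⟨-, h⟩
      simp only [modul, Prod.fst_sub, Prod.snd_sub] at h
      have := key ξ
      obtain ⟨h1, h2⟩ := abs_le.1 h
      simp only [Set.mem_preimage, Set.mem_ofPred_eq, ← sub_eq_add_neg]
      constructor <;> linarith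
    · rw [measure_preimage_add_right]
      exact volume_norm_sq_mem_Icc_le R D₂ hD₂

theorem volume_modul_norm_sub_le (z : Freq) {D R : ℝ} (hR : 0 ≤ R) :
    volume {y : Freq | |modul y| ≤ D ∧ ‖(z - y).1‖ ≤ R} ≤
      ENNReal.ofReal (R ^ 2 * Real.pi) * ENNReal.ofReal (2 * D) := by
  refine volume_le_of_modul ?_ (fun y hy => hy.1) fun σ => ?_
  · exact (measurableSet_le continuous_modul.measurable.abs measurable_const).inter
      (measurableSet_le (continuous_fst.comp (continuous_const.sub continuous_id)).norm.measurable
        measurable_const)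
  · refine (measure_mono (t := Metric.closedBall z.1 R) ?_).trans ?_
    · rintro ξ ⟨-, h⟩
      rwa [Metric.mem_closedBall, dist_comm, dist_eq_norm]
    · rw [Measure.addHaar_closedBall_eq_addHaar_ball, EuclideanSpace.volume_ball_fin_two,
        ← ENNReal.ofReal_pow hR, ENNReal.ofReal_mul (by positivity)]

theorem modul_sub (z x : Freq) :
    modul (z - x) = modul z + 2 * inner ℝ x.1 z.1 - (x.2 + ‖x.1‖ ^ 2) := by
  simp only [modul, Prod.fst_sub, Prod.snd_sub, norm_sub_sq_real]
  rw [real_inner_comm]; ring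

theorem inner_smul_two (x ξ : EuclideanSpace ℝ (Fin 2)) :
    inner ℝ ((2 : ℝ) • x) ξ = 2 * inner ℝ x ξ := by
  rw [inner_smul_left]; simp

theorem cross_smul_two_left (x y : EuclideanSpace ℝ (Fin 2)) :
    cross ((2 : ℝ) • x) y = 2 * cross x y := by
  simp [cross]; ring

theorem cross_smul_two_right (x y : EuclideanSpace ℝ (Fin 2)) :
    cross x ((2 : ℝ) • y) = 2 * cross x y := by
  simp [cross]; ring

theorem volume_modul_modul_modul_le {x y : Freq} (h : cross x.1 y.1 ≠ 0) (D D₁ D₂ : ℝ) :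
    volume {z : Freq | |modul z| ≤ D ∧ |modul (z - x)| ≤ D₁ ∧ |modul (z - y)| ≤ D₂} ≤
      ENNReal.ofReal (2 * D₁) * ENNReal.ofReal (2 * D₂) / ENNReal.ofReal (4 * |cross x.1 y.1|) *
        ENNReal.ofReal (2 * D) := by
  refine volume_le_of_modul ?_ (fun y hy => hy.1) fun σ => ?_
  · exact (measurableSet_le continuous_modul.measurable.abs measurable_const).inter
      ((measurableSet_le (continuous_modul.comp (continuous_id.sub continuous_const)).measurable.abs
        measurable_const).inter (measurableSet_le
        (continuous_modul.comp (continuous_id.sub continuous_const)).measurable.abs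
        measurable_const))
  · have hc : cross ((2 : ℝ) • x.1) ((2 : ℝ) • y.1) = 4 * cross x.1 y.1 := by
      rw [cross_smul_two_left, cross_smul_two_right]; ring
    have hc0 : cross ((2 : ℝ) • x.1) ((2 : ℝ) • y.1) ≠ 0 := by
      rw [hc]; exact mul_ne_zero (by norm_num) h
    have habs : |cross ((2 : ℝ) • x.1) ((2 : ℝ) • y.1)| = 4 * |cross x.1 y.1| := by
      rw [hc, abs_mul]; norm_num
    rw [← habs]
    refine (measure_mono ?_).trans (volume_parallelogram_le hc0
      (-(σ - (x.2 + ‖x.1‖ ^ 2))) (-(σ - (y.2 + ‖y.1‖ ^ 2))) D₁ D₂)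
    rintro ξ ⟨-, h1, h2⟩
    rw [modul_sub] at h1 h2
    have e : modul (ξ, σ + ‖ξ‖ ^ 2) = σ := by simp [modul]
    rw [e] at h1 h2
    simp only [Set.mem_ofPred_eq, inner_smul_two]
    constructor
    · convert h1 using 2; ring
    · convert h2 using 2; ring

theorem volume_modul_modul_norm_sub_le {x : Freq} (y : Freq) (h : x.1 ≠ 0) (D D₁ R : ℝ) :
    volume {z : Freq | |modul z| ≤ D ∧ |modul (z - x)| ≤ D₁ ∧ ‖(z - y).1‖ ≤ R} ≤
      ENNReal.ofReal (2 * D₁) * ENNReal.ofReal (2 * (‖x.1‖ * R)) /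
        ENNReal.ofReal (2 * ‖x.1‖ ^ 2) * ENNReal.ofReal (2 * D) := by
  refine volume_le_of_modul ?_ (fun y hy => hy.1) fun σ => ?_
  · exact (measurableSet_le continuous_modul.measurable.abs measurable_const).inter
      ((measurableSet_le (continuous_modul.comp (continuous_id.sub continuous_const)).measurable.abs
        measurable_const).inter (measurableSet_le
        (continuous_fst.comp (continuous_id.sub continuous_const)).norm.measurable
        measurable_const))
  · let v : EuclideanSpace ℝ (Fin 2) := !₂[-(x.1 1), x.1 0]
    have hv : ‖v‖ = ‖x.1‖ := by
      have : ‖v‖ ^ 2 = ‖x.1‖ ^ 2 := by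
        simp only [norm_sq_eq_coord, v]; simp; ring
      exact (sq_eq_sq₀ (norm_nonneg _) (norm_nonneg _)).1 this
    have hc : cross ((2 : ℝ) • x.1) v = 2 * ‖x.1‖ ^ 2 := by
      rw [cross_smul_two_left, norm_sq_eq_coord]; simp [cross, v]; ring
    have hpos : 0 < ‖x.1‖ := norm_pos_iff.2 h
    have hc0 : cross ((2 : ℝ) • x.1) v ≠ 0 := by rw [hc]; positivity
    have habs : |cross ((2 : ℝ) • x.1) v| = 2 * ‖x.1‖ ^ 2 := by
      rw [hc, abs_of_pos (by positivity)]
    rw [← habs]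
    refine (measure_mono ?_).trans (volume_parallelogram_le hc0
      (-(σ - (x.2 + ‖x.1‖ ^ 2))) (inner ℝ v y.1) D₁ (‖x.1‖ * R))
    rintro ξ ⟨-, h1, h2⟩
    rw [modul_sub] at h1
    have e : modul (ξ, σ + ‖ξ‖ ^ 2) = σ := by simp [modul]
    rw [e] at h1
    simp only [Set.mem_ofPred_eq, inner_smul_two]
    constructor
    · convert h1 using 2; ring
    · rw [← inner_sub_right, ← hv]
      refine (abs_real_inner_le_norm _ _).trans ?_
      gcongr
      exact h2

/-! ### Bilinear estimates for functions localized near the paraboloid -/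

/-- The power `2^x` in `[0, ∞]`. -/
def twoPow (x : ℝ) : ℝ≥0∞ := 2 ^ x

theorem twoPow_add (x y : ℝ) : twoPow (x + y) = twoPow x * twoPow y :=
  ENNReal.rpow_add _ _ two_ne_zero ENNReal.ofNat_ne_top

theorem twoPow_zero : twoPow 0 = 1 := ENNReal.rpow_zero

theorem twoPow_natCast (n : ℕ) : twoPow n = 2 ^ n := ENNReal.rpow_natCast _ _

theorem twoPow_sq (x : ℝ) : twoPow x ^ 2 = twoPow (2 * x) := by
  rw [sq, ← twoPow_add, two_mul]

theorem twoPow_two : twoPow 2 = 4 := by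
  have h := twoPow_natCast 2
  rw [Nat.cast_ofNat] at h
  rw [h]; norm_num

theorem twoPow_mono {x y : ℝ} (h : x ≤ y) : twoPow x ≤ twoPow y :=
  ENNReal.rpow_le_rpow_of_exponent_le one_le_two h

theorem ofReal_two_rpow (x : ℝ) : ENNReal.ofReal ((2 : ℝ) ^ x) = twoPow x := by
  rw [← ENNReal.ofReal_rpow_of_pos two_pos, ENNReal.ofReal_ofNat]; rfl

theorem abs_modul_le {z : Freq} {d : ℕ} (h : z ∈ parNhd d) : |modul z| ≤ (2 : ℝ) ^ (d + 1) := by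
  have h2 : 1 + |modul z| < (2 : ℝ) ^ (d + 1) := h.2
  linarith

theorem norm_le_of_mem_annulus {z : Freq} {j : ℕ} (h : z ∈ annulus j) :
    ‖z.1‖ ≤ (2 : ℝ) ^ (j + 1) := by
  have h2 := h.2
  rw [bracketXi_eq] at h2
  linarith

theorem le_norm_of_mem_annulus {z : Freq} {j : ℕ} (hj : 1 ≤ j) (h : z ∈ annulus j) :
    (2 : ℝ) ^ j / 2 ≤ ‖z.1‖ := by
  have h1 := h.1
  rw [bracketXi_eq] at h1
  have : (2 : ℝ) ^ 1 ≤ 2 ^ j := pow_le_pow_right₀ one_le_two hj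
  linarith

theorem l2_lconv_le_of_volume {F G : Freq → ℝ≥0∞} (hF : Measurable F) (hG : Measurable G)
    {S : Set (Freq × Freq)} (hS : MeasurableSet S)
    (hsupp : ∀ z y, F y ≠ 0 → G (z - y) ≠ 0 → (z, y) ∈ S) {B : ℝ≥0∞}
    (h : ∀ z, volume {y | (z, y) ∈ S} ≤ B ^ 2) :
    l2 (lconv F G) ≤ B * (l2 F * l2 G) := by
  have e : lconv F G = bil (fun z y => S.indicator 1 (z, y)) F G := by
    funext z
    refine lintegral_congr fun y => ?_
    by_cases hF0 : F y = 0
    · simp [hF0]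
    by_cases hG0 : G (z - y) = 0
    · simp [hG0]
    simp [hsupp z y hF0 hG0]
  rw [l2_le_iff, e, mul_pow, mul_pow, l2_sq, l2_sq]
  refine lintegral_bil_sq_le_of_right (m := fun z y => S.indicator 1 (z, y))
    (measurable_one.indicator hS) hF hG fun z => ?_
  refine le_trans (le_of_eq ?_) (h z)
  rw [← lintegral_indicator_one (show MeasurableSet {y | (z, y) ∈ S} from
    measurable_prodMk_left hS)]
  refine lintegral_congr fun y => ?_
  by_cases hy : (z, y) ∈ S <;> simp [hy]

theorem l2_bil_indicator_le_of_volume {F G : Freq → ℝ≥0∞} (hF : Measurable F) (hG : Measurable G)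
    {S : Set (Freq × Freq)} (hS : MeasurableSet S) {B : ℝ≥0∞}
    (h : ∀ y x, volume {z | (z, y) ∈ S ∧ (z, z - x) ∈ S} ≤ B ^ 2) :
    l2 (bil (fun z y => S.indicator 1 (z, y)) F G) ≤ B * (l2 F * l2 G) := by
  rw [l2_le_iff, mul_pow, mul_pow, l2_sq, l2_sq]
  refine lintegral_bil_sq_le_of_cross (m := fun z y => S.indicator 1 (z, y))
    (measurable_one.indicator hS) hF hG fun y x => ?_
  refine le_trans (le_of_eq ?_) (h y x)
  have hT : MeasurableSet {z | (z, y) ∈ S ∧ (z, z - x) ∈ S} :=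
    (measurable_prodMk_right hS).inter
      ((measurable_id.prodMk (measurable_id.sub measurable_const)) hS)
  rw [← lintegral_indicator_one hT]
  refine lintegral_congr fun z => ?_
  by_cases h1 : (z, y) ∈ S <;> by_cases h2 : (z, z - x) ∈ S <;> simp [h1, h2]

theorem ofReal_le_mul_twoPow {x c r : ℝ} (h : x ≤ c * (2 : ℝ) ^ r) (hc : 0 ≤ c) :
    ENNReal.ofReal x ≤ ENNReal.ofReal c * twoPow r := by
  rw [← ofReal_two_rpow, ← ENNReal.ofReal_mul hc]
  exact ENNReal.ofReal_le_ofReal h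

theorem two_rpow_nat_add (m n : ℕ) : (2 : ℝ) ^ ((m : ℝ) + n) = 2 ^ m * 2 ^ n := by
  rw [Real.rpow_add two_pos, Real.rpow_natCast, Real.rpow_natCast]

/-- Two functions supported in `B_{d₁}` and `B_{d₂}`: the intersection of a paraboloid
neighbourhood with a reflected one is a thickened circle, whose measure does not depend on its
radius. -/
theorem l2_lconv_le_of_parNhd {F G : Freq → ℝ≥0∞} (hF : Measurable F) (hG : Measurable G)
    {d₁ d₂ : ℕ} (h1 : ∀ z, F z ≠ 0 → z ∈ parNhd d₁) (h2 : ∀ z, G z ≠ 0 → z ∈ parNhd d₂) :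
    l2 (lconv F G) ≤ 8 * twoPow ((d₁ + d₂ : ℝ) / 2) * (l2 F * l2 G) := by
  refine l2_lconv_le_of_volume hF hG (S := {p | |modul p.2| ≤ (2 : ℝ) ^ (d₁ + 1) ∧
    |modul (p.1 - p.2)| ≤ (2 : ℝ) ^ (d₂ + 1)}) ?_
    (fun z y hy hzy => ⟨abs_modul_le (h1 _ hy), abs_modul_le (h2 _ hzy)⟩) fun z => ?_
  · exact (measurableSet_le (continuous_modul.measurable.comp measurable_snd).abs
      measurable_const).inter (measurableSet_le
      (continuous_modul.measurable.comp (measurable_fst.sub measurable_snd)).abs measurable_const)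
  · refine (volume_modul_modul_sub_le z (by positivity)).trans ?_
    rw [← ENNReal.ofReal_mul (by positivity), mul_pow, twoPow_sq,
      show (8 : ℝ≥0∞) ^ 2 = ENNReal.ofReal 64 by norm_num]
    refine ofReal_le_mul_twoPow ?_ (by norm_num)
    rw [show 2 * ((d₁ + d₂ : ℝ) / 2) = (d₁ : ℝ) + d₂ by ring, two_rpow_nat_add, pow_succ, pow_succ]
    have hp : (0 : ℝ) ≤ 2 ^ d₁ * 2 ^ d₂ := by positivity
    nlinarith [Real.pi_le_four]

/-- One function supported in `B_{d₁}`, the other one with bounded spatial frequency. -/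
theorem l2_lconv_le_of_annulus {F G : Freq → ℝ≥0∞} (hF : Measurable F) (hG : Measurable G)
    {d₁ l : ℕ} (h1 : ∀ z, F z ≠ 0 → z ∈ parNhd d₁) (h2 : ∀ z, G z ≠ 0 → z ∈ annulus l) :
    l2 (lconv F G) ≤ 8 * twoPow (l + d₁ / 2) * (l2 F * l2 G) := by
  refine l2_lconv_le_of_volume hF hG (S := {p | |modul p.2| ≤ (2 : ℝ) ^ (d₁ + 1) ∧
    ‖(p.1 - p.2).1‖ ≤ (2 : ℝ) ^ (l + 1)}) ?_
    (fun z y hy hzy => ⟨abs_modul_le (h1 _ hy), norm_le_of_mem_annulus (h2 _ hzy)⟩) fun z => ?_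
  · exact (measurableSet_le (continuous_modul.measurable.comp measurable_snd).abs
      measurable_const).inter (measurableSet_le
      (measurable_fst.sub measurable_snd).fst.norm measurable_const)
  · refine (volume_modul_norm_sub_le z (by positivity)).trans ?_
    rw [← ENNReal.ofReal_mul (by positivity), mul_pow, twoPow_sq,
      show (8 : ℝ≥0∞) ^ 2 = ENNReal.ofReal 64 by norm_num]
    refine ofReal_le_mul_twoPow ?_ (by norm_num)
    rw [show 2 * ((l : ℝ) + d₁ / 2) = (2 * l : ℕ) + (d₁ : ℝ) by push_cast; ring, two_rpow_nat_add,
      pow_succ 2 l, pow_succ 2 d₁, pow_mul']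
    have hp : (0 : ℝ) ≤ (2 ^ l) ^ 2 * 2 ^ d₁ := by positivity
    nlinarith [Real.pi_le_four]

theorem ofReal_mul_div_mul {a b c d : ℝ} (ha : 0 ≤ a) (hb : 0 ≤ b) (hc : 0 < c) :
    ENNReal.ofReal a * ENNReal.ofReal b / ENNReal.ofReal c * ENNReal.ofReal d =
      ENNReal.ofReal (a * b / c * d) := by
  rw [← ENNReal.ofReal_mul ha, ← ENNReal.ofReal_div_of_pos hc, ← ENNReal.ofReal_mul (by positivity)]

/-- One input and the output near the paraboloid, the other input of spatial frequency `2^l`.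
The difference of the two phases is affine in the output frequency, with gradient of size `2^l`,
and it restricts this frequency to a strip in a ball of radius `2^l`. -/
theorem l2_indicator_lconv_le_of_annulus {F G : Freq → ℝ≥0∞} (hF : Measurable F)
    (hG : Measurable G) {d d₁ l : ℕ} (hl : 1 ≤ l) (h1 : ∀ z, F z ≠ 0 → z ∈ parNhd d₁)
    (h2 : ∀ z, G z ≠ 0 → z ∈ annulus l) :
    l2 ((parNhd d).indicator (lconv F G)) ≤
      8 * twoPow ((d + d₁ : ℝ) / 2) * (l2 F * l2 G) := by
  let S : Set (Freq × Freq) := {p | p.1 ∈ parNhd d ∧ p.2 ∈ parNhd d₁ ∧ p.1 - p.2 ∈ annulus l}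
  have hS : MeasurableSet S :=
    (measurable_fst (measurableSet_parNhd d)).inter
      ((measurable_snd (measurableSet_parNhd d₁)).inter
        ((measurable_fst.sub measurable_snd) (measurableSet_annulus l)))
  have e : (parNhd d).indicator (lconv F G) = bil (fun z y => S.indicator 1 (z, y)) F G := by
    funext z
    by_cases hz : z ∈ parNhd d
    · rw [Set.indicator_of_mem hz]
      refine lintegral_congr fun y => ?_
      by_cases hF0 : F y = 0
      · simp [hF0]
      by_cases hG0 : G (z - y) = 0
      · simp [hG0]
      have : (z, y) ∈ S := ⟨hz, h1 _ hF0, h2 _ hG0⟩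
      simp [this]
    · rw [Set.indicator_of_notMem hz, bil]
      symm
      have : ∀ y, (z, y) ∉ S := fun y hy => hz hy.1
      simp [this]
  rw [e]
  refine l2_bil_indicator_le_of_volume hF hG hS fun y x => ?_
  by_cases hx : x ∈ annulus l
  · have hxn := le_norm_of_mem_annulus hl hx
    have hx0 : 0 < ‖x.1‖ := lt_of_lt_of_le (by positivity) hxn
    refine (measure_mono ?_).trans ((volume_modul_modul_norm_sub_le (x := x) y
      (norm_pos_iff.1 hx0) (2 ^ (d + 1)) (2 ^ (d₁ + 1)) (2 ^ (l + 1))).trans ?_)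
    · rintro z ⟨⟨hz, -, hzy⟩, -, hzx, -⟩
      exact ⟨abs_modul_le hz, abs_modul_le hzx, norm_le_of_mem_annulus hzy⟩
    · rw [ofReal_mul_div_mul (by positivity) (by positivity) (by positivity), mul_pow, twoPow_sq,
        show (8 : ℝ≥0∞) ^ 2 = ENNReal.ofReal 64 by norm_num]
      refine ofReal_le_mul_twoPow ?_ (by norm_num)
      rw [show 2 * ((d + d₁ : ℝ) / 2) = (d : ℝ) + d₁ by ring, two_rpow_nat_add]
      have hq : (2 : ℝ) ^ (l + 1) / ‖x.1‖ ≤ 4 := by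
        rw [div_le_iff₀ hx0, pow_succ]; linarith
      calc 2 * (2 : ℝ) ^ (d₁ + 1) * (2 * (‖x.1‖ * 2 ^ (l + 1))) / (2 * ‖x.1‖ ^ 2) *
            (2 * 2 ^ (d + 1))
          = 16 * (2 ^ d * 2 ^ d₁) * ((2 : ℝ) ^ (l + 1) / ‖x.1‖) := by
            field_simp; ring
        _ ≤ 16 * (2 ^ d * 2 ^ d₁) * 4 := by gcongr
        _ = 64 * (2 ^ d * 2 ^ d₁) := by ring
  · have : {z | (z, y) ∈ S ∧ (z, z - x) ∈ S} = ∅ := by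
      refine Set.eq_empty_of_forall_notMem ?_
      rintro z ⟨-, -, -, h⟩
      exact hx (by simpa using h)
    rw [this]; simp

/-- Finitely many directions such that every vector of the plane makes a small angle with one of
them. -/
theorem exists_directions : ∃ T : Finset (EuclideanSpace ℝ (Fin 2)),
    ∀ ξ : EuclideanSpace ℝ (Fin 2), ξ ≠ 0 → ∃ e ∈ T, ‖ξ - ‖ξ‖ • e‖ ≤ 1 / 8 * ‖ξ‖ := by
  obtain ⟨t, -, htf, hcov⟩ := (isCompact_sphere (0 : EuclideanSpace ℝ (Fin 2)) 1).finite_cover_balls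
    (e := 1 / 8) (by norm_num)
  refine ⟨htf.toFinset, fun ξ hξ => ?_⟩
  have hpos : 0 < ‖ξ‖ := norm_pos_iff.2 hξ
  have hmem : ‖ξ‖⁻¹ • ξ ∈ Metric.sphere (0 : EuclideanSpace ℝ (Fin 2)) 1 := by
    rw [mem_sphere_zero_iff_norm, norm_smul, norm_inv, norm_norm, inv_mul_cancel₀ hpos.ne']
  obtain ⟨e, he, hb⟩ := Set.mem_iUnion₂.1 (hcov hmem)
  refine ⟨e, htf.mem_toFinset.2 he, ?_⟩
  rw [Metric.mem_ball, dist_eq_norm] at hb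
  have : ξ - ‖ξ‖ • e = ‖ξ‖ • (‖ξ‖⁻¹ • ξ - e) := by
    rw [smul_sub, smul_inv_smul₀ hpos.ne']
  rw [this, norm_smul, norm_norm, mul_comm]
  gcongr

theorem cross_decomp (u v e : EuclideanSpace ℝ (Fin 2)) :
    cross u v = ‖v‖ * cross u e + cross u (v - ‖v‖ • e) := by
  simp [cross]; ring

theorem half_le_abs_cross {u v x e : EuclideanSpace ℝ (Fin 2)} (hv0 : v ≠ 0)
    (huv : |inner ℝ u v| ≤ 1 / 2 * (‖u‖ * ‖v‖)) (hv : ‖v - ‖v‖ • e‖ ≤ 1 / 8 * ‖v‖)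
    (hx : ‖x - ‖x‖ • e‖ ≤ 1 / 8 * ‖x‖) : 1 / 2 * (‖u‖ * ‖x‖) ≤ |cross x u| := by
  have hpos : 0 < ‖v‖ := norm_pos_iff.2 hv0
  have h1 : 3 / 4 * (‖u‖ * ‖v‖) ≤ |cross u v| := by
    refine abs_le_of_sq_le_sq' ?_ (abs_nonneg _) |>.2
    rw [sq_abs]
    have h2 := cross_sq_add_inner_sq u v
    have h3 : (inner ℝ u v : ℝ) ^ 2 ≤ (1 / 2 * (‖u‖ * ‖v‖)) ^ 2 := sq_le_sq' (by
      linarith [(abs_le.1 huv).1]) (abs_le.1 huv).2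
    nlinarith [sq_nonneg (‖u‖ * ‖v‖)]
  have h2 : 5 / 8 * ‖u‖ ≤ |cross u e| := by
    have e1 := abs_add_le (‖v‖ * cross u e) (cross u (v - ‖v‖ • e))
    rw [← cross_decomp, abs_mul, abs_norm] at e1
    have e2 := abs_cross_le u (v - ‖v‖ • e)
    have e3 : ‖u‖ * ‖v - ‖v‖ • e‖ ≤ ‖u‖ * (1 / 8 * ‖v‖) := by gcongr
    refine le_of_mul_le_mul_left ?_ hpos
    nlinarith
  have e1 := abs_sub_abs_le_abs_sub (‖x‖ * cross u e) (-cross u (x - ‖x‖ • e))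
  rw [sub_neg_eq_add, ← cross_decomp, abs_mul, abs_norm, abs_neg] at e1
  have e2 := abs_cross_le u (x - ‖x‖ • e)
  have e3 : ‖u‖ * ‖x - ‖x‖ • e‖ ≤ ‖u‖ * (1 / 8 * ‖x‖) := by gcongr
  have e4 : |cross x u| = |cross u x| := by
    rw [← abs_neg]; congr 1; simp [cross]; ring
  rw [e4]
  nlinarith [norm_nonneg x]

/-- The interactions of frequencies `ξ₁ ∈ A_{j₁}`, `ξ₂ ∈ A_{j₂}` that are almost orthogonal, with
`ξ₂` close to the direction `e`, all three functions being localized near the paraboloid. -/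
def transverseSet (j₁ d₁ j₂ d₂ d : ℕ) (e : EuclideanSpace ℝ (Fin 2)) : Set (Freq × Freq) :=
  {p | (p.1 ∈ parNhd d ∧ (p.2 ∈ annulus j₁ ∧ p.2 ∈ parNhd d₁) ∧
      (p.1 - p.2 ∈ annulus j₂ ∧ p.1 - p.2 ∈ parNhd d₂)) ∧
    |inner ℝ p.2.1 (p.1 - p.2).1| ≤ 1 / 2 * (‖p.2.1‖ * ‖(p.1 - p.2).1‖) ∧
    ‖(p.1 - p.2).1 - ‖(p.1 - p.2).1‖ • e‖ ≤ 1 / 8 * ‖(p.1 - p.2).1‖}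

theorem measurableSet_transverseSet (j₁ d₁ j₂ d₂ d : ℕ) (e : EuclideanSpace ℝ (Fin 2)) :
    MeasurableSet (transverseSet j₁ d₁ j₂ d₂ d e) := by
  have hs : Measurable fun p : Freq × Freq => p.1 - p.2 := measurable_fst.sub measurable_snd
  have hi : Measurable fun p : Freq × Freq => (inner ℝ p.2.1 (p.1 - p.2).1 : ℝ) :=
    measurable_snd.fst.inner hs.fst
  refine MeasurableSet.inter (MeasurableSet.inter ?_ (MeasurableSet.inter
    (MeasurableSet.inter ?_ ?_) (MeasurableSet.inter ?_ ?_))) (MeasurableSet.inter ?_ ?_)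
  · exact measurable_fst (measurableSet_parNhd d)
  · exact measurable_snd (measurableSet_annulus _)
  · exact measurable_snd (measurableSet_parNhd _)
  · exact hs (measurableSet_annulus _)
  · exact hs (measurableSet_parNhd _)
  · exact measurableSet_le hi.abs (measurable_const.mul (measurable_snd.fst.norm.mul hs.fst.norm))
  · exact measurableSet_le (hs.fst.sub (hs.fst.norm.smul measurable_const)).norm
      (measurable_const.mul hs.fst.norm)

/-- The transversal case. The map `z ↦ (σ(z), σ(z - x), σ(z - y))` with `σ(z) = τ - |ξ|²` is affine
in the coordinates `(ξ, σ)`, with determinant comparable to the area spanned by the spatial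
frequencies of `x` and `y`. -/
theorem l2_bil_transverseSet_le {F G : Freq → ℝ≥0∞} (hF : Measurable F) (hG : Measurable G)
    {j₁ d₁ j₂ d₂ d : ℕ} (hj₁ : 1 ≤ j₁) (hj₂ : 1 ≤ j₂) (e : EuclideanSpace ℝ (Fin 2)) :
    l2 (bil (fun z y => (transverseSet j₁ d₁ j₂ d₂ d e).indicator 1 (z, y)) F G) ≤
      12 * twoPow ((d + d₁ + d₂ - j₁ - j₂ : ℝ) / 2) * (l2 F * l2 G) := by
  refine l2_bil_indicator_le_of_volume hF hG (measurableSet_transverseSet _ _ _ _ _ _) fun y x => ?_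
  rcases Set.eq_empty_or_nonempty {z | (z, y) ∈ transverseSet j₁ d₁ j₂ d₂ d e ∧
    (z, z - x) ∈ transverseSet j₁ d₁ j₂ d₂ d e} with h0 | ⟨w, hw⟩
  · rw [h0]; simp
  obtain ⟨⟨⟨-, ⟨hy, -⟩, ⟨hwy, -⟩⟩, hang, hsec⟩, ⟨-, -, ⟨hx, -⟩⟩, -, hsecx⟩ := hw
  simp only [sub_sub_cancel] at hx hsecx
  dsimp only at hang hsec hy hwy
  have hy' := le_norm_of_mem_annulus hj₁ hy
  have hx' := le_norm_of_mem_annulus hj₂ hx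
  have hwy' := le_norm_of_mem_annulus hj₂ hwy
  have hwy0 : (w - y).1 ≠ 0 := norm_pos_iff.1 (lt_of_lt_of_le (by positivity) hwy')
  have hc := half_le_abs_cross hwy0 hang hsec hsecx
  have hc' : (2 : ℝ) ^ j₁ * 2 ^ j₂ / 8 ≤ |cross x.1 y.1| := by
    refine le_trans ?_ hc
    have : (2 : ℝ) ^ j₁ / 2 * (2 ^ j₂ / 2) ≤ ‖y.1‖ * ‖x.1‖ := by gcongr
    linarith
  have hcpos : 0 < |cross x.1 y.1| := lt_of_lt_of_le (by positivity) hc'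
  refine (measure_mono ?_).trans ((volume_modul_modul_modul_le (abs_pos.1 hcpos)
    (2 ^ (d + 1)) (2 ^ (d₁ + 1)) (2 ^ (d₂ + 1))).trans ?_)
  · rintro z ⟨⟨⟨hz, -, ⟨-, hzy⟩⟩, -⟩, ⟨-, ⟨-, hzx⟩, -⟩, -⟩
    exact ⟨abs_modul_le hz, abs_modul_le hzx, abs_modul_le hzy⟩
  · rw [ofReal_mul_div_mul (by positivity) (by positivity) (by positivity), mul_pow, twoPow_sq,
      show (12 : ℝ≥0∞) ^ 2 = ENNReal.ofReal 144 by norm_num]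
    refine ofReal_le_mul_twoPow ?_ (by norm_num)
    rw [show 2 * ((d + d₁ + d₂ - j₁ - j₂ : ℝ) / 2) = (d : ℝ) + d₁ + d₂ - (j₁ + j₂) by ring,
      Real.rpow_sub two_pos, two_rpow_nat_add, Real.rpow_add two_pos, two_rpow_nat_add,
      Real.rpow_natCast]
    calc 2 * (2 : ℝ) ^ (d₁ + 1) * (2 * 2 ^ (d₂ + 1)) / (4 * |cross x.1 y.1|) * (2 * 2 ^ (d + 1))
        ≤ 2 * (2 : ℝ) ^ (d₁ + 1) * (2 * 2 ^ (d₂ + 1)) / (4 * (2 ^ j₁ * 2 ^ j₂ / 8)) *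
            (2 * 2 ^ (d + 1)) := by gcongr
      _ = 128 * (2 ^ d * 2 ^ d₁ * 2 ^ d₂ / (2 ^ j₁ * 2 ^ j₂)) := by
          field_simp; ring
      _ ≤ 144 * (2 ^ d * 2 ^ d₁ * 2 ^ d₂ / (2 ^ j₁ * 2 ^ j₂)) := by
          have : (0 : ℝ) ≤ 2 ^ d * 2 ^ d₁ * 2 ^ d₂ / (2 ^ j₁ * 2 ^ j₂) := by positivity
          linarith

theorem measurable_bil_indicator {S : Set (Freq × Freq)} (hS : MeasurableSet S)
    {F G : Freq → ℝ≥0∞} (hF : Measurable F) (hG : Measurable G) :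
    Measurable (bil (fun z y => S.indicator 1 (z, y)) F G) :=
  measurable_bil (m := fun z y => S.indicator 1 (z, y)) (measurable_one.indicator hS) hF hG

/-- The full trilinear estimate near the paraboloid. Either the interaction is transversal, or one
of the three functions is at distance at least `2^(j₁ + j₂)`, up to a constant, from the
paraboloid. -/
theorem exists_l2_indicator_lconv_le : ∃ C : ℝ≥0, ∀ (F G : Freq → ℝ≥0∞) (j₁ d₁ j₂ d₂ d : ℕ),
    Measurable F → Measurable G → 1 ≤ j₁ → 1 ≤ j₂ →
    (∀ z, F z ≠ 0 → z ∈ annulus j₁ ∩ parNhd d₁) → (∀ z, G z ≠ 0 → z ∈ annulus j₂ ∩ parNhd d₂) →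
    l2 ((parNhd d).indicator (lconv F G)) ≤
      C * twoPow ((d + d₁ + d₂ - j₁ - j₂ : ℝ) / 2) * (l2 F * l2 G) := by
  obtain ⟨T, hT⟩ := exists_directions
  refine ⟨32 + 12 * T.card, fun F G j₁ d₁ j₂ d₂ d hF hG hj₁ hj₂ hFs hGs => ?_⟩
  have far : ∀ x y : ℝ, x ≤ 4 + y → 8 * twoPow (x / 2) * (l2 F * l2 G) ≤
      ((32 + 12 * T.card : ℝ≥0) : ℝ≥0∞) * twoPow (y / 2) * (l2 F * l2 G) := by
    intro x y h
    have h1 : twoPow (x / 2) ≤ 4 * twoPow (y / 2) := by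
      rw [← twoPow_two, ← twoPow_add]
      exact twoPow_mono (by linarith)
    have h2 : (8 * 4 : ℝ≥0∞) ≤ ((32 + 12 * T.card : ℝ≥0) : ℝ≥0∞) := by
      have : (8 * 4 : ℝ≥0∞) = ((32 : ℝ≥0) : ℝ≥0∞) := by norm_num
      rw [this]
      exact_mod_cast le_self_add
    calc 8 * twoPow (x / 2) * (l2 F * l2 G) ≤ 8 * (4 * twoPow (y / 2)) * (l2 F * l2 G) := by gcongr
      _ = (8 * 4) * twoPow (y / 2) * (l2 F * l2 G) := by ring
      _ ≤ _ := by gcongr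
  have hind : l2 ((parNhd d).indicator (lconv F G)) ≤ l2 (lconv F G) :=
    l2_mono fun z => Set.indicator_le_self _ _ z
  by_cases hd : j₁ + j₂ ≤ d + 4
  · refine (hind.trans (l2_lconv_le_of_parNhd hF hG (fun z hz => (hFs z hz).2)
      fun z hz => (hGs z hz).2)).trans (far _ _ ?_)
    have : (j₁ + j₂ : ℝ) ≤ d + 4 := by exact_mod_cast hd
    linarith
  by_cases hd₁ : j₁ + j₂ ≤ d₁ + 4
  · rw [show lconv F G = lconv G F from funext fun z => lconv_comm F G z]
    have := l2_indicator_lconv_le_of_annulus (d := d) hG hF hj₁ (fun z hz => (hGs z hz).2)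
      (fun z hz => (hFs z hz).1)
    rw [mul_comm (l2 G)] at this
    refine this.trans (far _ _ ?_)
    have : (j₁ + j₂ : ℝ) ≤ d₁ + 4 := by exact_mod_cast hd₁
    linarith
  by_cases hd₂ : j₁ + j₂ ≤ d₂ + 4
  · refine (l2_indicator_lconv_le_of_annulus (d := d) hF hG hj₂ (fun z hz => (hFs z hz).2)
      (fun z hz => (hGs z hz).1)).trans (far _ _ ?_)
    have : (j₁ + j₂ : ℝ) ≤ d₂ + 4 := by exact_mod_cast hd₂
    linarith
  have hpt : ∀ z, (parNhd d).indicator (lconv F G) z ≤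
      ∑ e ∈ T, bil (fun z y => (transverseSet j₁ d₁ j₂ d₂ d e).indicator 1 (z, y)) F G z := by
    intro z
    by_cases hz : z ∈ parNhd d
    swap
    · rw [Set.indicator_of_notMem hz]; exact zero_le
    rw [Set.indicator_of_mem hz]
    unfold bil
    rw [← lintegral_finsetSum']
    swap
    · intro e _
      exact (((measurable_one.indicator (measurableSet_transverseSet j₁ d₁ j₂ d₂ d e)).comp
        measurable_prodMk_left).mul
        (hF.mul (hG.comp (measurable_const.sub measurable_id)))).aemeasurable
    refine lintegral_mono fun y => ?_
    by_cases hF0 : F y = 0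
    · simp [hF0]
    by_cases hG0 : G (z - y) = 0
    · simp [hG0]
    obtain ⟨ya, yp⟩ := hFs y hF0
    obtain ⟨xa, xp⟩ := hGs _ hG0
    have ny := le_norm_of_mem_annulus hj₁ ya
    have nx := le_norm_of_mem_annulus hj₂ xa
    have hx0 : (z - y).1 ≠ 0 := norm_pos_iff.1 (lt_of_lt_of_le (by positivity) nx)
    obtain ⟨e, heT, he⟩ := hT _ hx0
    have hang : |inner ℝ y.1 (z - y).1| ≤ 1 / 2 * (‖y.1‖ * ‖(z - y).1‖) := by
      have m0 := abs_modul_le hz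
      have m1 := abs_modul_le yp
      have m2 := abs_modul_le xp
      have key : 2 * inner ℝ y.1 (z - y).1 = modul y + modul (z - y) - modul z := by
        have : z.1 = y.1 + (z - y).1 := by simp
        simp only [modul, Prod.snd_sub]
        rw [show ‖z.1‖ ^ 2 = ‖y.1 + (z - y).1‖ ^ 2 by rw [← this], norm_add_sq_real]
        ring
      have hb : ∀ n : ℕ, ¬ j₁ + j₂ ≤ n + 4 → 8 * (2 : ℝ) ^ (n + 1) ≤ 2 ^ j₁ * 2 ^ j₂ / 2 := by
        intro n hn
        have : (2 : ℝ) ^ (n + 5) ≤ 2 ^ (j₁ + j₂) := pow_le_pow_right₀ one_le_two (by omega)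
        rw [pow_add, pow_add 2 j₁] at this
        rw [pow_succ]
        linarith
      have b0 := hb d hd
      have b1 := hb d₁ hd₁
      have b2 := hb d₂ hd₂
      have hprod : (2 : ℝ) ^ j₁ / 2 * (2 ^ j₂ / 2) ≤ ‖y.1‖ * ‖(z - y).1‖ := by gcongr
      rw [abs_le] at m0 m1 m2 ⊢
      constructor <;> linarith
    have hmem : (z, y) ∈ transverseSet j₁ d₁ j₂ d₂ d e :=
      ⟨⟨hz, ⟨ya, yp⟩, ⟨xa, xp⟩⟩, hang, he⟩
    refine le_trans ?_ (Finset.single_le_sum (f := fun e =>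
      (transverseSet j₁ d₁ j₂ d₂ d e).indicator (1 : Freq × Freq → ℝ≥0∞) (z, y) *
        (F y * G (z - y))) (fun _ _ => zero_le) heT)
    simp [hmem]
  refine (l2_mono hpt).trans ((l2_sum_le T fun e =>
    measurable_bil_indicator (measurableSet_transverseSet _ _ _ _ _ _) hF hG).trans ?_)
  refine (Finset.sum_le_sum fun e _ => l2_bil_transverseSet_le hF hG hj₁ hj₂ e).trans ?_
  rw [Finset.sum_const, nsmul_eq_mul, mul_assoc, mul_assoc, ← mul_assoc (T.card : ℝ≥0∞)]
  have hC : (T.card : ℝ≥0∞) * 12 ≤ ((32 + 12 * T.card : ℝ≥0) : ℝ≥0∞) := by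
    push_cast
    rw [mul_comm]
    exact le_add_self
  gcongr

/-! ### The norms of `[0, ∞]`-valued functions and their embeddings -/

/-- The restriction of `F` to the block `A_j ∩ B_d`. -/
def block (F : Freq → ℝ≥0∞) (j d : ℕ) : Freq → ℝ≥0∞ := (annulus j ∩ parNhd d).indicator F

/-- The contribution of the annulus `A_j` to the norm of `X̂^{s,1/2,1}`. -/
def xPart (s : ℝ) (F : Freq → ℝ≥0∞) (j : ℕ) : ℝ≥0∞ :=
  twoPow (s * j) * ∑' d : ℕ, twoPow (d / 2) * l2 (block F j d)

/-- The norm of `X̂^{s,1/2,1}` for functions with values in `[0, ∞]`. -/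
def xN (s : ℝ) (F : Freq → ℝ≥0∞) : ℝ≥0∞ := (∑' j : ℕ, xPart s F j ^ 2) ^ (1 / 2 : ℝ)

/-- The norm of `L²_ξ L¹_τ` for functions with values in `[0, ∞]`. -/
def mixN (F : Freq → ℝ≥0∞) : ℝ≥0∞ := l2 fun ξ : EuclideanSpace ℝ (Fin 2) => ∫⁻ τ : ℝ, F (ξ, τ)

/-- Multiplication by a real weight, which stands for its positive part. -/
def wmul (v : Freq → ℝ) (F : Freq → ℝ≥0∞) : Freq → ℝ≥0∞ := fun z => ENNReal.ofReal (v z) * F z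

/-- The norm of `Y^s` for functions with values in `[0, ∞]`. -/
def yN (s : ℝ) (F : Freq → ℝ≥0∞) : ℝ≥0∞ :=
  mixN (wmul (fun z => bracketXi z ^ s) F) + l2 (wmul (fun z => bracketPar z ^ (s + 1)) F)

theorem measurableSet_block (j d : ℕ) : MeasurableSet (annulus j ∩ parNhd d) :=
  (measurableSet_annulus j).inter (measurableSet_parNhd d)

theorem measurable_block {F : Freq → ℝ≥0∞} (hF : Measurable F) (j d : ℕ) :
    Measurable (block F j d) := hF.indicator (measurableSet_block j d)

theorem measurable_wmul {v : Freq → ℝ} {F : Freq → ℝ≥0∞} (hv : Measurable v) (hF : Measurable F) :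
    Measurable (wmul v F) := hv.ennreal_ofReal.mul hF

theorem measurable_bracketXi_rpow (s : ℝ) : Measurable fun z => bracketXi z ^ s :=
  continuous_bracketXi.measurable.pow_const s

theorem measurable_bracketPar_rpow (s : ℝ) : Measurable fun z => bracketPar z ^ s :=
  continuous_bracketPar.measurable.pow_const s

theorem block_mem {F : Freq → ℝ≥0∞} {j d : ℕ} {z : Freq} (h : block F j d z ≠ 0) :
    z ∈ annulus j ∩ parNhd d := by
  by_contra hc
  exact h (Set.indicator_of_notMem hc _)

theorem block_le (F : Freq → ℝ≥0∞) (j d : ℕ) (z : Freq) : block F j d z ≤ F z :=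
  Set.indicator_le_self _ _ z

theorem tsum_block (F : Freq → ℝ≥0∞) (z : Freq) : ∑' (j : ℕ) (d : ℕ), block F j d z = F z := by
  obtain ⟨j, hj⟩ := exists_mem_annulus z
  obtain ⟨d, hd⟩ := exists_mem_parNhd z
  rw [tsum_eq_single j, tsum_eq_single d]
  · simp [block, hj, hd]
  · intro d' hd'
    exact Set.indicator_of_notMem (fun h => hd' (parNhd_unique h.2 hd)) _
  · intro j' hj'
    refine ENNReal.tsum_eq_zero.2 fun d' => ?_
    exact Set.indicator_of_notMem (fun h => hj' (annulus_unique h.1 hj)) _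

theorem lintegral_eq_tsum_block {F : Freq → ℝ≥0∞} (hF : Measurable F) :
    ∫⁻ z, F z = ∑' (j : ℕ) (d : ℕ), ∫⁻ z, block F j d z := by
  calc ∫⁻ z, F z = ∫⁻ z, ∑' (j : ℕ) (d : ℕ), block F j d z := by simp_rw [tsum_block]
    _ = ∑' j : ℕ, ∫⁻ z, ∑' d : ℕ, block F j d z :=
        lintegral_tsum fun j => (Measurable.tsum fun d => measurable_block hF j d).aemeasurable
    _ = _ := by
        refine tsum_congr fun j => ?_
        exact lintegral_tsum fun d => (measurable_block hF j d).aemeasurable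

theorem block_sq (F : Freq → ℝ≥0∞) (j d : ℕ) (z : Freq) :
    block (fun z => F z ^ 2) j d z = block F j d z ^ 2 := by
  by_cases h : z ∈ annulus j ∩ parNhd d <;> simp [block, h]

theorem l2_sq_eq_tsum_block {F : Freq → ℝ≥0∞} (hF : Measurable F) :
    l2 F ^ 2 = ∑' (j : ℕ) (d : ℕ), l2 (block F j d) ^ 2 := by
  rw [l2_sq, lintegral_eq_tsum_block (hF.pow_const 2)]
  simp_rw [l2_sq, block_sq]

theorem tsum_sq_le_sq_tsum (u : ℕ → ℝ≥0∞) : ∑' n, u n ^ 2 ≤ (∑' n, u n) ^ 2 := by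
  rw [sq (∑' n, u n), ← ENNReal.tsum_mul_right]
  refine ENNReal.tsum_le_tsum fun n => ?_
  rw [sq]
  gcongr
  exact ENNReal.le_tsum n

theorem xN_sq (s : ℝ) (F : Freq → ℝ≥0∞) : xN s F ^ 2 = ∑' j : ℕ, xPart s F j ^ 2 := rpow_half_sq _

theorem xPart_le_xN (s : ℝ) (F : Freq → ℝ≥0∞) (j : ℕ) : xPart s F j ≤ xN s F := by
  rw [← sq_le_sq_ennreal, xN_sq]
  exact ENNReal.le_tsum (f := fun j => xPart s F j ^ 2) j

theorem block_mono {F G : Freq → ℝ≥0∞} (h : ∀ z, F z ≤ G z) (j d : ℕ) (z : Freq) :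
    block F j d z ≤ block G j d z := Set.indicator_le_indicator (h z)

theorem xPart_mono_ae {F G : Freq → ℝ≥0∞} (h : ∀ᵐ z, F z ≤ G z) (s : ℝ) (j : ℕ) :
    xPart s F j ≤ xPart s G j := by
  unfold xPart
  gcongr with d
  exact l2_mono_ae (h.mono fun z hz => Set.indicator_le_indicator hz)

theorem xN_mono_ae {F G : Freq → ℝ≥0∞} (h : ∀ᵐ z, F z ≤ G z) (s : ℝ) : xN s F ≤ xN s G := by
  rw [← sq_le_sq_ennreal, xN_sq, xN_sq]
  gcongr with j
  exact xPart_mono_ae h s j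

theorem wmul_mono {v : Freq → ℝ} {F G : Freq → ℝ≥0∞} {z : Freq} (h : F z ≤ G z) :
    wmul v F z ≤ wmul v G z := by
  unfold wmul; gcongr

theorem ae_ae_freq {P : Freq → Prop} (h : ∀ᵐ z, P z) :
    ∀ᵐ ξ : EuclideanSpace ℝ (Fin 2), ∀ᵐ τ : ℝ, P (ξ, τ) := by
  rw [Measure.volume_eq_prod] at h
  exact Measure.ae_ae_of_ae_prod h

theorem mixN_mono_ae {F G : Freq → ℝ≥0∞} (h : ∀ᵐ z, F z ≤ G z) : mixN F ≤ mixN G :=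
  l2_mono_ae ((ae_ae_freq h).mono fun _ hξ => lintegral_mono_ae hξ)

theorem yN_mono_ae {F G : Freq → ℝ≥0∞} (h : ∀ᵐ z, F z ≤ G z) (s : ℝ) : yN s F ≤ yN s G := by
  unfold yN
  gcongr
  · exact mixN_mono_ae (h.mono fun z hz => wmul_mono hz)
  · exact l2_mono_ae (h.mono fun z hz => wmul_mono hz)

theorem measurable_lintegral_snd {F : Freq → ℝ≥0∞} (hF : Measurable F) :
    Measurable fun ξ : EuclideanSpace ℝ (Fin 2) => ∫⁻ τ : ℝ, F (ξ, τ) :=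
  hF.lintegral_prod_right'

theorem xPart_add_le {F G : Freq → ℝ≥0∞} (hF : Measurable F) (hG : Measurable G) (s : ℝ) (j : ℕ) :
    xPart s (fun z => F z + G z) j ≤ xPart s F j + xPart s G j := by
  unfold xPart
  rw [← mul_add, ← ENNReal.tsum_add]
  gcongr with d
  rw [← mul_add]
  gcongr
  refine le_trans (le_of_eq ?_) (l2_add_le (measurable_block hF j d).aemeasurable
    (measurable_block hG j d).aemeasurable)
  congr 1
  exact Set.indicator_add _ _ _

theorem add_sq_le_two (x y : ℝ≥0∞) : (x + y) ^ 2 ≤ 2 * (x ^ 2 + y ^ 2) := by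
  rcases eq_or_ne x ⊤ with rfl | hx
  · simp
  rcases eq_or_ne y ⊤ with rfl | hy
  · simp
  lift x to ℝ≥0 using hx
  lift y to ℝ≥0 using hy
  have := add_sq_le (a := x) (b := y)
  exact_mod_cast this

theorem xN_add_le {F G : Freq → ℝ≥0∞} (hF : Measurable F) (hG : Measurable G) (s : ℝ) :
    xN s (fun z => F z + G z) ≤ 2 * (xN s F + xN s G) := by
  rw [← sq_le_sq_ennreal, xN_sq]
  calc ∑' j, xPart s (fun z => F z + G z) j ^ 2
      ≤ ∑' j, 2 * (xPart s F j ^ 2 + xPart s G j ^ 2) := by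
        gcongr with j
        exact (pow_le_pow_left₀ zero_le (xPart_add_le hF hG s j) 2).trans (add_sq_le_two _ _)
    _ = 2 * (xN s F ^ 2 + xN s G ^ 2) := by
        rw [ENNReal.tsum_mul_left, ENNReal.tsum_add, xN_sq, xN_sq]
    _ ≤ 2 ^ 2 * (xN s F + xN s G) ^ 2 := by
        gcongr
        · norm_num
        · rw [add_sq]
          calc xN s F ^ 2 + xN s G ^ 2 ≤ xN s F ^ 2 + xN s G ^ 2 + 2 * xN s F * xN s G := le_self_add
            _ = _ := by ring
    _ = _ := by rw [mul_pow]

theorem yN_add_le {F G : Freq → ℝ≥0∞} (hF : Measurable F) (hG : Measurable G) (s : ℝ) :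
    yN s (fun z => F z + G z) ≤ yN s F + yN s G := by
  have e : ∀ v, wmul v (fun z => F z + G z) = fun z => wmul v F z + wmul v G z := by
    intro v; funext z; simp only [wmul, mul_add]
  have hX := measurable_bracketXi_rpow s
  have hP := measurable_bracketPar_rpow (s + 1)
  have h1 : mixN (fun z => wmul (fun z => bracketXi z ^ s) F z + wmul (fun z => bracketXi z ^ s) G z)
      ≤ mixN (wmul (fun z => bracketXi z ^ s) F) + mixN (wmul (fun z => bracketXi z ^ s) G) := by
    refine le_trans (le_of_eq ?_) (l2_add_le
      (measurable_lintegral_snd (measurable_wmul hX hF)).aemeasurable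
      (measurable_lintegral_snd (measurable_wmul hX hG)).aemeasurable)
    unfold mixN
    congr 1
    funext ξ
    exact lintegral_add_left ((measurable_wmul hX hF).comp measurable_prodMk_left) _
  have h2 := l2_add_le (measurable_wmul hP hF).aemeasurable (measurable_wmul hP hG).aemeasurable
  unfold yN
  rw [e, e]
  calc _ ≤ _ := add_le_add h1 h2
    _ = _ := by ring

theorem rpow_le_of_mem_annulus {s : ℝ} (hs : s ≤ 0) {z : Freq} {j : ℕ} (h : z ∈ annulus j) :
    bracketXi z ^ s ≤ (2 : ℝ) ^ (s * j) := by
  rw [mul_comm, Real.rpow_mul two_pos.le, Real.rpow_natCast]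
  exact Real.rpow_le_rpow_of_nonpos (by positivity) h.1 hs

theorem l2_wmul_block_le {v : Freq → ℝ} {F : Freq → ℝ≥0∞} (hF : Measurable F) {j d : ℕ} {r : ℝ}
    (h : ∀ z ∈ annulus j ∩ parNhd d, v z ≤ (2 : ℝ) ^ r) :
    l2 (block (wmul v F) j d) ≤ twoPow r * l2 (block F j d) := by
  rw [← l2_const_mul _ (measurable_block hF j d)]
  refine l2_mono fun z => ?_
  by_cases hz : z ∈ annulus j ∩ parNhd d
  · simp only [block, Set.indicator_of_mem hz, wmul]
    gcongr
    rw [← ofReal_two_rpow]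
    exact ENNReal.ofReal_le_ofReal (h z hz)
  · simp [block, hz]

theorem l2_wmul_le_xN {s : ℝ} (hs : s ≤ 0) {F : Freq → ℝ≥0∞} (hF : Measurable F) :
    l2 (wmul (fun z => bracketXi z ^ s * bracketMod z ^ (1 / 2 : ℝ)) F) ≤ 2 * xN s F := by
  have hm : Measurable fun z => bracketXi z ^ s * bracketMod z ^ (1 / 2 : ℝ) :=
    (measurable_bracketXi_rpow s).mul (continuous_bracketMod.measurable.pow_const _)
  rw [← sq_le_sq_ennreal, l2_sq_eq_tsum_block (measurable_wmul hm hF), mul_pow, xN_sq,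
    ← ENNReal.tsum_mul_left]
  refine ENNReal.tsum_le_tsum fun j => ?_
  have h1 : ∀ d : ℕ, l2 (block (wmul (fun z => bracketXi z ^ s * bracketMod z ^ (1 / 2 : ℝ)) F) j d)
      ≤ twoPow (s * j) * (2 * (twoPow (d / 2) * l2 (block F j d))) := by
    intro d
    have h : ∀ z ∈ annulus j ∩ parNhd d,
        bracketXi z ^ s * bracketMod z ^ (1 / 2 : ℝ) ≤ (2 : ℝ) ^ (s * j + (d / 2 + 1)) := by
      rintro z ⟨hj, hd⟩
      rw [Real.rpow_add two_pos]
      have e1 := rpow_le_of_mem_annulus hs hj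
      have e2 : bracketMod z ^ (1 / 2 : ℝ) ≤ (2 : ℝ) ^ ((d : ℝ) / 2 + 1) := by
        calc bracketMod z ^ (1 / 2 : ℝ) ≤ ((2 : ℝ) ^ (d + 1)) ^ (1 / 2 : ℝ) :=
              Real.rpow_le_rpow (bracketMod_pos z).le hd.2.le (by norm_num)
          _ = (2 : ℝ) ^ (((d + 1 : ℕ) : ℝ) * (1 / 2)) := by
              rw [Real.rpow_mul two_pos.le, Real.rpow_natCast]
          _ ≤ _ := Real.rpow_le_rpow_of_exponent_le one_le_two (by push_cast; linarith)
      have := Real.rpow_nonneg (bracketMod_pos z).le (1 / 2 : ℝ)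
      gcongr
    refine (l2_wmul_block_le hF h).trans (le_of_eq ?_)
    have : twoPow 1 = 2 := ENNReal.rpow_one _
    rw [twoPow_add, twoPow_add, this]
    ring
  calc ∑' d : ℕ, l2 (block (wmul (fun z => bracketXi z ^ s * bracketMod z ^ (1 / 2 : ℝ)) F) j d) ^ 2
      ≤ ∑' d : ℕ, (twoPow (s * j) * (2 * (twoPow (d / 2) * l2 (block F j d)))) ^ 2 := by
        gcongr with d; exact h1 d
    _ ≤ (∑' d : ℕ, twoPow (s * j) * (2 * (twoPow (d / 2) * l2 (block F j d)))) ^ 2 :=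
        tsum_sq_le_sq_tsum _
    _ = 2 ^ 2 * xPart s F j ^ 2 := by
        rw [ENNReal.tsum_mul_left, ENNReal.tsum_mul_left, ← mul_pow]
        congr 1
        unfold xPart
        ring

theorem l2_wmul_mono {u v : Freq → ℝ} (F : Freq → ℝ≥0∞) (h : ∀ z, u z ≤ v z) :
    l2 (wmul u F) ≤ l2 (wmul v F) :=
  l2_mono fun z => by unfold wmul; gcongr; exact h z

theorem l2_wmul_bracketXi_le_xN {s : ℝ} (hs : s ≤ 0) {F : Freq → ℝ≥0∞} (hF : Measurable F) :
    l2 (wmul (fun z => bracketXi z ^ s) F) ≤ 2 * xN s F := by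
  refine (l2_wmul_mono F fun z => ?_).trans (l2_wmul_le_xN hs hF)
  have h1 : 1 ≤ bracketMod z ^ (1 / 2 : ℝ) := Real.one_le_rpow (one_le_bracketMod z) (by norm_num)
  have h2 := Real.rpow_nonneg (bracketXi_pos z).le s
  nlinarith

theorem mixN_le_of_parNhd {F : Freq → ℝ≥0∞} (hF : Measurable F) {d : ℕ}
    (h : ∀ z, F z ≠ 0 → z ∈ parNhd d) : mixN F ≤ 2 * twoPow (d / 2) * l2 F := by
  unfold mixN
  rw [l2_le_iff, mul_pow, mul_pow, twoPow_sq, l2_sq, Measure.volume_eq_prod,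
    lintegral_prod _ (hF.pow_const 2).aemeasurable, ← lintegral_const_mul]
  swap
  · exact measurable_lintegral_snd (hF.pow_const 2)
  refine lintegral_mono fun ξ => ?_
  let I : Set ℝ := Set.Icc (‖ξ‖ ^ 2 - 2 ^ (d + 1)) (‖ξ‖ ^ 2 + 2 ^ (d + 1))
  have hI : Measurable (I.indicator (1 : ℝ → ℝ≥0∞)) := measurable_one.indicator measurableSet_Icc
  have hFξ : Measurable fun τ => F (ξ, τ) := hF.comp measurable_prodMk_left
  have e : ∀ τ, F (ξ, τ) = I.indicator (1 : ℝ → ℝ≥0∞) τ * F (ξ, τ) := by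
    intro τ
    by_cases h0 : F (ξ, τ) = 0
    · simp [h0]
    · have h1 := abs_le.1 (abs_modul_le (h _ h0))
      simp only [modul] at h1
      have : τ ∈ I := ⟨by linarith [h1.1], by linarith [h1.2]⟩
      simp [this]
  dsimp only
  rw [lintegral_congr e]
  refine (lintegral_mul_sq_le hI.aemeasurable hFξ.aemeasurable).trans ?_
  gcongr
  have e2 : ∀ τ, I.indicator (1 : ℝ → ℝ≥0∞) τ ^ 2 = I.indicator (1 : ℝ → ℝ≥0∞) τ := by
    intro τ; by_cases hτ : τ ∈ I <;> simp [hτ]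
  rw [lintegral_congr e2, lintegral_indicator_one measurableSet_Icc, Real.volume_Icc,
    show (2 : ℝ≥0∞) ^ 2 = ENNReal.ofReal 4 by norm_num]
  refine ofReal_le_mul_twoPow ?_ (by norm_num)
  rw [show 2 * ((d : ℝ) / 2) = (d : ℕ) by ring, Real.rpow_natCast, pow_succ 2 d]
  linarith

theorem mixN_const_mul (c : ℝ≥0∞) {F : Freq → ℝ≥0∞} (hF : Measurable F) :
    mixN (fun z => c * F z) = c * mixN F := by
  unfold mixN
  rw [← l2_const_mul _ (measurable_lintegral_snd hF)]
  congr 1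
  funext ξ
  exact lintegral_const_mul _ (hF.comp measurable_prodMk_left)

theorem mixN_tsum_le {F : ℕ → Freq → ℝ≥0∞} (hF : ∀ i, Measurable (F i)) :
    mixN (fun z => ∑' i, F i z) ≤ ∑' i, mixN (F i) := by
  unfold mixN
  refine le_trans (le_of_eq ?_) (l2_tsum_le fun i => measurable_lintegral_snd (hF i))
  congr 1
  funext ξ
  exact lintegral_tsum fun i => ((hF i).comp measurable_prodMk_left).aemeasurable

theorem mixN_sq_le_tsum_annulus {F : Freq → ℝ≥0∞} (hF : Measurable F) :
    mixN F ^ 2 ≤ ∑' j : ℕ, mixN ((annulus j).indicator F) ^ 2 := by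
  unfold mixN
  simp_rw [l2_sq]
  rw [← lintegral_tsum]
  · refine lintegral_mono fun ξ => ?_
    obtain ⟨j, hj⟩ := exists_mem_annulus (ξ, 0)
    refine le_trans (le_of_eq ?_) (ENNReal.le_tsum j)
    congr 1
    refine lintegral_congr fun τ => ?_
    rw [Set.indicator_of_mem]
    exact hj
  · intro j
    exact ((measurable_lintegral_snd
      (hF.indicator (measurableSet_annulus j))).pow_const 2).aemeasurable

theorem mixN_wmul_le_xN {s : ℝ} (hs : s ≤ 0) {F : Freq → ℝ≥0∞} (hF : Measurable F) :
    mixN (wmul (fun z => bracketXi z ^ s) F) ≤ 2 * xN s F := by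
  rw [← sq_le_sq_ennreal, mul_pow, xN_sq, ← ENNReal.tsum_mul_left]
  refine (mixN_sq_le_tsum_annulus (measurable_wmul (measurable_bracketXi_rpow s) hF)).trans ?_
  gcongr with j
  rw [← mul_pow]
  gcongr
  calc mixN ((annulus j).indicator (wmul (fun z => bracketXi z ^ s) F))
      ≤ mixN (fun z => twoPow (s * j) * ∑' d : ℕ, block F j d z) := by
        refine mixN_mono_ae (Filter.Eventually.of_forall fun z => ?_)
        by_cases hz : z ∈ annulus j
        · rw [Set.indicator_of_mem hz]
          unfold wmul
          gcongr
          · rw [← ofReal_two_rpow]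
            exact ENNReal.ofReal_le_ofReal (rpow_le_of_mem_annulus hs hz)
          · obtain ⟨d, hd⟩ := exists_mem_parNhd z
            refine le_trans (le_of_eq ?_) (ENNReal.le_tsum d)
            rw [block, Set.indicator_of_mem (show z ∈ annulus j ∩ parNhd d from ⟨hz, hd⟩)]
        · rw [Set.indicator_of_notMem hz]; exact zero_le
    _ = twoPow (s * j) * mixN (fun z => ∑' d : ℕ, block F j d z) :=
        mixN_const_mul _ (Measurable.tsum fun d => measurable_block hF j d)
    _ ≤ twoPow (s * j) * ∑' d : ℕ, mixN (block F j d) := by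
        gcongr; exact mixN_tsum_le fun d => measurable_block hF j d
    _ ≤ twoPow (s * j) * ∑' d : ℕ, 2 * (twoPow (d / 2) * l2 (block F j d)) := by
        gcongr with d
        rw [← mul_assoc]
        exact mixN_le_of_parNhd (measurable_block hF j d) fun z hz => (block_mem hz).2
    _ = 2 * xPart s F j := by
        rw [ENNReal.tsum_mul_left]; unfold xPart; ring

/-- Off `K`, the norm of `Y^s` is controlled by that of `X̂^{s,1/2,1}`. -/
theorem exists_yN_compl_le_xN {s : ℝ} (hs : -1 < s) (hs0 : s < 0) : ∃ C : ℝ≥0,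
    ∀ F : Freq → ℝ≥0∞, Measurable F → yN s (regionKᶜ.indicator F) ≤ C * xN s F := by
  refine ⟨2 + 2 * Real.toNNReal (130 * 32), fun F hF => ?_⟩
  have h1 : mixN (wmul (fun z => bracketXi z ^ s) (regionKᶜ.indicator F)) ≤ 2 * xN s F :=
    (mixN_mono_ae (Filter.Eventually.of_forall fun z =>
      wmul_mono (Set.indicator_le_self _ _ z))).trans (mixN_wmul_le_xN hs0.le hF)
  have h2 : l2 (wmul (fun z => bracketPar z ^ (s + 1)) (regionKᶜ.indicator F)) ≤
      ENNReal.ofReal (130 * 32) * (2 * xN s F) := by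
    have hm : Measurable fun z => bracketXi z ^ s * bracketMod z ^ (1 / 2 : ℝ) :=
      (measurable_bracketXi_rpow s).mul (continuous_bracketMod.measurable.pow_const _)
    refine le_trans ?_ (mul_le_mul_right (l2_wmul_le_xN hs0.le hF) _)
    rw [← l2_const_mul _ (measurable_wmul hm hF)]
    refine l2_mono fun z => ?_
    by_cases hz : z ∈ regionK
    · simp [wmul, hz]
    · simp only [wmul, Set.indicator_of_mem (show z ∈ regionKᶜ from hz)]
      rw [← mul_assoc, ← ENNReal.ofReal_mul (by norm_num)]
      gcongr
      have ha := bracketXi_pos z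
      have hb := bracketMod_pos z
      have hp := bracketPar_pos z
      have e1 : bracketPar z ^ (s + 1) ≤ 130 * bracketMod z ^ ((s + 1) / 2) := by
        calc bracketPar z ^ (s + 1) = (bracketPar z ^ 2) ^ ((s + 1) / 2) := by
              rw [← Real.rpow_natCast, ← Real.rpow_mul hp.le]; congr 1; push_cast; ring
          _ ≤ (130 * bracketMod z) ^ ((s + 1) / 2) :=
              Real.rpow_le_rpow (by positivity) (bracketPar_sq_le_of_notMem_regionK hz)
                (by linarith)
          _ = 130 ^ ((s + 1) / 2) * bracketMod z ^ ((s + 1) / 2) :=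
              Real.mul_rpow (by norm_num) hb.le
          _ ≤ 130 ^ (1 : ℝ) * bracketMod z ^ ((s + 1) / 2) := by
              gcongr
              · norm_num
              · linarith
          _ = _ := by rw [Real.rpow_one]
      have e2 : bracketMod z ^ (s / 2) ≤ 32 * bracketXi z ^ s := by
        calc bracketMod z ^ (s / 2) ≤ (bracketXi z ^ 2 / 32) ^ (s / 2) :=
              Real.rpow_le_rpow_of_nonpos (by positivity)
                (by linarith [bracketXi_sq_le_of_notMem_regionK hz]) (by linarith)
          _ = bracketXi z ^ s / 32 ^ (s / 2) := by
              rw [Real.div_rpow (by positivity) (by norm_num), ← Real.rpow_natCast,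
                ← Real.rpow_mul ha.le]
              congr 2; push_cast; ring
          _ = 32 ^ (-(s / 2)) * bracketXi z ^ s := by
              rw [Real.rpow_neg (by norm_num), div_eq_inv_mul]
          _ ≤ 32 ^ (1 : ℝ) * bracketXi z ^ s := by
              gcongr
              · norm_num
              · linarith
          _ = _ := by rw [Real.rpow_one]
      calc bracketPar z ^ (s + 1) ≤ 130 * bracketMod z ^ ((s + 1) / 2) := e1
        _ = 130 * (bracketMod z ^ (s / 2) * bracketMod z ^ (1 / 2 : ℝ)) := by
            rw [← Real.rpow_add hb]; congr 2; ring
        _ ≤ 130 * (32 * bracketXi z ^ s * bracketMod z ^ (1 / 2 : ℝ)) := by gcongr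
        _ = _ := by ring
  unfold yN
  calc _ ≤ _ := add_le_add h1 h2
    _ = _ := by
      push_cast
      rw [ENNReal.ofReal]
      ring

theorem tsum_mul_sq_le (u v : ℕ → ℝ≥0∞) :
    (∑' n, u n * v n) ^ 2 ≤ (∑' n, u n ^ 2) * ∑' n, v n ^ 2 := by
  have h := ENNReal.lintegral_mul_le_Lp_mul_Lq (Measure.count : Measure ℕ)
    Real.HolderConjugate.two_two (f := u) (g := v) (measurable_of_countable _).aemeasurable
    (measurable_of_countable _).aemeasurable
  simp only [lintegral_count, Pi.mul_apply] at h
  calc (∑' n, u n * v n) ^ 2 ≤ _ := pow_le_pow_left₀ zero_le h 2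
    _ = _ := by
      rw [mul_pow, rpow_half_sq, rpow_half_sq]
      norm_cast

theorem sum_range_two_pow_le (n : ℕ) : ∑ d ∈ Finset.range n, (2 : ℝ≥0∞) ^ d ≤ 2 ^ n := by
  induction n with
  | zero => simp
  | succ n ih =>
    rw [Finset.sum_range_succ, pow_succ, mul_two]
    gcongr

theorem block_regionK_eq_zero {F : Freq → ℝ≥0∞} {j d : ℕ} (h : 2 * j < d + 4) :
    block (regionK.indicator F) j d = 0 := by
  funext z
  by_contra hc
  have h1 := block_mem hc
  have h2 : z ∈ regionK := by
    by_contra h2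
    exact hc (by simp [block, h2])
  have := le_of_mem_regionK h2 h1.1 h1.2
  omega

theorem l2_zero {α : Type*} [MeasureSpace α] : l2 (0 : α → ℝ≥0∞) = 0 := by simp [l2]

/-- The restriction to `K`, where only the modulations `2^d` with `d ≤ 2j - 4` occur: summing the
geometric series in `d` gives `Y^s ⊆ X̂^{s,1/2,1}`. -/
theorem xN_regionK_le {s : ℝ} (hs : -1 < s) {F : Freq → ℝ≥0∞} (hF : Measurable F) :
    xN s (regionK.indicator F) ≤ l2 (wmul (fun z => bracketPar z ^ (s + 1)) F) := by
  rw [← sq_le_sq_ennreal, xN_sq,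
    l2_sq_eq_tsum_block (measurable_wmul (measurable_bracketPar_rpow _) hF)]
  refine ENNReal.tsum_le_tsum fun j => ?_
  have h0 : ∀ d ∉ Finset.range (2 * j),
      twoPow ((d : ℝ) / 2) * l2 (block (regionK.indicator F) j d) = 0 := by
    intro d hd
    rw [Finset.mem_range, not_lt] at hd
    rw [block_regionK_eq_zero (by omega), l2_zero, mul_zero]
  have hsum : ∑' d : ℕ, twoPow (d / 2) * l2 (block (regionK.indicator F) j d) =
      ∑' d : ℕ, (if d ∈ Finset.range (2 * j) then twoPow (d / 2) else 0) *
        l2 (block (regionK.indicator F) j d) := by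
    refine tsum_congr fun d => ?_
    split_ifs with hd
    · rfl
    · rw [h0 d hd, zero_mul]
  have hgeom : ∑' d : ℕ, (if d ∈ Finset.range (2 * j) then twoPow ((d : ℝ) / 2) else 0) ^ 2 ≤
      twoPow (2 * j) := by
    rw [tsum_eq_sum (s := Finset.range (2 * j)) (fun d hd => by simp [hd])]
    have : twoPow (2 * j) = (2 : ℝ≥0∞) ^ (2 * j) := by rw [← twoPow_natCast]; push_cast; rfl
    rw [this]
    refine le_trans (Finset.sum_le_sum fun d hd => ?_) (sum_range_two_pow_le (2 * j))
    rw [if_pos hd, twoPow_sq, ← twoPow_natCast]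
    exact twoPow_mono (by linarith)
  unfold xPart
  rw [hsum, mul_pow]
  calc twoPow (s * j) ^ 2 * (∑' d : ℕ, (if d ∈ Finset.range (2 * j) then twoPow (d / 2) else 0) *
        l2 (block (regionK.indicator F) j d)) ^ 2
      ≤ twoPow (s * j) ^ 2 * (twoPow (2 * j) *
          ∑' d : ℕ, l2 (block (regionK.indicator F) j d) ^ 2) := by
        gcongr
        exact (tsum_mul_sq_le _ _).trans (by gcongr)
    _ = ∑' d : ℕ, (twoPow ((s + 1) * j) * l2 (block (regionK.indicator F) j d)) ^ 2 := by
        simp_rw [mul_pow]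
        rw [ENNReal.tsum_mul_left, ← mul_assoc, twoPow_sq, twoPow_sq, ← twoPow_add]
        congr 2; ring
    _ ≤ _ := by
        gcongr with d
        rw [← l2_const_mul _ (measurable_block (hF.indicator measurableSet_regionK) j d)]
        refine l2_mono fun z => ?_
        by_cases hz : z ∈ annulus j ∩ parNhd d
        · simp only [block, Set.indicator_of_mem hz, wmul]
          gcongr
          · rw [← ofReal_two_rpow]
            apply ENNReal.ofReal_le_ofReal
            rw [mul_comm, Real.rpow_mul two_pos.le, Real.rpow_natCast]
            exact Real.rpow_le_rpow (by positivity)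
              (hz.1.1.trans (bracketXi_le_bracketPar z)) (by linarith)
          · exact Set.indicator_le_self _ _ z
        · simp [block, hz]

theorem xN_regionK_le_yN {s : ℝ} (hs : -1 < s) {F : Freq → ℝ≥0∞} (hF : Measurable F) :
    xN s (regionK.indicator F) ≤ yN s F := (xN_regionK_le hs hF).trans le_add_self

/-! ### Comparison with the norms of complex-valued functions -/

theorem eLpNorm_two_eq (f : Freq → ℂ) : eLpNorm f 2 volume = l2 fun z => ‖f z‖ₑ := by
  rw [eLpNorm_eq_lintegral_rpow_enorm_toReal (by norm_num) (by norm_num), l2]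
  norm_num

theorem xNorm_eq (s : ℝ) (f : Freq → ℂ) : xNorm s (1 / 2) f = xN s fun z => ‖f z‖ₑ := by
  unfold xNorm xN
  congr 1
  refine tsum_congr fun j => ?_
  unfold xPart
  rw [mul_pow, twoPow_sq, ofReal_two_rpow, mul_assoc]
  congr 2
  refine tsum_congr fun d => ?_
  rw [ofReal_two_rpow, eLpNorm_two_eq, one_div_mul_eq_div]
  congr 2
  funext z
  by_cases hz : z ∈ annulus j ∩ parNhd d <;> simp [block, hz]

theorem enorm_smul_weight {v : Freq → ℝ} (hv : ∀ z, 0 ≤ v z) (f : Freq → ℂ) :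
    (fun z => ‖v z • f z‖ₑ) = wmul v fun z => ‖f z‖ₑ := by
  funext z
  rw [enorm_smul, wmul, Real.enorm_of_nonneg (hv z)]

theorem yNorm_eq (s : ℝ) (f : Freq → ℂ) : yNorm s f = yN s fun z => ‖f z‖ₑ := by
  have h1 := enorm_smul_weight (fun z => Real.rpow_nonneg (bracketXi_pos z).le s) f
  have h2 := enorm_smul_weight (fun z => Real.rpow_nonneg (bracketPar_pos z).le (s + 1)) f
  unfold yNorm yN
  rw [eLpNorm_two_eq, h2, ← h1]
  rfl

/-- The sum of the `X̂^{s,1/2,1}` norm on `K` and of the `Y^s` norm off `K`. It is comparable to the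
norm of `Z^s`. -/
def pN (s : ℝ) (F : Freq → ℝ≥0∞) : ℝ≥0∞ :=
  xN s (regionK.indicator F) + yN s (regionKᶜ.indicator F)

theorem pN_mono_ae {F G : Freq → ℝ≥0∞} (h : ∀ᵐ z, F z ≤ G z) (s : ℝ) : pN s F ≤ pN s G := by
  unfold pN
  gcongr
  · exact xN_mono_ae (h.mono fun z hz => Set.indicator_le_indicator hz) s
  · exact yN_mono_ae (h.mono fun z hz => Set.indicator_le_indicator hz) s

theorem pN_add_le {F G : Freq → ℝ≥0∞} (hF : Measurable F) (hG : Measurable G) (s : ℝ) :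
    pN s (fun z => F z + G z) ≤ 2 * (pN s F + pN s G) := by
  have e : ∀ S : Set Freq, S.indicator (fun z => F z + G z) =
      fun z => S.indicator F z + S.indicator G z := fun S => Set.indicator_add _ _ _
  unfold pN
  rw [e, e]
  calc _ ≤ 2 * (xN s (regionK.indicator F) + xN s (regionK.indicator G)) +
        2 * (yN s (regionKᶜ.indicator F) + yN s (regionKᶜ.indicator G)) := by
        gcongr
        · exact xN_add_le (hF.indicator measurableSet_regionK)
            (hG.indicator measurableSet_regionK) s
        · refine (yN_add_le (hF.indicator measurableSet_regionK.compl)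
            (hG.indicator measurableSet_regionK.compl) s).trans ?_
          exact le_mul_of_one_le_left zero_le one_le_two
    _ = _ := by ring

theorem indicator_enorm (S : Set Freq) (f : Freq → ℂ) :
    (fun z => ‖S.indicator f z‖ₑ) = S.indicator fun z => ‖f z‖ₑ := by
  funext z
  by_cases h : z ∈ S <;> simp [h]

theorem zNorm_le_pN {s : ℝ} {f : Freq → ℂ} (hf : AEStronglyMeasurable f volume) :
    zNorm s f ≤ pN s fun z => ‖f z‖ₑ := by
  have h := iInf₂_le_of_le (f := fun f₁ f₂ => ⨅ (_ : AEStronglyMeasurable f₁ volume)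
    (_ : AEStronglyMeasurable f₂ volume) (_ : f =ᵐ[volume] f₁ + f₂),
    xNorm s (1 / 2) f₁ + yNorm s f₂) (regionK.indicator f) (regionKᶜ.indicator f)
    (iInf_le_of_le (hf.indicator measurableSet_regionK)
      (iInf_le_of_le (hf.indicator measurableSet_regionK.compl)
        (iInf_le_of_le (Filter.Eventually.of_forall fun z =>
          (congrFun (Set.indicator_self_add_compl regionK f) z).symm) le_rfl)))
  refine le_trans h (le_of_eq ?_)
  rw [xNorm_eq, yNorm_eq, indicator_enorm, indicator_enorm, pN]

theorem pN_congr_ae {F G : Freq → ℝ≥0∞} (h : ∀ᵐ z, F z = G z) (s : ℝ) : pN s F = pN s G :=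
  le_antisymm (pN_mono_ae (h.mono fun _ hz => hz.le) s) (pN_mono_ae (h.mono fun _ hz => hz.ge) s)

theorem xN_congr_ae {F G : Freq → ℝ≥0∞} (h : ∀ᵐ z, F z = G z) (s : ℝ) : xN s F = xN s G :=
  le_antisymm (xN_mono_ae (h.mono fun _ hz => hz.le) s) (xN_mono_ae (h.mono fun _ hz => hz.ge) s)

theorem yN_congr_ae {F G : Freq → ℝ≥0∞} (h : ∀ᵐ z, F z = G z) (s : ℝ) : yN s F = yN s G :=
  le_antisymm (yN_mono_ae (h.mono fun _ hz => hz.le) s) (yN_mono_ae (h.mono fun _ hz => hz.ge) s)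

theorem exists_pN_le_zNorm {s : ℝ} (hs : -1 < s) (hs0 : s < 0) : ∃ C : ℝ≥0, ∀ f : Freq → ℂ,
    pN s (fun z => ‖f z‖ₑ) ≤ C * zNorm s f := by
  obtain ⟨C, hC⟩ := exists_yN_compl_le_xN hs hs0
  refine ⟨2 * (2 + C), fun f => ?_⟩
  have hC0 : ((2 * (2 + C) : ℝ≥0) : ℝ≥0∞) ≠ 0 := by
    have : (2 * (2 + C) : ℝ≥0) ≠ 0 := by positivity
    exact_mod_cast this
  unfold zNorm
  simp_rw [ENNReal.mul_iInf_of_ne hC0 ENNReal.coe_ne_top]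
  refine le_iInf₂ fun f₁ f₂ => le_iInf₂ fun h₁ h₂ => le_iInf fun h => ?_
  obtain ⟨F, hF, hFe⟩ := h₁.enorm
  obtain ⟨G, hG, hGe⟩ := h₂.enorm
  have hX : xNorm s (1 / 2) f₁ = xN s F := by rw [xNorm_eq]; exact xN_congr_ae hFe s
  have hY : yNorm s f₂ = yN s G := by rw [yNorm_eq]; exact yN_congr_ae hGe s
  rw [hX, hY]
  have hle : pN s (fun z => ‖f z‖ₑ) ≤ pN s fun z => F z + G z := by
    refine pN_mono_ae ?_ s
    filter_upwards [h, hFe, hGe] with z hz hFz hGz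
    rw [hz, ← hFz, ← hGz]
    exact enorm_add_le _ _
  refine hle.trans ((pN_add_le hF hG s).trans ?_)
  have hPF : pN s F ≤ (1 + C) * xN s F := by
    unfold pN
    rw [add_mul, one_mul]
    gcongr
    · exact xN_mono_ae (Filter.Eventually.of_forall fun z => Set.indicator_le_self _ _ z) s
    · exact hC F hF
  have hPG : pN s G ≤ 2 * yN s G := by
    unfold pN
    rw [two_mul]
    gcongr
    · exact xN_regionK_le_yN hs hG
    · exact yN_mono_ae (Filter.Eventually.of_forall fun z => Set.indicator_le_self _ _ z) s
  have e : ((2 * (2 + C) : ℝ≥0) : ℝ≥0∞) = 2 * (2 + C) := by push_cast; rfl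
  rw [e, mul_assoc]
  refine mul_le_mul_right ?_ 2
  rw [mul_add]
  refine add_le_add (hPF.trans ?_) (hPG.trans ?_)
  · gcongr
    exact one_le_two
  · gcongr
    exact le_self_add

/-! ### Integrals of powers of brackets and convergent dyadic sums -/

theorem exists_lintegral_rpow_mul_rpow_le {p q : ℝ} (hp : 0 < p) (hq : 0 < q) (hpq : 2 < p + q) :
    ∃ C : ℝ≥0, ∀ η : EuclideanSpace ℝ (Fin 2), ∫⁻ ξ : EuclideanSpace ℝ (Fin 2),
      ENNReal.ofReal ((1 + ‖ξ‖) ^ (-p) * (1 + ‖ξ - η‖) ^ (-q)) ≤ C := by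
  have hfin : ∫⁻ ξ : EuclideanSpace ℝ (Fin 2), ENNReal.ofReal ((1 + ‖ξ‖) ^ (-(p + q))) < ⊤ :=
    finite_integral_one_add_norm (by simpa using hpq)
  have hm : Measurable fun ξ : EuclideanSpace ℝ (Fin 2) =>
      ENNReal.ofReal ((1 + ‖ξ‖) ^ (-(p + q))) :=
    ((measurable_const.add measurable_norm).pow_const _).ennreal_ofReal
  set I := ∫⁻ ξ : EuclideanSpace ℝ (Fin 2), ENNReal.ofReal ((1 + ‖ξ‖) ^ (-(p + q))) with hI
  refine ⟨(I + I).toNNReal, fun η => ?_⟩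
  rw [ENNReal.coe_toNNReal (ENNReal.add_ne_top.2 ⟨hfin.ne, hfin.ne⟩)]
  have key : ∀ x y : ℝ, 1 ≤ x → 1 ≤ y → x ^ (-p) * y ^ (-q) ≤ x ^ (-(p + q)) + y ^ (-(p + q)) := by
    intro x y hx hy
    have hx0 : 0 < x := one_pos.trans_le hx
    have hy0 : 0 < y := one_pos.trans_le hy
    rcases le_total x y with h | h
    · have h1 : y ^ (-q) ≤ x ^ (-q) := Real.rpow_le_rpow_of_nonpos hx0 h (by linarith)
      calc x ^ (-p) * y ^ (-q) ≤ x ^ (-p) * x ^ (-q) := by gcongr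
        _ = x ^ (-(p + q)) := by rw [← Real.rpow_add hx0]; congr 1; ring
        _ ≤ _ := le_add_of_nonneg_right (by positivity)
    · have h1 : x ^ (-p) ≤ y ^ (-p) := Real.rpow_le_rpow_of_nonpos hy0 h (by linarith)
      calc x ^ (-p) * y ^ (-q) ≤ y ^ (-p) * y ^ (-q) := by gcongr
        _ = y ^ (-(p + q)) := by rw [← Real.rpow_add hy0]; congr 1; ring
        _ ≤ _ := le_add_of_nonneg_left (by positivity)
  calc ∫⁻ ξ : EuclideanSpace ℝ (Fin 2), ENNReal.ofReal ((1 + ‖ξ‖) ^ (-p) * (1 + ‖ξ - η‖) ^ (-q))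
      ≤ ∫⁻ ξ : EuclideanSpace ℝ (Fin 2), (ENNReal.ofReal ((1 + ‖ξ‖) ^ (-(p + q))) +
          ENNReal.ofReal ((1 + ‖ξ - η‖) ^ (-(p + q)))) := by
        refine lintegral_mono fun ξ => ?_
        rw [← ENNReal.ofReal_add (by positivity) (by positivity)]
        apply ENNReal.ofReal_le_ofReal
        exact key _ _ (by linarith [norm_nonneg ξ]) (by linarith [norm_nonneg (ξ - η)])
    _ = I + I := by
        rw [lintegral_add_left hm, lintegral_sub_right_eq_self
          (fun ξ : EuclideanSpace ℝ (Fin 2) => ENNReal.ofReal ((1 + ‖ξ‖) ^ (-(p + q)))) η]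

theorem exists_lintegral_one_add_abs_rpow_le {r : ℝ} (hr : 1 < r) :
    ∃ C : ℝ≥0, ∫⁻ τ : ℝ, ENNReal.ofReal ((1 + |τ|) ^ (-r)) ≤ C := by
  have hfin : ∫⁻ τ : ℝ, ENNReal.ofReal ((1 + ‖τ‖) ^ (-r)) < ⊤ :=
    finite_integral_one_add_norm (by simpa using hr)
  exact ⟨_, (ENNReal.coe_toNNReal hfin.ne).ge⟩

theorem exists_tsum_pow_mul_twoPow_le (k : ℕ) {δ : ℝ} (hδ : 0 < δ) :
    ∃ C : ℝ≥0, ∑' j : ℕ, (j : ℝ≥0∞) ^ k * twoPow (-(δ * j)) ≤ C := by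
  have hr1 : (2 : ℝ) ^ (-δ) < 1 := Real.rpow_lt_one_of_one_lt_of_neg one_lt_two (by linarith)
  have hr0 : (0 : ℝ) ≤ 2 ^ (-δ) := by positivity
  have hs : Summable fun n : ℕ => (n : ℝ) ^ k * ((2 : ℝ) ^ (-δ)) ^ n :=
    summable_pow_mul_geometric_of_norm_lt_one k (by rwa [Real.norm_of_nonneg hr0])
  have e : ∀ n : ℕ, (n : ℝ≥0∞) ^ k * twoPow (-(δ * n)) =
      ENNReal.ofReal ((n : ℝ) ^ k * ((2 : ℝ) ^ (-δ)) ^ n) := by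
    intro n
    rw [ENNReal.ofReal_mul (by positivity), ENNReal.ofReal_pow (by positivity),
      ENNReal.ofReal_natCast, ← Real.rpow_natCast, ← Real.rpow_mul two_pos.le, ofReal_two_rpow,
      neg_mul]
  simp_rw [e]
  rw [← ENNReal.ofReal_tsum_of_nonneg (fun n => by positivity) hs]
  exact ⟨_, le_rfl⟩

/-! ### Reduction of the output norms to `L²` norms -/

/-- The output on `K`: only the modulations `2^d` with `d < 2j` occur, and `⟨τ - |ξ|²⟩⁻¹` gains
`2^(-d)`. -/
theorem xPart_regionK_div_le (s : ℝ) {h : Freq → ℝ≥0∞} (hh : Measurable h) (j : ℕ) :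
    xPart s (regionK.indicator (wmul (fun z => (bracketMod z)⁻¹) h)) j ≤
      twoPow (s * j) * ∑ d ∈ Finset.range (2 * j),
        twoPow (-(d / 2)) * l2 (block (regionK.indicator h) j d) := by
  have e : regionK.indicator (wmul (fun z => (bracketMod z)⁻¹) h) =
      wmul (fun z => (bracketMod z)⁻¹) (regionK.indicator h) := by
    funext z
    by_cases hz : z ∈ regionK <;> simp [wmul, hz]
  unfold xPart
  gcongr
  rw [tsum_eq_sum (s := Finset.range (2 * j))]
  · refine Finset.sum_le_sum fun d _ => ?_
    have h2 : l2 (block (wmul (fun z => (bracketMod z)⁻¹) (regionK.indicator h)) j d) ≤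
        twoPow (-d) * l2 (block (regionK.indicator h) j d) := by
      refine l2_wmul_block_le (hh.indicator measurableSet_regionK) fun z hz => ?_
      rw [Real.rpow_neg two_pos.le, Real.rpow_natCast]
      exact inv_anti₀ (by positivity) hz.2.1
    rw [e]
    calc _ ≤ twoPow (d / 2) * (twoPow (-d) * l2 (block (regionK.indicator h) j d)) := by
          gcongr
      _ = _ := by
          rw [← mul_assoc, ← twoPow_add]; congr 2; ring
  · intro d hd
    rw [Finset.mem_range, not_lt] at hd
    rw [block_regionK_eq_zero (by omega), l2_zero, mul_zero]

theorem xN_le_tsum (s : ℝ) (F : Freq → ℝ≥0∞) : xN s F ≤ ∑' j, xPart s F j := by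
  rw [← sq_le_sq_ennreal, xN_sq]
  exact tsum_sq_le_sq_tsum _

/-- The output on `K` when there is an exponential gain in the spatial frequency. -/
theorem exists_xN_regionK_div_le (s : ℝ) {δ : ℝ} (hδ : 0 < δ) : ∃ C : ℝ≥0,
    ∀ (h : Freq → ℝ≥0∞) (M : ℝ≥0∞), Measurable h →
      (∀ j d : ℕ, d + 4 ≤ 2 * j → l2 (block h j d) ≤ twoPow (d / 2) * twoPow (-((s + δ) * j)) * M) →
      xN s (regionK.indicator (wmul (fun z => (bracketMod z)⁻¹) h)) ≤ C * M := by
  obtain ⟨C, hC⟩ := exists_tsum_pow_mul_twoPow_le 1 hδ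
  refine ⟨2 * C, fun h M hh hM => (xN_le_tsum _ _).trans ?_⟩
  have hM' : ∀ j d : ℕ, l2 (block (regionK.indicator h) j d) ≤
      twoPow (d / 2) * twoPow (-((s + δ) * j)) * M := by
    intro j d
    rcases le_or_gt (d + 4) (2 * j) with hd | hd
    · exact (l2_mono fun z => block_mono (fun z => Set.indicator_le_self _ _ z) j d z).trans
        (hM j d hd)
    · rw [block_regionK_eq_zero hd, l2_zero]; exact zero_le
  calc ∑' j, xPart s (regionK.indicator (wmul (fun z => (bracketMod z)⁻¹) h)) j
      ≤ ∑' j : ℕ, 2 * M * ((j : ℝ≥0∞) ^ 1 * twoPow (-(δ * j))) := by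
        refine ENNReal.tsum_le_tsum fun j => (xPart_regionK_div_le s hh j).trans ?_
        calc twoPow (s * j) * ∑ d ∈ Finset.range (2 * j),
              twoPow (-(d / 2)) * l2 (block (regionK.indicator h) j d)
            ≤ twoPow (s * j) * ∑ d ∈ Finset.range (2 * j), twoPow (-((s + δ) * j)) * M := by
              refine mul_le_mul_right (Finset.sum_le_sum fun d _ => ?_) _
              calc twoPow (-((d : ℝ) / 2)) * l2 (block (regionK.indicator h) j d)
                  ≤ twoPow (-((d : ℝ) / 2)) * (twoPow (d / 2) * twoPow (-((s + δ) * j)) * M) := by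
                    gcongr; exact hM' j d
                _ = twoPow (-((d : ℝ) / 2) + d / 2) * (twoPow (-((s + δ) * j)) * M) := by
                    rw [twoPow_add]; ring
                _ = _ := by rw [neg_add_cancel, twoPow_zero, one_mul]
          _ = twoPow (s * j + -((s + δ) * j)) * (2 * M * (j : ℝ≥0∞) ^ 1) := by
              rw [Finset.sum_const, Finset.card_range, nsmul_eq_mul, twoPow_add]
              push_cast
              ring
          _ = _ := by
              rw [show s * j + -((s + δ) * j) = -(δ * j) by ring]; ring
    _ ≤ 2 * M * C := by
        rw [ENNReal.tsum_mul_left]; gcongr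
    _ = _ := by push_cast; ring

theorem rpow_neg_le_of_le {x y r : ℝ} (hx : 0 < x) (h : x ≤ y) (hr : 0 ≤ r) : y ^ (-r) ≤ x ^ (-r) :=
  Real.rpow_le_rpow_of_nonpos hx h (by linarith)

theorem bracketPar_rpow_le_one_add_abs {r : ℝ} (hr : 0 ≤ r) (z : Freq) :
    bracketPar z ^ (-(2 * r)) ≤ (1 + |z.2|) ^ (-r) := by
  have h1 : 1 + |z.2| ≤ bracketPar z ^ 2 := by
    nlinarith [one_add_le_bracketPar_sq z, sq_nonneg ‖z.1‖]
  have h2 : bracketPar z ^ (-(2 * r)) = (bracketPar z ^ 2) ^ (-r) := by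
    rw [← Real.rpow_natCast, ← Real.rpow_mul (bracketPar_pos z).le]; congr 1; push_cast; ring
  rw [h2]
  exact rpow_neg_le_of_le (by positivity) h1 hr

theorem bracketPar_rpow_le_bracketXi {r : ℝ} (hr : r ≤ 0) (z : Freq) :
    bracketPar z ^ r ≤ bracketXi z ^ r :=
  Real.rpow_le_rpow_of_nonpos (bracketXi_pos z) (bracketXi_le_bracketPar z) hr

theorem inv_bracketMod_le {z : Freq} (hz : z ∉ regionK) :
    (bracketMod z)⁻¹ ≤ 130 * bracketPar z ^ (-2 : ℝ) := by
  have h := bracketPar_sq_le_of_notMem_regionK hz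
  have hp := bracketPar_pos z
  have hb := bracketMod_pos z
  rw [Real.rpow_neg hp.le, Real.rpow_ofNat, ← div_eq_mul_inv, inv_eq_one_div,
    div_le_div_iff₀ hb (by positivity)]
  linarith

/-- The `L²` part of the `Y^s` norm of the output off `K`. -/
theorem l2_compl_div_le {s : ℝ} {h : Freq → ℝ≥0∞} (hh : Measurable h) :
    l2 (wmul (fun z => bracketPar z ^ (s + 1))
      (regionKᶜ.indicator (wmul (fun z => (bracketMod z)⁻¹) h))) ≤
      130 * l2 (wmul (fun z => bracketPar z ^ (s - 1)) h) := by
  rw [← l2_const_mul _ (measurable_wmul (measurable_bracketPar_rpow _) hh)]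
  refine l2_mono fun z => ?_
  by_cases hz : z ∈ regionK
  · simp [wmul, hz]
  · simp only [wmul, Set.indicator_of_mem (show z ∈ regionKᶜ from hz)]
    rw [← mul_assoc, ← mul_assoc, ← ENNReal.ofReal_mul
      (Real.rpow_nonneg (bracketPar_pos z).le _), show (130 : ℝ≥0∞) = ENNReal.ofReal 130 by norm_num,
      ← ENNReal.ofReal_mul (by norm_num)]
    refine mul_le_mul_left (ENNReal.ofReal_le_ofReal ?_) _
    have hp := bracketPar_pos z
    have := Real.rpow_nonneg hp.le (s + 1)
    calc bracketPar z ^ (s + 1) * (bracketMod z)⁻¹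
        ≤ bracketPar z ^ (s + 1) * (130 * bracketPar z ^ (-2 : ℝ)) := by
          gcongr; exact inv_bracketMod_le hz
      _ = 130 * (bracketPar z ^ (s + 1) * bracketPar z ^ (-2 : ℝ)) := by ring
      _ = 130 * bracketPar z ^ (s - 1) := by
          rw [← Real.rpow_add hp]; congr 2; ring

theorem mixN_compl_div_le {s : ℝ} {h : Freq → ℝ≥0∞} (hh : Measurable h) :
    mixN (wmul (fun z => bracketXi z ^ s)
      (regionKᶜ.indicator (wmul (fun z => (bracketMod z)⁻¹) h))) ≤
      130 * mixN (wmul (fun z => bracketXi z ^ s * bracketPar z ^ (-2 : ℝ)) h) := by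
  have hm : Measurable fun z => bracketXi z ^ s * bracketPar z ^ (-2 : ℝ) :=
    (measurable_bracketXi_rpow _).mul (measurable_bracketPar_rpow _)
  rw [← mixN_const_mul _ (measurable_wmul hm hh)]
  refine mixN_mono_ae (Filter.Eventually.of_forall fun z => ?_)
  by_cases hz : z ∈ regionK
  · simp [wmul, hz]
  · simp only [wmul, Set.indicator_of_mem (show z ∈ regionKᶜ from hz)]
    rw [← mul_assoc, ← mul_assoc, ← ENNReal.ofReal_mul
      (Real.rpow_nonneg (bracketXi_pos z).le _), show (130 : ℝ≥0∞) = ENNReal.ofReal 130 by norm_num,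
      ← ENNReal.ofReal_mul (by norm_num)]
    refine mul_le_mul_left (ENNReal.ofReal_le_ofReal ?_) _
    have := Real.rpow_nonneg (bracketXi_pos z).le s
    calc bracketXi z ^ s * (bracketMod z)⁻¹
        ≤ bracketXi z ^ s * (130 * bracketPar z ^ (-2 : ℝ)) := by
          gcongr; exact inv_bracketMod_le hz
      _ = _ := by ring

/-- The output off `K` is controlled by a weighted `L²` norm: the `L¹_τ` norm is estimated by the
Cauchy-Schwarz inequality, at the price of an arbitrarily small power of the parabolic bracket. -/
theorem exists_yN_compl_div_le {s ε : ℝ} (hs0 : s ≤ 0) (hε : 0 < ε) : ∃ C : ℝ≥0,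
    ∀ h : Freq → ℝ≥0∞, Measurable h →
      yN s (regionKᶜ.indicator (wmul (fun z => (bracketMod z)⁻¹) h)) ≤
        C * l2 (wmul (fun z => bracketXi z ^ s * bracketPar z ^ (-1 + ε)) h) := by
  obtain ⟨C, hC⟩ := exists_lintegral_one_add_abs_rpow_le (r := 1 + ε) (by linarith)
  refine ⟨130 * (1 + C) + 130, fun h hh => ?_⟩
  have hm : Measurable (wmul (fun z => bracketXi z ^ s * bracketPar z ^ (-1 + ε)) h) :=
    measurable_wmul ((measurable_bracketXi_rpow _).mul (measurable_bracketPar_rpow _)) hh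
  have h1 : mixN (wmul (fun z => bracketXi z ^ s * bracketPar z ^ (-2 : ℝ)) h) ≤
      (1 + C) * l2 (wmul (fun z => bracketXi z ^ s * bracketPar z ^ (-1 + ε)) h) := by
    set u := wmul (fun z => bracketXi z ^ s * bracketPar z ^ (-1 + ε)) h with hu
    unfold mixN
    rw [l2_le_iff, mul_pow, l2_sq, Measure.volume_eq_prod,
      lintegral_prod _ (hm.pow_const 2).aemeasurable,
      ← lintegral_const_mul _ (measurable_lintegral_snd (hm.pow_const 2))]
    refine lintegral_mono fun ξ => ?_
    dsimp only
    have hp : Measurable fun τ : ℝ => ENNReal.ofReal (bracketPar (ξ, τ) ^ (-(1 + ε))) :=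
      ((measurable_bracketPar_rpow _).comp measurable_prodMk_left).ennreal_ofReal
    have e : ∀ τ : ℝ, wmul (fun z => bracketXi z ^ s * bracketPar z ^ (-2 : ℝ)) h (ξ, τ) =
        ENNReal.ofReal (bracketPar (ξ, τ) ^ (-(1 + ε))) * u (ξ, τ) := by
      intro τ
      have h0 := bracketPar_pos (ξ, τ)
      simp only [hu, wmul]
      rw [← mul_assoc, ← ENNReal.ofReal_mul (by positivity)]
      congr 2
      rw [mul_left_comm, ← Real.rpow_add h0]
      congr 2; ring
    rw [lintegral_congr e]
    refine (lintegral_mul_sq_le hp.aemeasurable (hm.comp measurable_prodMk_left).aemeasurable).trans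
      (mul_le_mul_left ?_ _)
    calc ∫⁻ τ : ℝ, ENNReal.ofReal (bracketPar (ξ, τ) ^ (-(1 + ε))) ^ 2
        ≤ ∫⁻ τ : ℝ, ENNReal.ofReal ((1 + |τ|) ^ (-(1 + ε))) := by
          refine lintegral_mono fun τ => ?_
          have h0 := bracketPar_pos (ξ, τ)
          rw [← ENNReal.ofReal_pow (by positivity), ← Real.rpow_natCast, ← Real.rpow_mul h0.le]
          apply ENNReal.ofReal_le_ofReal
          have := bracketPar_rpow_le_one_add_abs (r := 1 + ε) (by linarith) (ξ, τ)
          convert this using 2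
          push_cast; ring
      _ ≤ C := hC
      _ ≤ (1 + C) * 1 := by rw [mul_one]; exact le_add_self
      _ ≤ (1 + C) * (1 + C) := by gcongr; exact le_self_add
      _ = (1 + C) ^ 2 := by ring
  have h2 : l2 (wmul (fun z => bracketPar z ^ (s - 1)) h) ≤
      l2 (wmul (fun z => bracketXi z ^ s * bracketPar z ^ (-1 + ε)) h) := by
    refine l2_wmul_mono h fun z => ?_
    have hp := bracketPar_pos z
    calc bracketPar z ^ (s - 1) = bracketPar z ^ s * bracketPar z ^ (-1 : ℝ) := by
          rw [← Real.rpow_add hp]; congr 1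
      _ ≤ bracketXi z ^ s * bracketPar z ^ (-1 + ε) := by
          have := Real.rpow_nonneg (bracketXi_pos z).le s
          exact mul_le_mul (bracketPar_rpow_le_bracketXi hs0 z)
            (Real.rpow_le_rpow_of_exponent_le (one_le_bracketPar z) (by linarith))
            (by positivity) this
  unfold yN
  refine (add_le_add ((mixN_compl_div_le hh).trans (mul_le_mul_right h1 _))
    ((l2_compl_div_le hh).trans (mul_le_mul_right h2 _))).trans (le_of_eq ?_)
  push_cast
  ring

/-! ### Interaction of two functions in the `L²` part of `Y^s` -/

/-- The convolution `w (F / w * G / w)`. -/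
def weightedConv (F G : Freq → ℝ≥0∞) : Freq → ℝ≥0∞ :=
  bil (fun z y => ENNReal.ofReal (weight z / (weight y * weight (z - y)))) F G

theorem measurable_weightRatio :
    Measurable (Function.uncurry fun z y : Freq =>
      ENNReal.ofReal (weight z / (weight y * weight (z - y)))) := by
  have hw := continuous_weight.measurable
  exact ((hw.comp measurable_fst).div ((hw.comp measurable_snd).mul
    (hw.comp (measurable_fst.sub measurable_snd)))).ennreal_ofReal

theorem measurable_weightedConv {F G : Freq → ℝ≥0∞} (hF : Measurable F) (hG : Measurable G) :
    Measurable (weightedConv F G) := measurable_bil measurable_weightRatio hF hG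

theorem weightRatio_le (z y : Freq) : weight z / (weight y * weight (z - y)) ≤ 2 ^ 10 := by
  rw [div_le_iff₀ (mul_pos (weight_pos y) (weight_pos _))]
  exact weight_le z y

theorem lintegral_weightedConv_mono {F G : Freq → ℝ≥0∞} {c : ℝ} {z : Freq}
    (h : ∀ y, F y ≠ 0 → G (z - y) ≠ 0 → weight z / (weight y * weight (z - y)) ≤ c) :
    weightedConv F G z ≤ ENNReal.ofReal c * lconv F G z := by
  unfold weightedConv bil lconv
  rw [← lintegral_const_mul' _ _ ENNReal.ofReal_ne_top]
  refine lintegral_mono fun y => ?_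
  by_cases hF : F y = 0
  · simp [hF]
  by_cases hG : G (z - y) = 0
  · simp [hG]
  exact mul_le_mul_left (ENNReal.ofReal_le_ofReal (h y hF hG)) _

theorem weightedConv_le (F G : Freq → ℝ≥0∞) (z : Freq) :
    weightedConv F G z ≤ ENNReal.ofReal (2 ^ 10) * lconv F G z :=
  lintegral_weightedConv_mono fun y _ _ => weightRatio_le z y

theorem bracketPar_rpow_le_add {r : ℝ} (h0 : 0 ≤ r) (h1 : r ≤ 1) (z y : Freq) :
    bracketPar z ^ r ≤ bracketPar y ^ r + bracketPar (z - y) ^ r :=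
  (Real.rpow_le_rpow (bracketPar_pos z).le (bracketPar_le_add z y) h0).trans
    (Real.rpow_add_le_add_rpow (bracketPar_pos y).le (bracketPar_pos _).le h0 h1)

theorem ofReal_rpow_neg_mul {x r : ℝ} (hx : 0 < x) (a : ℝ≥0∞) :
    ENNReal.ofReal (x ^ (-r)) * (ENNReal.ofReal (x ^ r) * a) = a := by
  rw [← mul_assoc, ← ENNReal.ofReal_mul (by positivity), ← Real.rpow_add hx, neg_add_cancel,
    Real.rpow_zero, ENNReal.ofReal_one, one_mul]

theorem le_wmul_bracketPar {r : ℝ} (hr : 0 ≤ r) (F : Freq → ℝ≥0∞) (z : Freq) :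
    F z ≤ ENNReal.ofReal (bracketXi z ^ (-r)) * wmul (fun z => bracketPar z ^ r) F z := by
  calc F z = ENNReal.ofReal (bracketPar z ^ (-r)) * wmul (fun z => bracketPar z ^ r) F z :=
        (ofReal_rpow_neg_mul (bracketPar_pos z) _).symm
    _ ≤ _ := by
        refine mul_le_mul_left (ENNReal.ofReal_le_ofReal ?_) _
        exact bracketPar_rpow_le_bracketXi (neg_nonpos.2 hr) z

theorem wmul_bracketPar_lconv_le {r : ℝ} (h0 : 0 ≤ r) (h1 : r ≤ 1) {F G : Freq → ℝ≥0∞}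
    (hF : Measurable F) (hG : Measurable G) (z : Freq) :
    ENNReal.ofReal (bracketPar z ^ r) * lconv F G z ≤
      lconv (wmul (fun z => bracketPar z ^ r) F) G z +
        lconv (wmul (fun z => bracketPar z ^ r) G) F z := by
  have hm : Measurable (wmul (fun z => bracketPar z ^ r) F) :=
    measurable_wmul (measurable_bracketPar_rpow r) hF
  rw [lconv_comm _ F]
  unfold lconv
  have hG' : Measurable fun y => G (z - y) := hG.comp (measurable_const.sub measurable_id)
  rw [← lintegral_const_mul' _ _ ENNReal.ofReal_ne_top, ← lintegral_add_left
    (show Measurable fun y => wmul (fun z => bracketPar z ^ r) F y * G (z - y) from hm.mul hG')]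
  refine lintegral_mono fun y => ?_
  simp only [wmul]
  calc ENNReal.ofReal (bracketPar z ^ r) * (F y * G (z - y))
      ≤ (ENNReal.ofReal (bracketPar y ^ r) + ENNReal.ofReal (bracketPar (z - y) ^ r)) *
          (F y * G (z - y)) := by
        rw [← ENNReal.ofReal_add (Real.rpow_nonneg (bracketPar_pos _).le _)
          (Real.rpow_nonneg (bracketPar_pos _).le _)]
        gcongr
        exact bracketPar_rpow_le_add h0 h1 z y
    _ = _ := by ring

/-- A weighted estimate of a convolution: the larger input carries the decay in the parabolic
bracket of the output, the other one the decay in its spatial frequency. -/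
theorem l2_wmul_lconv_le {r : ℝ} (h0 : 0 ≤ r) (h1 : r ≤ 1) {F G : Freq → ℝ≥0∞}
    (hF : Measurable F) (hG : Measurable G) {v : Freq → ℝ} (hv : Measurable v) (hv0 : ∀ z, 0 ≤ v z)
    {B : ℝ≥0∞} (h : ∀ η : EuclideanSpace ℝ (Fin 2), ∫⁻ z : Freq,
      ENNReal.ofReal ((v z * bracketPar z ^ (-r) * (1 + ‖z.1 - η‖) ^ (-r)) ^ 2) ≤ B ^ 2) :
    l2 (wmul v (lconv F G)) ≤ 2 * B *
      (l2 (wmul (fun z => bracketPar z ^ r) F) * l2 (wmul (fun z => bracketPar z ^ r) G)) := by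
  set m : Freq → Freq → ℝ≥0∞ := fun z y =>
    ENNReal.ofReal (v z * bracketPar z ^ (-r) * (1 + ‖z.1 - y.1‖) ^ (-r)) with hm_def
  have hm : Measurable (Function.uncurry m) := by
    refine Measurable.ennreal_ofReal (Measurable.mul ?_ ?_)
    · exact (hv.mul (measurable_bracketPar_rpow _)).comp measurable_fst
    · exact (measurable_const.add (measurable_fst.fst.sub measurable_snd.fst).norm).pow_const _
  have hP := measurable_bracketPar_rpow r
  have hbil : ∀ φ ψ : Freq → ℝ≥0∞, Measurable φ → Measurable ψ →
      l2 (bil m φ ψ) ≤ B * (l2 φ * l2 ψ) := by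
    intro φ ψ hφ hψ
    rw [l2_le_iff, mul_pow, mul_pow, l2_sq, l2_sq]
    refine lintegral_bil_sq_le_of_left hm hφ hψ fun y => ?_
    refine le_trans (le_of_eq ?_) (h y.1)
    refine lintegral_congr fun z => ?_
    have := hv0 z
    have := bracketPar_pos z
    rw [ENNReal.ofReal_pow (by positivity)]
  have hpt : ∀ z, wmul v (lconv F G) z ≤
      bil m (wmul (fun z => bracketPar z ^ r) F) (wmul (fun z => bracketPar z ^ r) G) z +
      bil m (wmul (fun z => bracketPar z ^ r) G) (wmul (fun z => bracketPar z ^ r) F) z := by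
    intro z
    have hc : ∀ φ G' : Freq → ℝ≥0∞, ENNReal.ofReal (v z * bracketPar z ^ (-r)) * lconv φ G' z ≤
        bil m φ (wmul (fun z => bracketPar z ^ r) G') z := by
      intro φ G'
      unfold lconv bil
      rw [← lintegral_const_mul' _ _ ENNReal.ofReal_ne_top]
      refine lintegral_mono fun y => ?_
      have e : m z y = ENNReal.ofReal (v z * bracketPar z ^ (-r)) *
          ENNReal.ofReal (bracketXi (z - y) ^ (-r)) := by
        have := hv0 z
        have := bracketPar_pos z
        rw [hm_def, bracketXi_eq, Prod.fst_sub, ← ENNReal.ofReal_mul (by positivity)]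
      rw [e]
      calc _ ≤ ENNReal.ofReal (v z * bracketPar z ^ (-r)) * (φ y *
            (ENNReal.ofReal (bracketXi (z - y) ^ (-r)) *
              wmul (fun z => bracketPar z ^ r) G' (z - y))) := by
            gcongr; exact le_wmul_bracketPar h0 G' _
        _ = _ := by ring
    calc wmul v (lconv F G) z
        = ENNReal.ofReal (v z * bracketPar z ^ (-r)) *
            (ENNReal.ofReal (bracketPar z ^ r) * lconv F G z) := by
          rw [wmul, ENNReal.ofReal_mul (hv0 z), mul_assoc,
            ofReal_rpow_neg_mul (bracketPar_pos z)]
      _ ≤ ENNReal.ofReal (v z * bracketPar z ^ (-r)) *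
            (lconv (wmul (fun z => bracketPar z ^ r) F) G z +
              lconv (wmul (fun z => bracketPar z ^ r) G) F z) := by
          gcongr; exact wmul_bracketPar_lconv_le h0 h1 hF hG z
      _ ≤ _ := by rw [mul_add]; exact add_le_add (hc _ _) (hc _ _)
  have hFw := measurable_wmul hP hF
  have hGw := measurable_wmul hP hG
  refine (l2_mono hpt).trans ((l2_add_le (measurable_bil hm hFw hGw).aemeasurable
    (measurable_bil hm hGw hFw).aemeasurable).trans ?_)
  refine (add_le_add (hbil _ _ hFw hGw) (hbil _ _ hGw hFw)).trans (le_of_eq ?_)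
  ring

theorem volume_parNhd_slice_le (ξ : EuclideanSpace ℝ (Fin 2)) (d : ℕ) :
    volume {τ : ℝ | (ξ, τ) ∈ parNhd d} ≤ 4 * twoPow d := by
  refine (measure_mono (t := Set.Icc (‖ξ‖ ^ 2 - 2 ^ (d + 1)) (‖ξ‖ ^ 2 + 2 ^ (d + 1))) ?_).trans ?_
  · intro τ hτ
    have h1 := abs_le.1 (abs_modul_le hτ)
    simp only [modul] at h1
    exact ⟨by linarith [h1.1], by linarith [h1.2]⟩
  · rw [Real.volume_Icc, show (4 : ℝ≥0∞) = ENNReal.ofReal 4 by norm_num]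
    refine ofReal_le_mul_twoPow ?_ (by norm_num)
    rw [Real.rpow_natCast, pow_succ 2 d]
    linarith

theorem measurable_bracket_sub (η : EuclideanSpace ℝ (Fin 2)) (p q : ℝ) :
    Measurable fun ξ : EuclideanSpace ℝ (Fin 2) =>
      ENNReal.ofReal ((1 + ‖ξ‖) ^ p * (1 + ‖ξ - η‖) ^ q) :=
  (((measurable_const.add measurable_norm).pow_const _).mul
    ((measurable_const.add (measurable_id.sub measurable_const).norm).pow_const _)).ennreal_ofReal

theorem rpow_neg_sq {x : ℝ} (hx : 0 < x) (r : ℝ) : (x ^ (-r)) ^ 2 = x ^ (-(2 * r)) := by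
  rw [← Real.rpow_natCast, ← Real.rpow_mul hx.le]; congr 1; push_cast; ring

/-- The output on one block of `K` for two functions in the `L²` part of `Y^s`. -/
theorem exists_l2_block_lconv_le {s : ℝ} (hs : -1 < s) (hs0 : s < 0) : ∃ C : ℝ≥0,
    ∀ F G : Freq → ℝ≥0∞, Measurable F → Measurable G → ∀ j d : ℕ,
      l2 (block (lconv F G) j d) ≤ twoPow (d / 2) * twoPow (-((s + (s + 1) / 2) * j)) *
        (C * (l2 (wmul (fun z => bracketPar z ^ (s + 1)) F) *
          l2 (wmul (fun z => bracketPar z ^ (s + 1)) G))) := by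
  obtain ⟨C, hC⟩ := exists_lintegral_rpow_mul_rpow_le (p := 1 - s) (q := 2 * (s + 1))
    (by linarith) (by linarith) (by linarith)
  refine ⟨2 * (4 * (1 + C)), fun F G hF hG j d => ?_⟩
  let v : Freq → ℝ := (annulus j ∩ parNhd d).indicator 1
  have hv : Measurable v := measurable_one.indicator (measurableSet_block j d)
  have hv0 : ∀ z, 0 ≤ v z := fun z => Set.indicator_nonneg (fun _ _ => zero_le_one) z
  have e : block (lconv F G) j d = wmul v (lconv F G) := by
    funext z
    by_cases hz : z ∈ annulus j ∩ parNhd d <;> simp [block, wmul, v, hz]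
  rw [e]
  refine (l2_wmul_lconv_le (r := s + 1) (by linarith) (by linarith) hF hG hv hv0
    (B := 4 * (1 + C) * (twoPow (d / 2) * twoPow (-((s + (s + 1) / 2) * j)))) fun η => ?_).trans
    (le_of_eq ?_)
  swap
  · push_cast; ring
  let c : ℝ := (2 : ℝ) ^ (-(2 * (s + 1) * j) + (j + 1) * (1 - s))
  let g : EuclideanSpace ℝ (Fin 2) → ℝ≥0∞ := fun ξ =>
    ENNReal.ofReal ((1 + ‖ξ‖) ^ (-(1 - s)) * (1 + ‖ξ - η‖) ^ (-(2 * (s + 1))))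
  have hg : Measurable g := measurable_bracket_sub η _ _
  have hpt : ∀ z : Freq, ENNReal.ofReal
      ((v z * bracketPar z ^ (-(s + 1)) * (1 + ‖z.1 - η‖) ^ (-(s + 1))) ^ 2) ≤
      ENNReal.ofReal c * (g z.1 * (parNhd d).indicator 1 z) := by
    intro z
    by_cases hz : z ∈ annulus j ∩ parNhd d
    swap
    · simp [v, hz]
    have hz1 : v z = 1 := Set.indicator_of_mem hz _
    rw [hz1, Set.indicator_of_mem hz.2, Pi.one_apply, mul_one, one_mul,
      ← ENNReal.ofReal_mul (by positivity)]
    apply ENNReal.ofReal_le_ofReal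
    have ha := bracketXi_pos z
    have hn : 0 < 1 + ‖z.1 - η‖ := by positivity
    rw [mul_pow, rpow_neg_sq (bracketPar_pos z), rpow_neg_sq hn, ← mul_assoc, ← bracketXi_eq]
    gcongr
    have h1 : bracketPar z ^ (-(2 * (s + 1))) ≤ (2 : ℝ) ^ (-(2 * (s + 1) * j)) := by
      refine (bracketPar_rpow_le_bracketXi (by linarith) z).trans
        ((rpow_le_of_mem_annulus (by linarith) hz.1).trans (le_of_eq ?_))
      congr 1; ring
    have h2 : 1 ≤ (2 : ℝ) ^ ((j + 1) * (1 - s)) * bracketXi z ^ (-(1 - s)) := by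
      have h3 : bracketXi z ^ (1 - s) ≤ (2 : ℝ) ^ ((j + 1) * (1 - s)) := by
        rw [Real.rpow_mul two_pos.le]
        refine Real.rpow_le_rpow ha.le ?_ (by linarith)
        have := hz.1.2.le
        exact_mod_cast this
      calc (1 : ℝ) = bracketXi z ^ (1 - s) * bracketXi z ^ (-(1 - s)) := by
            rw [← Real.rpow_add ha, add_neg_cancel, Real.rpow_zero]
        _ ≤ _ := by gcongr
    calc bracketPar z ^ (-(2 * (s + 1))) ≤ (2 : ℝ) ^ (-(2 * (s + 1) * j)) * 1 := by
          rw [mul_one]; exact h1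
      _ ≤ (2 : ℝ) ^ (-(2 * (s + 1) * j)) *
            ((2 : ℝ) ^ ((j + 1) * (1 - s)) * bracketXi z ^ (-(1 - s))) := by gcongr
      _ = c * bracketXi z ^ (-(1 - s)) := by
          simp only [c]; rw [Real.rpow_add two_pos]; ring
  have hmi : Measurable fun z : Freq => g z.1 * (parNhd d).indicator 1 z :=
    (hg.comp measurable_fst).mul (measurable_one.indicator (measurableSet_parNhd d))
  calc ∫⁻ z : Freq, ENNReal.ofReal
        ((v z * bracketPar z ^ (-(s + 1)) * (1 + ‖z.1 - η‖) ^ (-(s + 1))) ^ 2)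
      ≤ ∫⁻ z : Freq, ENNReal.ofReal c * (g z.1 * (parNhd d).indicator 1 z) := lintegral_mono hpt
    _ = ENNReal.ofReal c * ∫⁻ ξ, g ξ * volume {τ : ℝ | (ξ, τ) ∈ parNhd d} := by
        rw [lintegral_const_mul _ hmi, Measure.volume_eq_prod, lintegral_prod _ hmi.aemeasurable]
        congr 1
        refine lintegral_congr fun ξ => ?_
        have hS : MeasurableSet {τ : ℝ | (ξ, τ) ∈ parNhd d} :=
          measurable_prodMk_left (measurableSet_parNhd d)
        change ∫⁻ τ, g ξ * (parNhd d).indicator 1 (ξ, τ) = _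
        rw [lintegral_const_mul' (g ξ) _ ENNReal.ofReal_ne_top, ← lintegral_indicator_one hS]
        rfl
    _ ≤ ENNReal.ofReal c * (C * (4 * twoPow d)) := by
        refine mul_le_mul_right ?_ _
        calc ∫⁻ ξ, g ξ * volume {τ : ℝ | (ξ, τ) ∈ parNhd d}
            ≤ ∫⁻ ξ, g ξ * (4 * twoPow d) := by
              refine lintegral_mono fun ξ => ?_
              gcongr
              exact volume_parNhd_slice_le ξ d
          _ = (∫⁻ ξ, g ξ) * (4 * twoPow d) := lintegral_mul_const _ hg
          _ ≤ _ := by gcongr; exact hC η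
    _ ≤ _ := by
        have h4 : ENNReal.ofReal c ≤ 4 * twoPow (-((s + (s + 1) / 2) * j)) ^ 2 := by
          rw [ofReal_two_rpow, twoPow_sq, ← twoPow_two, ← twoPow_add]
          exact twoPow_mono (by linarith)
        have h5 : twoPow ((d : ℝ) / 2) ^ 2 = twoPow d := by
          rw [twoPow_sq]; congr 1; ring
        have h6 : (C : ℝ≥0∞) ≤ (1 + C) ^ 2 := by
          calc (C : ℝ≥0∞) ≤ 1 + C := le_add_self
            _ = (1 + C) * 1 := by ring
            _ ≤ (1 + C) * (1 + C) := by gcongr; exact le_self_add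
            _ = _ := by ring
        calc _ ≤ (4 * twoPow (-((s + (s + 1) / 2) * j)) ^ 2) * ((1 + C) ^ 2 * (4 * twoPow d)) := by
              gcongr
          _ = _ := by rw [← h5]; ring

theorem lintegral_fst_mul_snd {g : EuclideanSpace ℝ (Fin 2) → ℝ≥0∞} {t : ℝ → ℝ≥0∞}
    (hg : Measurable g) (ht : Measurable t) :
    ∫⁻ z : Freq, g z.1 * t z.2 = (∫⁻ ξ, g ξ) * ∫⁻ τ, t τ := by
  rw [Measure.volume_eq_prod, lintegral_prod_mul hg.aemeasurable ht.aemeasurable]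

theorem l2_const_le {c : ℝ≥0∞} {F G : Freq → ℝ≥0∞} (hG : Measurable G) (h : ∀ z, F z ≤ c * G z) :
    l2 F ≤ c * l2 G := (l2_mono h).trans (l2_const_mul c hG).le

/-- The weighted `L²` norm that controls the output off `K`, for two functions in the `L²` part of
`Y^s`. -/
theorem exists_l2_wmul_lconv_le {s : ℝ} (hs : -1 < s) (hs0 : s < 0) : ∃ C : ℝ≥0,
    ∀ F G : Freq → ℝ≥0∞, Measurable F → Measurable G →
      l2 (wmul (fun z => bracketXi z ^ s * bracketPar z ^ (-1 + (s + 1) / 4)) (lconv F G)) ≤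
        C * (l2 (wmul (fun z => bracketPar z ^ (s + 1)) F) *
          l2 (wmul (fun z => bracketPar z ^ (s + 1)) G)) := by
  obtain ⟨C, hC⟩ := exists_lintegral_rpow_mul_rpow_le (p := 1 - s) (q := 2 * (s + 1))
    (by linarith) (by linarith) (by linarith)
  obtain ⟨D, hD⟩ := exists_lintegral_one_add_abs_rpow_le (r := 1 + (s + 1) / 4) (by linarith)
  refine ⟨2 * (1 + C * D), fun F G hF hG => ?_⟩
  have hv : Measurable fun z => bracketXi z ^ s * bracketPar z ^ (-1 + (s + 1) / 4) :=
    (measurable_bracketXi_rpow _).mul (measurable_bracketPar_rpow _)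
  refine (l2_wmul_lconv_le (r := s + 1) (by linarith) (by linarith) hF hG hv
    (fun z => mul_nonneg (Real.rpow_nonneg (bracketXi_pos z).le _)
      (Real.rpow_nonneg (bracketPar_pos z).le _)) (B := 1 + C * D) fun η => ?_).trans
    (le_of_eq (by push_cast; ring))
  let g : EuclideanSpace ℝ (Fin 2) → ℝ≥0∞ := fun ξ =>
    ENNReal.ofReal ((1 + ‖ξ‖) ^ (-(1 - s)) * (1 + ‖ξ - η‖) ^ (-(2 * (s + 1))))
  let t : ℝ → ℝ≥0∞ := fun τ => ENNReal.ofReal ((1 + |τ|) ^ (-(1 + (s + 1) / 4)))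
  have hg : Measurable g := measurable_bracket_sub η _ _
  have ht : Measurable t := ((measurable_const.add measurable_id.abs).pow_const _).ennreal_ofReal
  calc ∫⁻ z : Freq, ENNReal.ofReal ((bracketXi z ^ s * bracketPar z ^ (-1 + (s + 1) / 4) *
        bracketPar z ^ (-(s + 1)) * (1 + ‖z.1 - η‖) ^ (-(s + 1))) ^ 2)
      ≤ ∫⁻ z : Freq, g z.1 * t z.2 := by
        refine lintegral_mono fun z => ?_
        have ha := bracketXi_pos z
        have hp := bracketPar_pos z
        have hn : 0 < 1 + ‖z.1 - η‖ := by positivity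
        simp only [g, t]
        rw [← ENNReal.ofReal_mul (by positivity)]
        apply ENNReal.ofReal_le_ofReal
        have e1 : (bracketXi z ^ s * bracketPar z ^ (-1 + (s + 1) / 4) *
            bracketPar z ^ (-(s + 1))) ^ 2 = bracketXi z ^ (2 * s) * (bracketPar z ^ (-(1 + s)) *
              bracketPar z ^ (-(2 * (1 + (s + 1) / 4)))) := by
          rw [mul_pow, mul_pow, ← Real.rpow_natCast, ← Real.rpow_natCast, ← Real.rpow_natCast,
            ← Real.rpow_mul ha.le, ← Real.rpow_mul hp.le, ← Real.rpow_mul hp.le, mul_assoc,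
            ← Real.rpow_add hp, ← Real.rpow_add hp]
          congr 2
          · push_cast; ring
          · push_cast; ring
        have e2 : bracketPar z ^ (-(1 + s)) * bracketPar z ^ (-(2 * (1 + (s + 1) / 4))) ≤
            bracketXi z ^ (-(1 + s)) * (1 + |z.2|) ^ (-(1 + (s + 1) / 4)) :=
          mul_le_mul (bracketPar_rpow_le_bracketXi (by linarith) z)
            (bracketPar_rpow_le_one_add_abs (by linarith) z) (Real.rpow_nonneg hp.le _)
            (Real.rpow_nonneg ha.le _)
        have e3 : bracketXi z ^ (2 * s) * bracketXi z ^ (-(1 + s)) = bracketXi z ^ (-(1 - s)) := by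
          rw [← Real.rpow_add ha]; congr 1; ring
        rw [mul_pow, rpow_neg_sq hn, e1, ← bracketXi_eq, ← e3]
        calc _ ≤ bracketXi z ^ (2 * s) * (bracketXi z ^ (-(1 + s)) *
                (1 + |z.2|) ^ (-(1 + (s + 1) / 4))) * (1 + ‖z.1 - η‖) ^ (-(2 * (s + 1))) :=
              mul_le_mul_of_nonneg_right (mul_le_mul_of_nonneg_left e2
                (Real.rpow_nonneg ha.le _)) (Real.rpow_nonneg hn.le _)
          _ = _ := by ring
    _ = (∫⁻ ξ, g ξ) * ∫⁻ τ, t τ := lintegral_fst_mul_snd hg ht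
    _ ≤ C * D := by gcongr; exact hC η
    _ ≤ (1 + C * D) * 1 := by rw [mul_one]; exact le_add_self
    _ ≤ (1 + C * D) ^ 2 := by rw [sq]; gcongr; exact le_self_add

/-- The interaction of two functions in the `L²` part of `Y^s`, with output in `Z^s`. -/
theorem exists_pN_weightedConv_le {s : ℝ} (hs : -1 < s) (hs0 : s < 0) : ∃ C : ℝ≥0,
    ∀ F G : Freq → ℝ≥0∞, Measurable F → Measurable G →
      pN s (wmul (fun z => (bracketMod z)⁻¹) (weightedConv F G)) ≤
        C * (l2 (wmul (fun z => bracketPar z ^ (s + 1)) F) *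
          l2 (wmul (fun z => bracketPar z ^ (s + 1)) G)) := by
  obtain ⟨C₁, h₁⟩ := exists_l2_block_lconv_le hs hs0
  obtain ⟨C₂, h₂⟩ := exists_l2_wmul_lconv_le hs hs0
  obtain ⟨C₃, h₃⟩ := exists_xN_regionK_div_le s (δ := (s + 1) / 2) (by linarith)
  obtain ⟨C₄, h₄⟩ := exists_yN_compl_div_le (s := s) (ε := (s + 1) / 4) hs0.le (by linarith)
  refine ⟨C₃ * (Real.toNNReal (2 ^ 10) * C₁) + C₄ * (Real.toNNReal (2 ^ 10) * C₂),
    fun F G hF hG => ?_⟩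
  have hl : Measurable (lconv F G) := measurable_lconv hF hG
  have hw := measurable_weightedConv hF hG
  have hv : Measurable fun z => bracketXi z ^ s * bracketPar z ^ (-1 + (s + 1) / 4) :=
    (measurable_bracketXi_rpow _).mul (measurable_bracketPar_rpow _)
  set N := l2 (wmul (fun z => bracketPar z ^ (s + 1)) F) *
    l2 (wmul (fun z => bracketPar z ^ (s + 1)) G) with hN
  have k1 := h₃ (weightedConv F G) (ENNReal.ofReal (2 ^ 10) * (C₁ * N)) hw fun j d _ => by
    calc l2 (block (weightedConv F G) j d)
        ≤ ENNReal.ofReal (2 ^ 10) * l2 (block (lconv F G) j d) := by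
          refine l2_const_le (measurable_block hl j d) fun z => ?_
          by_cases hz : z ∈ annulus j ∩ parNhd d
          · simp only [block, Set.indicator_of_mem hz]; exact weightedConv_le F G z
          · simp [block, hz]
      _ ≤ ENNReal.ofReal (2 ^ 10) *
            (twoPow (d / 2) * twoPow (-((s + (s + 1) / 2) * j)) * (C₁ * N)) := by
          gcongr; exact h₁ F G hF hG j d
      _ = _ := by ring
  have k2 := h₄ (weightedConv F G) hw
  have k3 : l2 (wmul (fun z => bracketXi z ^ s * bracketPar z ^ (-1 + (s + 1) / 4))
      (weightedConv F G)) ≤ ENNReal.ofReal (2 ^ 10) * (C₂ * N) := by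
    refine le_trans (l2_const_le (measurable_wmul hv hl) fun z => ?_)
      (mul_le_mul_right (h₂ F G hF hG) _)
    simp only [wmul]
    rw [mul_left_comm]
    gcongr
    exact weightedConv_le F G z
  unfold pN
  refine (add_le_add k1 (k2.trans (mul_le_mul_right k3 _))).trans (le_of_eq ?_)
  rw [ENNReal.ofReal]
  push_cast
  ring

/-! ### One factor in `K`: output off `K` -/

theorem weightRatio_nonneg (z y : Freq) : 0 ≤ weight z / (weight y * weight (z - y)) :=
  div_nonneg (weight_pos z).le (mul_pos (weight_pos y) (weight_pos _)).le

theorem weightRatio_le_of_mem_regionK {z y : Freq} (hy : y ∈ regionK) :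
    weight z / (weight y * weight (z - y)) ≤ 1 ∧
      weight z / (weight y * weight (z - y)) * bracketXi y ^ 2 ≤ 16 * bracketPar z ^ 2 := by
  obtain ⟨h1, h2⟩ := weight_le_of_mem_regionK (z := z) hy
  have hw := one_le_weight y
  have hv := weight_pos (z - y)
  have h3 : weight (z - y) ≤ weight y * weight (z - y) := le_mul_of_one_le_left hv.le hw
  constructor
  · rw [div_le_one (by positivity)]
    exact h1.trans h3
  · rw [div_mul_eq_mul_div, div_le_iff₀ (by positivity)]
    refine h2.trans ?_
    have : 0 ≤ bracketPar z ^ 2 := sq_nonneg _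
    nlinarith

/-- The gain from the weight when one factor lies in `K`. -/
theorem weightRatio_mul_rpow_le {z y : Freq} (hy : y ∈ regionK) {θ : ℝ} (h0 : 0 ≤ θ) (h1 : θ ≤ 1) :
    weight z / (weight y * weight (z - y)) * bracketXi y ^ θ ≤ 4 * bracketPar z ^ θ := by
  obtain ⟨k1, k2⟩ := weightRatio_le_of_mem_regionK (z := z) hy
  have k0 := weightRatio_nonneg z y
  set ω := weight z / (weight y * weight (z - y))
  have ha := bracketXi_pos y
  have hp := bracketPar_pos z
  have hω : ω ≤ ω ^ θ := by
    rcases eq_or_lt_of_le k0 with h | h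
    · rw [← h]; exact Real.rpow_nonneg le_rfl _
    · simpa using Real.rpow_le_rpow_of_exponent_ge h k1 h1
  have h4 : ω * bracketXi y ≤ 4 * bracketPar z := by
    refine le_of_sq_le_sq ?_ (by positivity)
    nlinarith [mul_nonneg k0 (mul_nonneg (sub_nonneg.2 k1) (sq_nonneg (bracketXi y)))]
  calc ω * bracketXi y ^ θ ≤ ω ^ θ * bracketXi y ^ θ := by gcongr
    _ = (ω * bracketXi y) ^ θ := (Real.mul_rpow k0 ha.le).symm
    _ ≤ (4 * bracketPar z) ^ θ := Real.rpow_le_rpow (by positivity) h4 h0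
    _ = 4 ^ θ * bracketPar z ^ θ := Real.mul_rpow (by norm_num) hp.le
    _ ≤ 4 * bracketPar z ^ θ := by
        gcongr
        calc (4 : ℝ) ^ θ ≤ 4 ^ (1 : ℝ) := Real.rpow_le_rpow_of_exponent_le (by norm_num) h1
          _ = 4 := Real.rpow_one 4

/-- The spatial kernel that controls the output off `K` when one factor lies in `K`. -/
def outKernel (s : ℝ) (ξ η : EuclideanSpace ℝ (Fin 2)) : ℝ :=
  8 * ((1 + ‖ξ‖) ^ (-(1 - (s + 1) / 4)) * (1 + ‖ξ - η‖) ^ (-(s + 1)) +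
    (1 + ‖ξ‖) ^ (-(2 + s - (s + 1) / 4)))

theorem outKernel_nonneg (s : ℝ) (ξ η : EuclideanSpace ℝ (Fin 2)) : 0 ≤ outKernel s ξ η := by
  unfold outKernel; positivity

theorem measurable_outKernel (s : ℝ) :
    Measurable (Function.uncurry fun ξ η => ENNReal.ofReal (outKernel s ξ η)) := by
  unfold outKernel Function.uncurry
  fun_prop

/-- Either `y` or `z - y` carries the parabolic bracket of `z`. In the first case the weight gains
a full power of `p(z) / a(y)`, in the second one the power `-s`. -/
theorem weightRatio_le_outKernel {s : ℝ} (hs : -1 < s) (hs0 : s < 0) {z y : Freq}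
    (hy : y ∈ regionK) :
    bracketXi z ^ s * bracketPar z ^ (-1 + (s + 1) / 4) *
      (weight z / (weight y * weight (z - y))) ≤
      outKernel s z.1 y.1 * (bracketXi y ^ s * bracketPar (z - y) ^ (s + 1)) := by
  have k0 := weightRatio_nonneg z y
  have hA := weightRatio_mul_rpow_le (z := z) hy zero_le_one le_rfl
  have hB := weightRatio_mul_rpow_le (z := z) hy (θ := -s) (by linarith) (by linarith)
  set ω := weight z / (weight y * weight (z - y))
  have ha := bracketXi_pos z
  have ha1 := bracketXi_pos y
  have hp := bracketPar_pos z
  have hp2 := bracketPar_pos (z - y)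
  have hq : 0 < 1 + ‖z.1 - y.1‖ := by positivity
  rw [Real.rpow_one, Real.rpow_one] at hA
  set ε := (s + 1) / 4 with hε
  have hadd : bracketPar z ^ (s + 1) ≤
      2 * bracketXi y ^ (s + 1) + bracketPar (z - y) ^ (s + 1) := by
    refine (bracketPar_rpow_le_add (by linarith) (by linarith) z y).trans (add_le_add_left ?_ _)
    calc bracketPar y ^ (s + 1) ≤ (2 * bracketXi y) ^ (s + 1) :=
          Real.rpow_le_rpow (bracketPar_pos y).le (bracketPar_le_of_mem_regionK hy) (by linarith)
      _ = 2 ^ (s + 1) * bracketXi y ^ (s + 1) := Real.mul_rpow two_pos.le ha1.le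
      _ ≤ 2 ^ (1 : ℝ) * bracketXi y ^ (s + 1) := by
          gcongr
          · norm_num
          · linarith
      _ = _ := by rw [Real.rpow_one]
  have e1 : bracketPar z ^ (-1 + ε) = bracketPar z ^ (-1 + ε - (s + 1)) * bracketPar z ^ (s + 1) := by
    rw [← Real.rpow_add hp]; congr 1; ring
  have e2 : bracketXi y ^ (s + 1) = bracketXi y ^ s * bracketXi y := by
    rw [Real.rpow_add_one ha1.ne']
  have e3 : (1 : ℝ) = bracketXi y ^ s * bracketXi y ^ (-s) := by
    rw [← Real.rpow_add ha1, add_neg_cancel, Real.rpow_zero]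
  have hP : 1 ≤ (1 + ‖z.1 - y.1‖) ^ (-(s + 1)) * bracketPar (z - y) ^ (s + 1) := by
    have h : 1 + ‖z.1 - y.1‖ ≤ bracketPar (z - y) := by
      have := bracketXi_le_bracketPar (z - y)
      rwa [bracketXi_eq] at this
    calc (1 : ℝ) = (1 + ‖z.1 - y.1‖) ^ (-(s + 1)) * (1 + ‖z.1 - y.1‖) ^ (s + 1) := by
          rw [← Real.rpow_add hq, neg_add_cancel, Real.rpow_zero]
      _ ≤ _ := by
          gcongr
          linarith
  set Q := (1 + ‖z.1 - y.1‖) ^ (-(s + 1))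
  have hQ : 0 < Q := Real.rpow_pos_of_pos hq _
  -- the part in which the spatial frequency of `y` carries the modulus of `z`
  have tA : bracketXi z ^ s * bracketPar z ^ (-1 + ε - (s + 1)) * ω *
      (2 * (bracketXi y ^ s * bracketXi y)) ≤
      8 * (bracketXi z ^ (-(1 - ε)) * Q) * (bracketXi y ^ s * bracketPar (z - y) ^ (s + 1)) := by
    have h1 : bracketPar z ^ (-1 + ε - (s + 1)) * bracketPar z ≤ bracketXi z ^ (ε - (s + 1)) := by
      rw [← Real.rpow_add_one hp.ne']
      refine le_trans (le_of_eq ?_) (bracketPar_rpow_le_bracketXi (r := ε - (s + 1)) (by linarith) z)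
      congr 1; ring
    have h2 : bracketXi z ^ s * bracketXi z ^ (ε - (s + 1)) = bracketXi z ^ (-(1 - ε)) := by
      rw [← Real.rpow_add ha]; congr 1; ring
    have P1 : 0 ≤ bracketXi z ^ s := Real.rpow_nonneg ha.le _
    have P2 : 0 ≤ bracketPar z ^ (-1 + ε - (s + 1)) := Real.rpow_nonneg hp.le _
    have P3 : 0 ≤ bracketXi y ^ s := Real.rpow_nonneg ha1.le _
    have P4 : 0 ≤ bracketXi z ^ (-(1 - ε)) := Real.rpow_nonneg ha.le _
    calc _ = 2 * (bracketXi z ^ s * bracketPar z ^ (-1 + ε - (s + 1)) * bracketXi y ^ s) *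
            (ω * bracketXi y) := by ring
      _ ≤ 2 * (bracketXi z ^ s * bracketPar z ^ (-1 + ε - (s + 1)) * bracketXi y ^ s) *
            (4 * bracketPar z) := by gcongr
      _ = 8 * (bracketXi z ^ s * bracketXi y ^ s) *
            (bracketPar z ^ (-1 + ε - (s + 1)) * bracketPar z) := by ring
      _ ≤ 8 * (bracketXi z ^ s * bracketXi y ^ s) * bracketXi z ^ (ε - (s + 1)) := by gcongr
      _ = 8 * (bracketXi z ^ (-(1 - ε)) * bracketXi y ^ s) * 1 := by rw [← h2]; ring
      _ ≤ 8 * (bracketXi z ^ (-(1 - ε)) * bracketXi y ^ s) *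
            (Q * bracketPar (z - y) ^ (s + 1)) := by gcongr
      _ = _ := by ring
  -- the part in which `z - y` carries the modulus of `z`
  have tB : bracketXi z ^ s * bracketPar z ^ (-1 + ε - (s + 1)) * ω * bracketPar (z - y) ^ (s + 1) ≤
      8 * bracketXi z ^ (-(2 + s - ε)) * (bracketXi y ^ s * bracketPar (z - y) ^ (s + 1)) := by
    have h1 : bracketPar z ^ (-1 + ε - (s + 1)) * bracketPar z ^ (-s) ≤
        bracketXi z ^ (-2 - 2 * s + ε) := by
      rw [← Real.rpow_add hp]
      refine le_trans (le_of_eq ?_)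
        (bracketPar_rpow_le_bracketXi (r := -2 - 2 * s + ε) (by linarith) z)
      congr 1; ring
    have h2 : bracketXi z ^ s * bracketXi z ^ (-2 - 2 * s + ε) = bracketXi z ^ (-(2 + s - ε)) := by
      rw [← Real.rpow_add ha]; congr 1; ring
    have P1 : 0 ≤ bracketXi z ^ s := Real.rpow_nonneg ha.le _
    have P2 : 0 ≤ bracketPar z ^ (-1 + ε - (s + 1)) := Real.rpow_nonneg hp.le _
    have P3 : 0 ≤ bracketXi y ^ s := Real.rpow_nonneg ha1.le _
    have P4 : 0 ≤ bracketXi z ^ (-(2 + s - ε)) := Real.rpow_nonneg ha.le _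
    have P5 : 0 ≤ bracketPar (z - y) ^ (s + 1) := Real.rpow_nonneg hp2.le _
    calc _ = bracketXi z ^ s * bracketPar z ^ (-1 + ε - (s + 1)) * bracketPar (z - y) ^ (s + 1) *
            bracketXi y ^ s * (ω * bracketXi y ^ (-s)) := by
          rw [← mul_one (_ * bracketPar (z - y) ^ (s + 1)), e3]; ring
      _ ≤ bracketXi z ^ s * bracketPar z ^ (-1 + ε - (s + 1)) * bracketPar (z - y) ^ (s + 1) *
            bracketXi y ^ s * (4 * bracketPar z ^ (-s)) := by gcongr
      _ = 4 * (bracketXi z ^ s * bracketPar (z - y) ^ (s + 1) * bracketXi y ^ s) *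
            (bracketPar z ^ (-1 + ε - (s + 1)) * bracketPar z ^ (-s)) := by ring
      _ ≤ 4 * (bracketXi z ^ s * bracketPar (z - y) ^ (s + 1) * bracketXi y ^ s) *
            bracketXi z ^ (-2 - 2 * s + ε) := by gcongr
      _ = 4 * (bracketXi z ^ (-(2 + s - ε)) * (bracketXi y ^ s * bracketPar (z - y) ^ (s + 1))) := by
          rw [← h2]; ring
      _ ≤ 8 * (bracketXi z ^ (-(2 + s - ε)) * (bracketXi y ^ s * bracketPar (z - y) ^ (s + 1))) := by
          gcongr; norm_num
      _ = _ := by ring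
  have P1 : 0 ≤ bracketXi z ^ s := Real.rpow_nonneg ha.le _
  have P2 : 0 ≤ bracketPar z ^ (-1 + ε - (s + 1)) := Real.rpow_nonneg hp.le _
  calc bracketXi z ^ s * bracketPar z ^ (-1 + ε) * ω
      = bracketXi z ^ s * bracketPar z ^ (-1 + ε - (s + 1)) * ω * bracketPar z ^ (s + 1) := by
        rw [e1]; ring
    _ ≤ bracketXi z ^ s * bracketPar z ^ (-1 + ε - (s + 1)) * ω *
          (2 * bracketXi y ^ (s + 1) + bracketPar (z - y) ^ (s + 1)) := by gcongr
    _ = bracketXi z ^ s * bracketPar z ^ (-1 + ε - (s + 1)) * ω *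
          (2 * (bracketXi y ^ s * bracketXi y)) +
          bracketXi z ^ s * bracketPar z ^ (-1 + ε - (s + 1)) * ω *
            bracketPar (z - y) ^ (s + 1) := by rw [e2]; ring
    _ ≤ _ := add_le_add tA tB
    _ = _ := by rw [outKernel, ← bracketXi_eq]; ring

theorem exists_lintegral_outKernel_sq_le {s : ℝ} (hs : -1 < s) (hs0 : s < 0) : ∃ C : ℝ≥0,
    ∀ η, ∫⁻ ξ, ENNReal.ofReal (outKernel s ξ η) ^ 2 ≤ C := by
  obtain ⟨C, hC⟩ := exists_lintegral_rpow_mul_rpow_le (p := 2 * (1 - (s + 1) / 4))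
    (q := 2 * (s + 1)) (by linarith) (by linarith) (by linarith)
  obtain ⟨D, hD⟩ := exists_lintegral_rpow_mul_rpow_le (p := 2 + s - (s + 1) / 4)
    (q := 2 + s - (s + 1) / 4) (by linarith) (by linarith) (by linarith)
  refine ⟨Real.toNNReal 128 * (C + D), fun η => ?_⟩
  let u : EuclideanSpace ℝ (Fin 2) → ℝ := fun ξ =>
    (1 + ‖ξ‖) ^ (-(2 * (1 - (s + 1) / 4))) * (1 + ‖ξ - η‖) ^ (-(2 * (s + 1)))
  let v : EuclideanSpace ℝ (Fin 2) → ℝ := fun ξ =>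
    (1 + ‖ξ‖) ^ (-(2 + s - (s + 1) / 4)) * (1 + ‖ξ - 0‖) ^ (-(2 + s - (s + 1) / 4))
  have hu : ∀ ξ, 0 ≤ u ξ := fun ξ => by simp only [u]; positivity
  have hv : ∀ ξ, 0 ≤ v ξ := fun ξ => by simp only [v]; positivity
  have hum : Measurable fun ξ => ENNReal.ofReal (u ξ) := by simp only [u]; fun_prop
  have hvm : Measurable fun ξ => ENNReal.ofReal (v ξ) := by simp only [v]; fun_prop
  calc ∫⁻ ξ, ENNReal.ofReal (outKernel s ξ η) ^ 2
      ≤ ∫⁻ ξ, ENNReal.ofReal 128 * (ENNReal.ofReal (u ξ) + ENNReal.ofReal (v ξ)) := by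
        refine lintegral_mono fun ξ => ?_
        rw [← ENNReal.ofReal_add (hu ξ) (hv ξ), ← ENNReal.ofReal_mul (by norm_num),
          ← ENNReal.ofReal_pow (outKernel_nonneg s ξ η)]
        refine ENNReal.ofReal_le_ofReal ?_
        have h1 : 0 < 1 + ‖ξ‖ := by positivity
        have h2 : 0 < 1 + ‖ξ - η‖ := by positivity
        have eu : u ξ = ((1 + ‖ξ‖) ^ (-(1 - (s + 1) / 4)) * (1 + ‖ξ - η‖) ^ (-(s + 1))) ^ 2 := by
          rw [mul_pow, rpow_neg_sq h1, rpow_neg_sq h2]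
        have ev : v ξ = ((1 + ‖ξ‖) ^ (-(2 + s - (s + 1) / 4))) ^ 2 := by
          simp only [v, sub_zero]; ring
        rw [eu, ev, outKernel]
        nlinarith [sq_nonneg ((1 + ‖ξ‖) ^ (-(1 - (s + 1) / 4)) * (1 + ‖ξ - η‖) ^ (-(s + 1)) -
          (1 + ‖ξ‖) ^ (-(2 + s - (s + 1) / 4)))]
    _ = ENNReal.ofReal 128 * ((∫⁻ ξ, ENNReal.ofReal (u ξ)) + ∫⁻ ξ, ENNReal.ofReal (v ξ)) := by
        rw [lintegral_const_mul' _ _ ENNReal.ofReal_ne_top, lintegral_add_left hum]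
    _ ≤ ENNReal.ofReal 128 * (C + D) := mul_le_mul_right (add_le_add (hC η) (hD 0)) _
    _ = _ := by rw [ENNReal.ofReal]; push_cast; ring

theorem mixN_sq (F : Freq → ℝ≥0∞) :
    mixN F ^ 2 = ∫⁻ ξ : EuclideanSpace ℝ (Fin 2), (∫⁻ τ : ℝ, F (ξ, τ)) ^ 2 := by
  rw [mixN]; exact rpow_half_sq _

theorem lintegral_l2_snd_sq {G : Freq → ℝ≥0∞} (hG : Measurable G) :
    ∫⁻ ξ : EuclideanSpace ℝ (Fin 2), (l2 fun τ : ℝ => G (ξ, τ)) ^ 2 = l2 G ^ 2 := by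
  simp only [l2_sq]
  rw [Measure.volume_eq_prod, lintegral_prod _ (hG.pow_const 2).aemeasurable]

theorem exists_l2_bil_outKernel_le {s : ℝ} (hs : -1 < s) (hs0 : s < 0) : ∃ C : ℝ≥0,
    ∀ F G : Freq → ℝ≥0∞, Measurable F → Measurable G →
      l2 (bil (fun z y : Freq => ENNReal.ofReal (outKernel s z.1 y.1)) F G) ≤
        C * (mixN F * l2 G) := by
  obtain ⟨C, hC⟩ := exists_lintegral_outKernel_sq_le hs hs0
  refine ⟨1 + C, fun F G hF hG => ?_⟩
  have hl : Measurable fun ξ : EuclideanSpace ℝ (Fin 2) => l2 fun τ : ℝ => G (ξ, τ) :=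
    (measurable_lintegral_snd (hG.pow_const 2)).pow_const _
  rw [l2_le_iff]
  calc _ ≤ _ := lintegral_bil_fst_sq_le (measurable_outKernel s) hF hG
    _ ≤ C * ((∫⁻ ξ, (∫⁻ τ, F (ξ, τ)) ^ 2) * ∫⁻ ξ, (l2 fun τ => G (ξ, τ)) ^ 2) :=
        lintegral_bil_sq_le_of_left (measurable_outKernel s) (measurable_lintegral_snd hF) hl hC
    _ = C * (mixN F ^ 2 * l2 G ^ 2) := by rw [← mixN_sq, lintegral_l2_snd_sq hG]
    _ ≤ (1 + C) ^ 2 * (mixN F ^ 2 * l2 G ^ 2) := by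
        refine mul_le_mul_left ?_ _
        calc (C : ℝ≥0∞) ≤ 1 + C := le_add_self
          _ = (1 + C) * 1 := by ring
          _ ≤ (1 + C) * (1 + C) := by gcongr; exact le_self_add
          _ = _ := by ring
    _ = _ := by push_cast; ring

/-- The interaction of a function supported in `K` with one in the `L²` part of `Y^s`,
with output off `K`. -/
theorem exists_yN_weightedConv_le {s : ℝ} (hs : -1 < s) (hs0 : s < 0) : ∃ C : ℝ≥0,
    ∀ F G : Freq → ℝ≥0∞, Measurable F → Measurable G → (∀ z, F z ≠ 0 → z ∈ regionK) →
      yN s (regionKᶜ.indicator (wmul (fun z => (bracketMod z)⁻¹) (weightedConv F G))) ≤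
        C * (xN s F * l2 (wmul (fun z => bracketPar z ^ (s + 1)) G)) := by
  obtain ⟨C₁, h₁⟩ := exists_yN_compl_div_le (s := s) (ε := (s + 1) / 4) hs0.le (by linarith)
  obtain ⟨C₂, h₂⟩ := exists_l2_bil_outKernel_le hs hs0
  refine ⟨C₁ * (C₂ * 2), fun F G hF hG hFK => ?_⟩
  have hF' := measurable_wmul (measurable_bracketXi_rpow s) hF
  have hG' := measurable_wmul (measurable_bracketPar_rpow (s + 1)) hG
  have key : ∀ z, wmul (fun z => bracketXi z ^ s * bracketPar z ^ (-1 + (s + 1) / 4))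
      (weightedConv F G) z ≤ bil (fun z y : Freq => ENNReal.ofReal (outKernel s z.1 y.1))
        (wmul (fun z => bracketXi z ^ s) F) (wmul (fun z => bracketPar z ^ (s + 1)) G) z := by
    intro z
    unfold wmul weightedConv bil
    rw [← lintegral_const_mul' _ _ ENNReal.ofReal_ne_top]
    refine lintegral_mono fun y => ?_
    by_cases hy : F y = 0
    · simp [hy]
    have h := ENNReal.ofReal_le_ofReal (weightRatio_le_outKernel hs hs0 (z := z) (hFK y hy))
    have n1 : 0 ≤ bracketXi z ^ s * bracketPar z ^ (-1 + (s + 1) / 4) :=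
      mul_nonneg (Real.rpow_nonneg (bracketXi_pos z).le _) (Real.rpow_nonneg (bracketPar_pos z).le _)
    rw [ENNReal.ofReal_mul n1, ENNReal.ofReal_mul (outKernel_nonneg _ _ _),
      ENNReal.ofReal_mul (Real.rpow_nonneg (bracketXi_pos y).le _)] at h
    calc _ = _ * (F y * G (z - y)) := (mul_assoc _ _ _).symm
      _ ≤ _ * (F y * G (z - y)) := mul_le_mul_left h _
      _ = _ := by ring
  calc _ ≤ C₁ * l2 (wmul (fun z => bracketXi z ^ s * bracketPar z ^ (-1 + (s + 1) / 4))
          (weightedConv F G)) := h₁ _ (measurable_weightedConv hF hG)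
    _ ≤ C₁ * (C₂ * (mixN (wmul (fun z => bracketXi z ^ s) F) *
          l2 (wmul (fun z => bracketPar z ^ (s + 1)) G))) := by
        gcongr
        exact (l2_mono key).trans (h₂ _ _ hF' hG')
    _ ≤ C₁ * (C₂ * (2 * xN s F * l2 (wmul (fun z => bracketPar z ^ (s + 1)) G))) := by
        gcongr; exact mixN_wmul_le_xN hs0.le hF
    _ = _ := by push_cast; ring

/-! ### One factor in `K`: output on `K` -/

/-- Schur's test for sequences. -/
theorem tsum_schur_le {k : ℕ → ℕ → ℝ≥0∞} {D : ℝ≥0∞} (h1 : ∀ j, ∑' i, k j i ≤ D)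
    (h2 : ∀ i, ∑' j, k j i ≤ D) (x : ℕ → ℝ≥0∞) :
    ∑' j, (∑' i, k j i * x i) ^ 2 ≤ D ^ 2 * ∑' i, x i ^ 2 := by
  calc ∑' j, (∑' i, k j i * x i) ^ 2 ≤ ∑' j, D * ∑' i, k j i * x i ^ 2 := by
        refine ENNReal.tsum_le_tsum fun j => ?_
        have h := tsum_mul_sq_le (fun i => k j i ^ (1 / 2 : ℝ)) fun i => k j i ^ (1 / 2 : ℝ) * x i
        simp only [← mul_assoc, mul_pow, rpow_half_sq] at h
        simp only [← sq, rpow_half_sq] at h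
        exact h.trans (mul_le_mul_left (h1 j) _)
    _ = D * ∑' i, (∑' j, k j i) * x i ^ 2 := by
        rw [ENNReal.tsum_mul_left, ENNReal.tsum_comm]
        simp only [ENNReal.tsum_mul_right]
    _ ≤ D * ∑' i, D * x i ^ 2 := by
        gcongr with i
        exact h2 i
    _ = _ := by rw [ENNReal.tsum_mul_left]; ring

theorem exists_tsum_twoPow_le {δ : ℝ} (hδ : 0 < δ) :
    ∃ C : ℝ≥0, ∑' j : ℕ, twoPow (-(δ * j)) ≤ C := by
  obtain ⟨C, hC⟩ := exists_tsum_pow_mul_twoPow_le 0 hδ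
  exact ⟨C, by simpa using hC⟩

/-- A sequence that is dominated by `v` on either side of `j`, counted away from `j`, has sum at
most `2 ∑ v`. -/
theorem tsum_le_add_of_dist {u v : ℕ → ℝ≥0∞} (j : ℕ) (h1 : ∀ i < j, u i ≤ v (j - 1 - i))
    (h2 : ∀ i, u (i + j) ≤ v i) : ∑' i, u i ≤ (∑' i, v i) + ∑' i, v i := by
  rw [← Summable.sum_add_tsum_nat_add' (k := j) (ENNReal.summable (f := fun i => u (i + j)))]
  refine add_le_add ?_ (ENNReal.tsum_le_tsum h2)
  calc ∑ i ∈ Finset.range j, u i ≤ ∑ i ∈ Finset.range j, v (j - 1 - i) :=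
        Finset.sum_le_sum fun i hi => h1 i (Finset.mem_range.1 hi)
    _ = ∑ i ∈ Finset.range j, v i := Finset.sum_range_reflect v j
    _ ≤ _ := ENNReal.sum_le_tsum _

theorem exists_tsum_twoPow_abs_le {δ : ℝ} (hδ : 0 < δ) :
    ∃ C : ℝ≥0, ∀ j : ℕ, ∑' i : ℕ, twoPow (-(δ * |(j : ℝ) - i|)) ≤ C := by
  obtain ⟨C, hC⟩ := exists_tsum_twoPow_le hδ
  refine ⟨C + C, fun j => ?_⟩
  rw [ENNReal.coe_add]
  refine (tsum_le_add_of_dist j (v := fun i : ℕ => twoPow (-(δ * i))) (fun i hi => ?_)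
    fun i => ?_).trans (add_le_add hC hC)
  · refine twoPow_mono (neg_le_neg (mul_le_mul_of_nonneg_left ?_ hδ.le))
    have h : ((j - 1 - i : ℕ) : ℝ) + 1 + i = j := by
      have : j - 1 - i + 1 + i = j := by omega
      exact_mod_cast this
    exact le_trans (by linarith) (le_abs_self _)
  · refine twoPow_mono (neg_le_neg (mul_le_mul_of_nonneg_left ?_ hδ.le))
    push_cast
    rw [show (j : ℝ) - (i + j) = -i by ring, abs_neg, abs_of_nonneg (Nat.cast_nonneg i)]

theorem bil_tsum_left {m : Freq → Freq → ℝ≥0∞} {F : ℕ → Freq → ℝ≥0∞} {G : Freq → ℝ≥0∞}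
    (hm : Measurable (Function.uncurry m)) (hF : ∀ i, Measurable (F i)) (hG : Measurable G)
    (z : Freq) : bil m (fun y => ∑' i, F i y) G z = ∑' i, bil m (F i) G z := by
  unfold bil
  rw [← lintegral_tsum]
  · refine lintegral_congr fun y => ?_
    rw [← ENNReal.tsum_mul_right, ← ENNReal.tsum_mul_left]
  · intro i
    exact ((hm.comp measurable_prodMk_left).mul ((hF i).mul
      (hG.comp (measurable_const.sub measurable_id)))).aemeasurable

theorem lconv_tsum_left {F : ℕ → Freq → ℝ≥0∞} {G : Freq → ℝ≥0∞} (hF : ∀ i, Measurable (F i))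
    (hG : Measurable G) (z : Freq) :
    lconv (fun y => ∑' i, F i y) G z = ∑' i, lconv (F i) G z := by
  rw [← bil_one, bil_tsum_left measurable_const hF hG]
  simp only [bil_one]

theorem lconv_tsum_right {F : Freq → ℝ≥0∞} {G : ℕ → Freq → ℝ≥0∞} (hF : Measurable F)
    (hG : ∀ i, Measurable (G i)) (z : Freq) :
    lconv F (fun y => ∑' i, G i y) z = ∑' i, lconv F (G i) z := by
  rw [lconv_comm, lconv_tsum_left hG hF]
  exact tsum_congr fun i => lconv_comm _ _ _

theorem weightedConv_tsum_left {F : ℕ → Freq → ℝ≥0∞} {G : Freq → ℝ≥0∞}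
    (hF : ∀ i, Measurable (F i)) (hG : Measurable G) (z : Freq) :
    weightedConv (fun y => ∑' i, F i y) G z = ∑' i, weightedConv (F i) G z :=
  bil_tsum_left measurable_weightRatio hF hG z

theorem tsum_indicator_annulus (G : Freq → ℝ≥0∞) (z : Freq) :
    ∑' l : ℕ, (annulus l).indicator G z = G z := by
  obtain ⟨l, hl⟩ := exists_mem_annulus z
  rw [tsum_eq_single l fun l' h => Set.indicator_of_notMem (fun h' => h (annulus_unique h' hl)) _,
    Set.indicator_of_mem hl]

/-- On `K`, the weight ratio compensates for the loss of `2^{s(j-j₁)}` when `j < j₁`. -/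
theorem weightRatio_le_of_mem_annulus {s : ℝ} (hs : -1 < s) (hs0 : s < 0) {z y : Freq} {j i : ℕ}
    (hz : z ∈ regionK) (hzj : z ∈ annulus j) (hy : y ∈ regionK) (hyi : y ∈ annulus i) :
    weight z / (weight y * weight (z - y)) ≤
      256 * (2 : ℝ) ^ (-(-s * |(j : ℝ) - i|) + s * i - s * j) := by
  obtain ⟨k1, k2⟩ := weightRatio_le_of_mem_regionK (z := z) hy
  have k0 := weightRatio_nonneg z y
  set ω := weight z / (weight y * weight (z - y))
  rcases le_total i j with hij | hij
  · have hij' : (i : ℝ) ≤ j := by exact_mod_cast hij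
    rw [abs_of_nonneg (by linarith), show -(-s * ((j : ℝ) - i)) + s * i - s * j = 0 by ring,
      Real.rpow_zero]
    linarith
  · have hij' : (j : ℝ) ≤ i := by exact_mod_cast hij
    rw [abs_of_nonpos (by linarith)]
    have h1 : (2 : ℝ) ^ (2 * ((j : ℝ) - i)) ≤
        (2 : ℝ) ^ (-(-s * -((j : ℝ) - i)) + s * i - s * j) := by
      refine Real.rpow_le_rpow_of_exponent_le one_le_two ?_
      nlinarith
    have h2 : (2 : ℝ) ^ (2 * ((j : ℝ) - i)) * (2 ^ i) ^ 2 = (2 ^ j) ^ 2 := by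
      rw [← Real.rpow_natCast 2 i, ← Real.rpow_natCast 2 j, ← Real.rpow_natCast _ 2,
        ← Real.rpow_natCast _ 2, ← Real.rpow_mul two_pos.le, ← Real.rpow_mul two_pos.le,
        ← Real.rpow_add two_pos]
      congr 1; push_cast; ring
    have h3 : bracketPar z ≤ 4 * 2 ^ j := by
      have := bracketPar_le_of_mem_regionK hz
      have h := hzj.2
      rw [pow_succ 2 j] at h
      linarith
    have h4 : (2 : ℝ) ^ i ≤ bracketXi y := hyi.1
    have h5 : ω * (2 ^ i) ^ 2 ≤ 256 * (2 ^ j) ^ 2 := by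
      calc ω * (2 ^ i) ^ 2 ≤ ω * bracketXi y ^ 2 := by gcongr
        _ ≤ 16 * bracketPar z ^ 2 := k2
        _ ≤ 16 * (4 * 2 ^ j) ^ 2 := by
            have := (bracketPar_pos z).le
            gcongr
        _ = _ := by ring
    have h6 : (0 : ℝ) < (2 ^ i) ^ 2 := by positivity
    have h7 : ω ≤ 256 * (2 : ℝ) ^ (2 * ((j : ℝ) - i)) := by
      refine le_of_mul_le_mul_right ?_ h6
      rw [mul_assoc, h2]
      exact h5
    linarith

theorem l2_indicator_le {S : Set Freq} (F : Freq → ℝ≥0∞) : l2 (S.indicator F) ≤ l2 F :=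
  l2_mono fun z => Set.indicator_le_self _ _ z

/-- The geometric mean of the two bounds for the product of a block with an annulus. -/
theorem l2_indicator_lconv_le_of_annulus_interp {F G : Freq → ℝ≥0∞} (hF : Measurable F)
    (hG : Measurable G) {κ : ℝ} (hκ : 0 ≤ κ) (hκ1 : κ ≤ 1) {d d₁ l : ℕ}
    (h1 : ∀ z, F z ≠ 0 → z ∈ parNhd d₁) (h2 : ∀ z, G z ≠ 0 → z ∈ annulus l) :
    l2 ((parNhd d).indicator (lconv F G)) ≤
      8 * twoPow (d₁ / 2 + (1 - κ) * (d / 2) + κ * l) * (l2 F * l2 G) := by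
  have hd : (0 : ℝ) ≤ d := Nat.cast_nonneg d
  have hl : (0 : ℝ) ≤ l := Nat.cast_nonneg l
  rcases le_or_gt ((l : ℝ)) (d / 2) with h | h
  · refine ((l2_indicator_le _).trans (l2_lconv_le_of_annulus hF hG h1 h2)).trans ?_
    refine mul_le_mul_left (mul_le_mul_right (twoPow_mono ?_) _) _
    nlinarith
  · have hl1 : 1 ≤ l := by
      by_contra h0
      have : l = 0 := by omega
      rw [this] at h
      simp only [Nat.cast_zero] at h
      linarith
    refine (l2_indicator_lconv_le_of_annulus hF hG hl1 h1 h2).trans ?_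
    refine mul_le_mul_left (mul_le_mul_right (twoPow_mono ?_) _) _
    nlinarith

theorem l2_indicator_annulus_le {r : ℝ} (hr : 0 ≤ r) {G : Freq → ℝ≥0∞} (hG : Measurable G)
    (l : ℕ) : l2 ((annulus l).indicator G) ≤
      twoPow (-(r * l)) * l2 (wmul (fun z => bracketPar z ^ r) G) := by
  refine l2_const_le (measurable_wmul (measurable_bracketPar_rpow r) hG) fun z => ?_
  by_cases hz : z ∈ annulus l
  swap
  · rw [Set.indicator_of_notMem hz]; exact zero_le
  rw [Set.indicator_of_mem hz]
  refine (le_wmul_bracketPar hr G z).trans (mul_le_mul_left ?_ _)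
  rw [← ofReal_two_rpow]
  refine ENNReal.ofReal_le_ofReal ((rpow_le_of_mem_annulus (by linarith) hz).trans (le_of_eq ?_))
  congr 1; ring

theorem tsum_twoPow_mul_l2_block (s : ℝ) (F : Freq → ℝ≥0∞) (i : ℕ) :
    ∑' d : ℕ, twoPow (d / 2) * l2 (block F i d) = twoPow (-(s * i)) * xPart s F i := by
  have h : twoPow (-(s * i)) * twoPow (s * i) = 1 := by
    rw [← twoPow_add, neg_add_cancel, twoPow_zero]
  unfold xPart
  rw [← mul_assoc, h, one_mul]

/-- The output on one block of the product of the part of `F` in one annulus with `G`. -/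
theorem exists_l2_indicator_lconv_annulus_le {s : ℝ} (hs : -1 < s) (hs0 : s < 0) : ∃ C : ℝ≥0,
    ∀ F G : Freq → ℝ≥0∞, Measurable F → Measurable G → ∀ i d : ℕ,
      l2 ((parNhd d).indicator (lconv (fun y => ∑' e, block F i e y) G)) ≤
        C * (twoPow ((1 - (s + 1) / 2) * (d / 2)) * (twoPow (-(s * i)) * xPart s F i *
          l2 (wmul (fun z => bracketPar z ^ (s + 1)) G))) := by
  obtain ⟨C, hC⟩ := exists_tsum_twoPow_le (δ := (s + 1) / 2) (by linarith)
  refine ⟨8 * C, fun F G hF hG i d => ?_⟩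
  set N := l2 (wmul (fun z => bracketPar z ^ (s + 1)) G) with hN
  have hb := fun e => measurable_block hF i e
  have ha : ∀ l, Measurable ((annulus l).indicator G) := fun l =>
    hG.indicator (measurableSet_annulus l)
  have hm : ∀ e l, Measurable ((parNhd d).indicator (lconv (block F i e) ((annulus l).indicator G))) :=
    fun e l => (measurable_lconv (hb e) (ha l)).indicator (measurableSet_parNhd d)
  have e1 : (parNhd d).indicator (lconv (fun y => ∑' e, block F i e y) G) = fun z =>
      ∑' e, ∑' l, (parNhd d).indicator (lconv (block F i e) ((annulus l).indicator G)) z := by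
    funext z
    by_cases hz : z ∈ parNhd d
    · simp only [Set.indicator_of_mem hz]
      rw [lconv_tsum_left hb hG]
      refine tsum_congr fun e => ?_
      rw [← lconv_tsum_right (hb e) ha]
      simp only [tsum_indicator_annulus]
    · simp only [Set.indicator_of_notMem hz, tsum_zero]
  rw [e1]
  calc _ ≤ ∑' e, ∑' l, l2 ((parNhd d).indicator
          (lconv (block F i e) ((annulus l).indicator G))) :=
        (l2_tsum_le fun e => Measurable.tsum (hm e)).trans
          (ENNReal.tsum_le_tsum fun e => l2_tsum_le (hm e))
    _ ≤ ∑' e : ℕ, ∑' l : ℕ, (8 * twoPow ((1 - (s + 1) / 2) * (d / 2)) * N) *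
          (twoPow (e / 2) * l2 (block F i e)) * twoPow (-((s + 1) / 2 * l)) := by
        refine ENNReal.tsum_le_tsum fun e => ENNReal.tsum_le_tsum fun l => ?_
        refine (l2_indicator_lconv_le_of_annulus_interp (hb e) (ha l) (κ := (s + 1) / 2)
          (by linarith) (by linarith) (fun z hz => (block_mem hz).2)
          (fun z hz => Set.mem_of_indicator_ne_zero hz)).trans ?_
        have e2 : twoPow (-((s + 1) / 2 * l)) = twoPow ((s + 1) / 2 * l) *
            twoPow (-((s + 1) * l)) := by
          rw [← twoPow_add]; congr 1; ring
        calc _ ≤ 8 * twoPow (e / 2 + (1 - (s + 1) / 2) * (d / 2) + (s + 1) / 2 * l) *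
              (l2 (block F i e) * (twoPow (-((s + 1) * l)) * N)) := by
              gcongr
              exact l2_indicator_annulus_le (by linarith) hG l
          _ = _ := by rw [twoPow_add, twoPow_add, e2]; ring
    _ = (8 * twoPow ((1 - (s + 1) / 2) * (d / 2)) * N) * (twoPow (-(s * i)) * xPart s F i) *
          ∑' l : ℕ, twoPow (-((s + 1) / 2 * l)) := by
        simp only [ENNReal.tsum_mul_left, ENNReal.tsum_mul_right, tsum_twoPow_mul_l2_block s]
    _ ≤ (8 * twoPow ((1 - (s + 1) / 2) * (d / 2)) * N) * (twoPow (-(s * i)) * xPart s F i) * C :=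
        mul_le_mul_right hC _
    _ = _ := by push_cast; ring

/-- The interaction of a function supported in `K` with one in the `L²` part of `Y^s`,
with output on `K`. -/
theorem exists_xN_weightedConv_le {s : ℝ} (hs : -1 < s) (hs0 : s < 0) : ∃ C : ℝ≥0,
    ∀ F G : Freq → ℝ≥0∞, Measurable F → Measurable G → (∀ z, F z ≠ 0 → z ∈ regionK) →
      xN s (regionK.indicator (wmul (fun z => (bracketMod z)⁻¹) (weightedConv F G))) ≤
        C * (xN s F * l2 (wmul (fun z => bracketPar z ^ (s + 1)) G)) := by
  obtain ⟨C₁, h₁⟩ := exists_l2_indicator_lconv_annulus_le hs hs0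
  obtain ⟨C₂, h₂⟩ := exists_tsum_twoPow_le (δ := (s + 1) / 4) (by linarith)
  obtain ⟨C₃, h₃⟩ := exists_tsum_twoPow_abs_le (δ := -s) (by linarith)
  refine ⟨256 * C₁ * C₂ * C₃, fun F G hF hG hFK => ?_⟩
  set N := l2 (wmul (fun z => bracketPar z ^ (s + 1)) G) with hN
  have hh := measurable_weightedConv hF hG
  have hb : ∀ i, Measurable fun y => ∑' e, block F i e y := fun i =>
    Measurable.tsum (measurable_block hF i)
  have hmem : ∀ i y, ∑' e, block F i e y ≠ 0 → y ∈ annulus i ∧ y ∈ regionK := by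
    intro i y hy
    obtain ⟨e, he⟩ : ∃ e, block F i e y ≠ 0 := by
      by_contra! h
      exact hy (by simp [h])
    refine ⟨(block_mem he).1, hFK y fun h => he ?_⟩
    have := block_le F i e y
    rw [h] at this
    exact le_antisymm this zero_le
  have hdec : ∀ z, weightedConv F G z = ∑' i, weightedConv (fun y => ∑' e, block F i e y) G z := by
    intro z
    rw [← weightedConv_tsum_left hb hG]
    simp only [tsum_block]
  have hblock : ∀ j d : ℕ, l2 (block (regionK.indicator (weightedConv F G)) j d) ≤
      256 * C₁ * N * twoPow ((1 - (s + 1) / 2) * (d / 2)) * twoPow (-(s * j)) *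
        ∑' i : ℕ, twoPow (-(-s * |(j : ℝ) - i|)) * xPart s F i := by
    intro j d
    have hm : ∀ i, Measurable ((parNhd d).indicator (lconv (fun y => ∑' e, block F i e y) G)) :=
      fun i => (measurable_lconv (hb i) hG).indicator (measurableSet_parNhd d)
    calc l2 (block (regionK.indicator (weightedConv F G)) j d)
        ≤ l2 fun z => ∑' i : ℕ,
          ENNReal.ofReal (256 * (2 : ℝ) ^ (-(-s * |(j : ℝ) - i|) + s * i - s * j)) *
            (parNhd d).indicator (lconv (fun y => ∑' e, block F i e y) G) z := by
          refine l2_mono fun z => ?_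
          by_cases hz : z ∈ annulus j ∩ parNhd d
          swap
          · simp [block, hz]
          by_cases hzK : z ∈ regionK
          swap
          · simp [block, hz, hzK]
          simp only [block, Set.indicator_of_mem hz, Set.indicator_of_mem hzK,
            Set.indicator_of_mem hz.2]
          rw [hdec z]
          refine ENNReal.tsum_le_tsum fun i => lintegral_weightedConv_mono fun y hy _ => ?_
          exact weightRatio_le_of_mem_annulus hs hs0 hzK hz.1 (hmem i y hy).2 (hmem i y hy).1
      _ ≤ ∑' i : ℕ, ENNReal.ofReal (256 * (2 : ℝ) ^ (-(-s * |(j : ℝ) - i|) + s * i - s * j)) *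
            l2 ((parNhd d).indicator (lconv (fun y => ∑' e, block F i e y) G)) := by
          refine (l2_tsum_le fun i => (hm i).const_mul _).trans
            (ENNReal.tsum_le_tsum fun i => (l2_const_mul _ (hm i)).le)
      _ ≤ ∑' i : ℕ, (256 * C₁ * N * twoPow ((1 - (s + 1) / 2) * (d / 2)) * twoPow (-(s * j))) *
            (twoPow (-(-s * |(j : ℝ) - i|)) * xPart s F i) := by
          refine ENNReal.tsum_le_tsum fun i => ?_
          have e1 : ENNReal.ofReal (256 * (2 : ℝ) ^ (-(-s * |(j : ℝ) - i|) + s * i - s * j)) =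
              256 * (twoPow (-(-s * |(j : ℝ) - i|)) * twoPow (s * i) * twoPow (-(s * j))) := by
            rw [ENNReal.ofReal_mul (by norm_num), ofReal_two_rpow, sub_eq_add_neg, twoPow_add,
              twoPow_add]
            norm_num
          have e2 : twoPow (s * i) * twoPow (-(s * i)) = 1 := by
            rw [← twoPow_add, add_neg_cancel, twoPow_zero]
          rw [e1]
          refine (mul_le_mul_right (h₁ F G hF hG i d) _).trans (le_of_eq ?_)
          calc _ = (256 * C₁ * N * twoPow ((1 - (s + 1) / 2) * (d / 2)) * twoPow (-(s * j))) *
                (twoPow (-(-s * |(j : ℝ) - i|)) * xPart s F i) *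
                (twoPow (s * i) * twoPow (-(s * i))) := by rw [← hN]; ring
            _ = _ := by rw [e2, mul_one]
      _ = _ := ENNReal.tsum_mul_left
  have hpart : ∀ j : ℕ, xPart s (regionK.indicator (wmul (fun z => (bracketMod z)⁻¹)
      (weightedConv F G))) j ≤ 256 * C₁ * C₂ * N *
        ∑' i : ℕ, twoPow (-(-s * |(j : ℝ) - i|)) * xPart s F i := by
    intro j
    set T := ∑' i : ℕ, twoPow (-(-s * |(j : ℝ) - i|)) * xPart s F i
    refine (xPart_regionK_div_le s hh j).trans ?_
    have e3 : twoPow (s * j) * twoPow (-(s * j)) = 1 := by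
      rw [← twoPow_add, add_neg_cancel, twoPow_zero]
    calc _ ≤ twoPow (s * j) * ∑ d ∈ Finset.range (2 * j), (256 * C₁ * N * twoPow (-(s * j)) * T) *
            twoPow (-((s + 1) / 4 * d)) := by
          refine mul_le_mul_right (Finset.sum_le_sum fun d _ => ?_) _
          refine (mul_le_mul_right (hblock j d) _).trans (le_of_eq ?_)
          have e4 : twoPow (-((s + 1) / 4 * d)) =
              twoPow (-((d : ℝ) / 2)) * twoPow ((1 - (s + 1) / 2) * (d / 2)) := by
            rw [← twoPow_add]; congr 1; ring
          rw [e4]; ring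
      _ ≤ twoPow (s * j) * ((256 * C₁ * N * twoPow (-(s * j)) * T) * C₂) := by
          rw [← Finset.mul_sum]
          gcongr
          exact (ENNReal.sum_le_tsum _).trans h₂
      _ = (256 * C₁ * C₂ * N * T) * (twoPow (s * j) * twoPow (-(s * j))) := by ring
      _ = _ := by rw [e3, mul_one]
  rw [← sq_le_sq_ennreal, xN_sq]
  calc _ ≤ ∑' j : ℕ, (256 * C₁ * C₂ * N *
          ∑' i : ℕ, twoPow (-(-s * |(j : ℝ) - i|)) * xPart s F i) ^ 2 := by
        gcongr with j
        exact hpart j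
    _ = (256 * C₁ * C₂ * N) ^ 2 *
          ∑' j : ℕ, (∑' i : ℕ, twoPow (-(-s * |(j : ℝ) - i|)) * xPart s F i) ^ 2 := by
        simp only [mul_pow _ (∑' i : ℕ, _), ENNReal.tsum_mul_left]
    _ ≤ (256 * C₁ * C₂ * N) ^ 2 * ((C₃ : ℝ≥0∞) ^ 2 * ∑' i, xPart s F i ^ 2) := by
        gcongr
        refine tsum_schur_le h₃ (fun i => ?_) _
        simpa only [abs_sub_comm] using h₃ i
    _ = _ := by rw [← xN_sq]; push_cast; ring

/-! ### Both factors in `K` -/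

theorem weightedConv_le_of_regionK {F G : Freq → ℝ≥0∞} (hFK : ∀ z, F z ≠ 0 → z ∈ regionK)
    (z : Freq) : weightedConv F G z ≤ lconv F G z := by
  have h := lintegral_weightedConv_mono (F := F) (G := G) (c := 1) (z := z) fun y hy _ =>
    (weightRatio_le_of_mem_regionK (hFK y hy)).1
  simpa using h

theorem block_eq_wmul (F : Freq → ℝ≥0∞) (j d : ℕ) :
    block F j d = wmul ((annulus j ∩ parNhd d).indicator 1) F := by
  funext z
  by_cases hz : z ∈ annulus j ∩ parNhd d <;> simp [block, wmul, hz]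

theorem exists_tsum_block_le (s : ℝ) {δ : ℝ} (hδ : 0 < δ) : ∃ C : ℝ≥0, ∀ F : Freq → ℝ≥0∞,
    ∑' (j : ℕ) (d : ℕ), twoPow ((s - δ) * j + d / 2) * l2 (block F j d) ≤ C * xN s F := by
  obtain ⟨C, hC⟩ := exists_tsum_twoPow_le hδ
  refine ⟨C, fun F => ?_⟩
  calc ∑' (j : ℕ) (d : ℕ), twoPow ((s - δ) * j + d / 2) * l2 (block F j d)
      ≤ ∑' j : ℕ, twoPow (-(δ * j)) * xN s F := by
        refine ENNReal.tsum_le_tsum fun j => ?_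
        simp only [twoPow_add, mul_assoc]
        rw [ENNReal.tsum_mul_left, tsum_twoPow_mul_l2_block s, ← mul_assoc, ← twoPow_add]
        refine mul_le_mul' (twoPow_mono (by linarith)) (xPart_le_xN s F j)
    _ = (∑' j : ℕ, twoPow (-(δ * j))) * xN s F := ENNReal.tsum_mul_right
    _ ≤ _ := by gcongr

/-- Summation of a bilinear estimate for pairs of blocks that gains a power of the frequencies. -/
theorem exists_l2_wmul_lconv_le_of_block (s : ℝ) {δ : ℝ} (hδ : 0 < δ) : ∃ C : ℝ≥0,
    ∀ (F G : Freq → ℝ≥0∞) (v : Freq → ℝ) (c : ℝ≥0∞), Measurable F → Measurable G → Measurable v →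
      (∀ i e k f : ℕ, l2 (wmul v (lconv (block F i e) (block G k f))) ≤
        c * ((twoPow ((s - δ) * i + e / 2) * l2 (block F i e)) *
          (twoPow ((s - δ) * k + f / 2) * l2 (block G k f)))) →
      l2 (wmul v (lconv F G)) ≤ C * c * (xN s F * xN s G) := by
  obtain ⟨C, hC⟩ := exists_tsum_block_le s hδ
  refine ⟨C * C, fun F G v c hF hG hv h => ?_⟩
  have hm : ∀ i e k f, Measurable (wmul v (lconv (block F i e) (block G k f))) := fun i e k f =>
    measurable_wmul hv (measurable_lconv (measurable_block hF i e) (measurable_block hG k f))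
  have e1 : wmul v (lconv F G) = fun z => ∑' (i : ℕ) (e : ℕ) (k : ℕ) (f : ℕ),
      wmul v (lconv (block F i e) (block G k f)) z := by
    funext z
    have hz : lconv F G z = ∑' (i : ℕ) (e : ℕ) (k : ℕ) (f : ℕ),
        lconv (block F i e) (block G k f) z := by
      conv_lhs => rw [show F = fun y => ∑' (i : ℕ) (e : ℕ), block F i e y from
        funext fun y => (tsum_block F y).symm]
      rw [lconv_tsum_left (fun i => Measurable.tsum (measurable_block hF i)) hG]
      refine tsum_congr fun i => ?_
      rw [lconv_tsum_left (measurable_block hF i) hG]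
      refine tsum_congr fun e => ?_
      conv_lhs => rw [show G = fun y => ∑' (i : ℕ) (e : ℕ), block G i e y from
        funext fun y => (tsum_block G y).symm]
      rw [lconv_tsum_right (measurable_block hF i e)
        fun k => Measurable.tsum (measurable_block hG k)]
      refine tsum_congr fun k => ?_
      rw [lconv_tsum_right (measurable_block hF i e) (measurable_block hG k)]
    simp only [wmul, hz, ENNReal.tsum_mul_left]
  rw [e1]
  calc _ ≤ ∑' (i : ℕ) (e : ℕ) (k : ℕ) (f : ℕ),
          l2 (wmul v (lconv (block F i e) (block G k f))) := by
        refine (l2_tsum_le fun i => Measurable.tsum fun e => Measurable.tsum fun k =>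
          Measurable.tsum (hm i e k)).trans (ENNReal.tsum_le_tsum fun i => ?_)
        refine (l2_tsum_le fun e => Measurable.tsum fun k =>
          Measurable.tsum (hm i e k)).trans (ENNReal.tsum_le_tsum fun e => ?_)
        refine (l2_tsum_le fun k =>
          Measurable.tsum (hm i e k)).trans (ENNReal.tsum_le_tsum fun k => ?_)
        exact l2_tsum_le (hm i e k)
    _ ≤ ∑' (i : ℕ) (e : ℕ) (k : ℕ) (f : ℕ), c * ((twoPow ((s - δ) * i + e / 2) *
          l2 (block F i e)) * (twoPow ((s - δ) * k + f / 2) * l2 (block G k f))) :=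
        ENNReal.tsum_le_tsum fun i => ENNReal.tsum_le_tsum fun e => ENNReal.tsum_le_tsum fun k =>
          ENNReal.tsum_le_tsum fun f => h i e k f
    _ = c * ((∑' (i : ℕ) (e : ℕ), twoPow ((s - δ) * i + e / 2) * l2 (block F i e)) *
          ∑' (k : ℕ) (f : ℕ), twoPow ((s - δ) * k + f / 2) * l2 (block G k f)) := by
        simp only [ENNReal.tsum_mul_left, ENNReal.tsum_mul_right]
    _ ≤ c * ((C * xN s F) * (C * xN s G)) := by gcongr <;> exact hC _
    _ = _ := by push_cast; ring

theorem exists_ne_zero_of_lconv {F G : Freq → ℝ≥0∞} {z : Freq} (h : lconv F G z ≠ 0) :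
    ∃ y, F y ≠ 0 ∧ G (z - y) ≠ 0 := by
  by_contra! h'
  refine h ?_
  unfold lconv
  rw [← lintegral_zero (α := Freq) (μ := volume)]
  refine lintegral_congr fun y => ?_
  by_cases hy : F y = 0
  · simp [hy]
  · simp [h' y hy]

theorem ne_zero_of_block {F : Freq → ℝ≥0∞} {j d : ℕ} {z : Freq} (h : block F j d z ≠ 0) :
    F z ≠ 0 := fun h' => h (le_antisymm ((block_le F j d z).trans h'.le) zero_le)

theorem pow_le_of_two_mul_le {i j k : ℕ} {x y : ℝ} (hx : (2 : ℝ) ^ i ≤ x) (h : x ≤ 2 ^ k * y)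
    (hy : y < 2 ^ j) : i < k + j := by
  have : (2 : ℝ) ^ i < 2 ^ (k + j) := by
    rw [pow_add]
    calc (2 : ℝ) ^ i ≤ 2 ^ k * y := hx.trans h
      _ < 2 ^ k * 2 ^ j := by gcongr
  exact (pow_lt_pow_iff_right₀ one_lt_two).1 this

/-- The spatial scales of an output in `K` and of two inputs in `K` are comparable
with the larger input. -/
theorem scale_of_mem_regionK {z y : Freq} {j i k : ℕ} (hz : z ∈ regionK) (hzj : z ∈ annulus j)
    (hy : y ∈ regionK) (hyi : y ∈ annulus i) (hx : z - y ∈ regionK) (hxk : z - y ∈ annulus k) :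
    i ≤ j + 2 ∧ k ≤ j + 2 ∧ (j ≤ i + 2 ∨ j ≤ k + 2) := by
  obtain ⟨h1, h2⟩ := bracketXi_le_two_mul_bracketPar hy hx
  have h3 := bracketPar_le_of_mem_regionK hz
  refine ⟨?_, ?_, ?_⟩
  · have := pow_le_of_two_mul_le (k := 2) hyi.1 (by linarith) hzj.2
    omega
  · have := pow_le_of_two_mul_le (k := 2) hxk.1 (by linarith) hzj.2
    omega
  · have h4 : bracketXi z ≤ bracketXi y + bracketXi (z - y) := by
      simp only [bracketXi_eq]
      have : ‖z.1‖ ≤ ‖y.1‖ + ‖(z - y).1‖ := by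
        have := norm_add_le y.1 (z - y).1
        simpa using this
      linarith
    rcases le_total (bracketXi y) (bracketXi (z - y)) with h | h
    · right
      have := pow_le_of_two_mul_le (k := 1) hzj.1 (by linarith) hxk.2
      omega
    · left
      have := pow_le_of_two_mul_le (k := 1) hzj.1 (by linarith) hyi.2
      omega

/-- The power of two that the bilinear estimate for blocks has to supply in order to sum over the
scales of both inputs and of the output. -/
theorem exponent_le {s : ℝ} (hs : -1 < s) (hs0 : s < 0) {j i k : ℕ} (h1 : i ≤ j + 2)
    (h2 : k ≤ j + 2) (h3 : j ≤ i + 2 ∨ j ≤ k + 2) :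
    -(((i : ℝ) + k) / 2) ≤
      2 - (s + (s + 1) / 4) * j + (s - (s + 1) / 4) * i + (s - (s + 1) / 4) * k := by
  have h1' : (i : ℝ) ≤ j + 2 := by exact_mod_cast h1
  have h2' : (k : ℝ) ≤ j + 2 := by exact_mod_cast h2
  have hi : (0 : ℝ) ≤ i := Nat.cast_nonneg i
  have hk : (0 : ℝ) ≤ k := Nat.cast_nonneg k
  -- the bound is affine in the smaller of the two scales, so that its endpoints suffice
  have main : ∀ m n : ℝ, 0 ≤ n → n ≤ m → |(j : ℝ) - m| ≤ 2 →
      -((m + n) / 2) ≤ 2 - (s + (s + 1) / 4) * j + (s - (s + 1) / 4) * m +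
        (s - (s + 1) / 4) * n := by
    intro m n hn hnm hjm
    have hc : |s + (s + 1) / 4| ≤ 1 := abs_le.2 ⟨by linarith, by linarith⟩
    have h4 : (s + (s + 1) / 4) * (j - m) ≤ 2 := by
      calc _ ≤ |(s + (s + 1) / 4) * (j - m)| := le_abs_self _
        _ = |s + (s + 1) / 4| * |(j : ℝ) - m| := abs_mul _ _
        _ ≤ 1 * 2 := mul_le_mul hc hjm (abs_nonneg _) zero_le_one
        _ = 2 := by norm_num
    have h5 : 0 ≤ (m - n) * (1 + s + 1 / 4 * (1 - s)) := by
      apply mul_nonneg <;> linarith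
    nlinarith [mul_nonneg hn (sub_nonneg.2 hs.le), mul_nonneg (sub_nonneg.2 hnm)
      (sub_nonneg.2 hs.le), mul_nonneg hn (sub_nonneg.2 hs0.le), mul_nonneg (sub_nonneg.2 hnm)
      (sub_nonneg.2 hs0.le)]
  rcases le_total k i with h | h
  · have hki : (k : ℝ) ≤ i := by exact_mod_cast h
    have : (j : ℝ) ≤ i + 2 := by
      have : j ≤ i + 2 := by omega
      exact_mod_cast this
    exact main i k hk hki (abs_le.2 ⟨by linarith, by linarith⟩)
  · have hki : (i : ℝ) ≤ k := by exact_mod_cast h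
    have : (j : ℝ) ≤ k + 2 := by
      have : j ≤ k + 2 := by omega
      exact_mod_cast this
    have := main k i hi hki (abs_le.2 ⟨by linarith, by linarith⟩)
    linarith

theorem one_le_of_mem_regionK {z : Freq} {j : ℕ} (hz : z ∈ regionK) (hj : z ∈ annulus j) :
    1 ≤ j := by
  obtain ⟨d, hd⟩ := exists_mem_parNhd z
  have := le_of_mem_regionK hz hj hd
  omega

/-- The interaction of two functions supported in `K`, with output on `K`. -/
theorem exists_xN_weightedConv_regionK_le {s : ℝ} (hs : -1 < s) (hs0 : s < 0) : ∃ C : ℝ≥0,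
    ∀ F G : Freq → ℝ≥0∞, Measurable F → Measurable G → (∀ z, F z ≠ 0 → z ∈ regionK) →
      (∀ z, G z ≠ 0 → z ∈ regionK) →
      xN s (regionK.indicator (wmul (fun z => (bracketMod z)⁻¹) (weightedConv F G))) ≤
        C * (xN s F * xN s G) := by
  obtain ⟨C₁, h₁⟩ := exists_l2_indicator_lconv_le
  obtain ⟨C₂, h₂⟩ := exists_l2_wmul_lconv_le_of_block s (δ := (s + 1) / 4) (by linarith)
  obtain ⟨C₃, h₃⟩ := exists_xN_regionK_div_le s (δ := (s + 1) / 4) (by linarith)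
  refine ⟨C₃ * (C₂ * (C₁ * 4)), fun F G hF hG hFK hGK => ?_⟩
  refine (h₃ _ (C₂ * (C₁ * 4) * (xN s F * xN s G)) (measurable_weightedConv hF hG)
    fun j d hjd => ?_).trans (le_of_eq (by push_cast; ring))
  refine (l2_mono (block_mono (weightedConv_le_of_regionK hFK) j d)).trans ?_
  rw [block_eq_wmul]
  refine (h₂ F G _ (C₁ * 4 * (twoPow (d / 2) * twoPow (-((s + (s + 1) / 4) * j)))) hF hG
    (measurable_one.indicator (measurableSet_block j d)) fun i e k f => ?_).trans
    (le_of_eq (by ring))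
  rw [← block_eq_wmul]
  by_cases hne : ∃ z, block (lconv (block F i e) (block G k f)) j d z ≠ 0
  swap
  · push Not at hne
    rw [show block (lconv (block F i e) (block G k f)) j d = 0 from funext hne, l2_zero]
    exact zero_le
  obtain ⟨z, hz⟩ := hne
  have hzm := block_mem hz
  have hzK : z ∈ regionK := ⟨j, d, hjd, hzm⟩
  obtain ⟨y, hy, hx⟩ := exists_ne_zero_of_lconv (ne_zero_of_block hz)
  have hyK := hFK y (ne_zero_of_block hy)
  have hxK := hGK _ (ne_zero_of_block hx)
  obtain ⟨s1, s2, s3⟩ := scale_of_mem_regionK hzK hzm.1 hyK (block_mem hy).1 hxK (block_mem hx).1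
  have hexp := exponent_le hs hs0 s1 s2 s3
  calc l2 (block (lconv (block F i e) (block G k f)) j d)
      ≤ l2 ((parNhd d).indicator (lconv (block F i e) (block G k f))) :=
        l2_mono fun z => Set.indicator_le_indicator_of_subset Set.inter_subset_right
          (fun _ => zero_le) z
    _ ≤ C₁ * twoPow ((d + e + f - i - k : ℝ) / 2) * (l2 (block F i e) * l2 (block G k f)) :=
        h₁ _ _ i e k f d (measurable_block hF i e) (measurable_block hG k f)
          (one_le_of_mem_regionK hyK (block_mem hy).1) (one_le_of_mem_regionK hxK (block_mem hx).1)
          (fun z hz => block_mem hz) fun z hz => block_mem hz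
    _ ≤ C₁ * twoPow (2 + (d / 2 + -((s + (s + 1) / 4) * j)) + (((s - (s + 1) / 4) * i + e / 2) +
          ((s - (s + 1) / 4) * k + f / 2))) * (l2 (block F i e) * l2 (block G k f)) := by
        refine mul_le_mul_left (mul_le_mul_right (twoPow_mono ?_) _) _
        linarith
    _ = _ := by
        rw [twoPow_add, twoPow_add 2, twoPow_two, twoPow_add (d / 2),
          twoPow_add ((s - (s + 1) / 4) * i + e / 2)]
        ring

theorem rpow_le_of_le_two_mul {z : Freq} {x r : ℝ} (hr : 0 ≤ r) (hx : 0 < x)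
    (h : x ≤ 2 * bracketPar z) : bracketPar z ^ (-r) ≤ 2 ^ r * x ^ (-r) := by
  have hp := bracketPar_pos z
  have e : (2 : ℝ) ^ r * (2 * bracketPar z) ^ (-r) = bracketPar z ^ (-r) := by
    rw [Real.mul_rpow two_pos.le hp.le, ← mul_assoc, ← Real.rpow_add two_pos, add_neg_cancel,
      Real.rpow_zero, one_mul]
  rw [← e]
  gcongr ?_ * ?_
  exact rpow_neg_le_of_le hx h hr

/-- The `L²` part of the output off `K`. -/
theorem exists_l2_bracketPar_lconv_le {s : ℝ} (hs : -1 < s) (hs0 : s < 0) : ∃ C : ℝ≥0,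
    ∀ F G : Freq → ℝ≥0∞, Measurable F → Measurable G → (∀ z, F z ≠ 0 → z ∈ regionK) →
      (∀ z, G z ≠ 0 → z ∈ regionK) →
      l2 (wmul (fun z => bracketPar z ^ (s - 1)) (lconv F G)) ≤ C * (xN s F * xN s G) := by
  obtain ⟨C, hC⟩ := exists_l2_wmul_lconv_le_of_block s (δ := (s + 1) / 4) (by linarith)
  refine ⟨C * (4 * 8), fun F G hF hG hFK hGK => ?_⟩
  have hv := measurable_bracketPar_rpow (s - 1)
  refine (hC F G _ (4 * 8) hF hG hv fun i e k f => ?_).trans (le_of_eq (by push_cast; ring))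
  have hm := measurable_lconv (measurable_block hF i e) (measurable_block hG k f)
  have hi : (0 : ℝ) ≤ i := Nat.cast_nonneg i
  have hk : (0 : ℝ) ≤ k := Nat.cast_nonneg k
  calc l2 (wmul (fun z => bracketPar z ^ (s - 1)) (lconv (block F i e) (block G k f)))
      ≤ (4 * twoPow ((s - (s + 1) / 4) * i + (s - (s + 1) / 4) * k)) *
          l2 (lconv (block F i e) (block G k f)) := by
        refine l2_const_le hm fun z => ?_
        by_cases h0 : lconv (block F i e) (block G k f) z = 0
        · simp [wmul, h0]
        refine mul_le_mul_left ?_ _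
        obtain ⟨y, hy, hx⟩ := exists_ne_zero_of_lconv h0
        obtain ⟨g1, g2⟩ := bracketXi_le_two_mul_bracketPar (hFK y (ne_zero_of_block hy))
          (hGK _ (ne_zero_of_block hx))
        have g3 := rpow_le_of_le_two_mul (z := z) (r := (1 - s) / 2) (by linarith)
          (by positivity) ((block_mem hy).1.1.trans g1)
        have g4 := rpow_le_of_le_two_mul (z := z) (r := (1 - s) / 2) (by linarith)
          (by positivity) ((block_mem hx).1.1.trans g2)
        rw [← ofReal_two_rpow, show (4 : ℝ≥0∞) = ENNReal.ofReal 4 by norm_num,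
          ← ENNReal.ofReal_mul (by norm_num)]
        refine ENNReal.ofReal_le_ofReal ?_
        calc bracketPar z ^ (s - 1)
            = bracketPar z ^ (-((1 - s) / 2)) * bracketPar z ^ (-((1 - s) / 2)) := by
              rw [← Real.rpow_add (bracketPar_pos z)]; congr 1; ring
          _ ≤ (2 ^ ((1 - s) / 2) * (2 ^ i) ^ (-((1 - s) / 2))) *
                (2 ^ ((1 - s) / 2) * (2 ^ k) ^ (-((1 - s) / 2))) :=
              mul_le_mul g3 g4 (Real.rpow_nonneg (bracketPar_pos z).le _) (by positivity)
          _ = 2 ^ ((1 - s) / 2 + i * (-((1 - s) / 2)) + ((1 - s) / 2 + k * (-((1 - s) / 2)))) := by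
              rw [Real.rpow_add two_pos, Real.rpow_add two_pos, Real.rpow_add two_pos,
                Real.rpow_mul two_pos.le, Real.rpow_mul two_pos.le, Real.rpow_natCast,
                Real.rpow_natCast]
          _ ≤ 2 ^ (2 + ((s - (s + 1) / 4) * i + (s - (s + 1) / 4) * k)) := by
              refine Real.rpow_le_rpow_of_exponent_le one_le_two ?_
              nlinarith
          _ = _ := by
              rw [Real.rpow_add two_pos]; norm_num
    _ ≤ (4 * twoPow ((s - (s + 1) / 4) * i + (s - (s + 1) / 4) * k)) *
          (8 * twoPow ((e + f : ℝ) / 2) * (l2 (block F i e) * l2 (block G k f))) := by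
        refine mul_le_mul_right ?_ _
        exact l2_lconv_le_of_parNhd (measurable_block hF i e) (measurable_block hG k f)
          (fun z hz => (block_mem hz).2) fun z hz => (block_mem hz).2
    _ = _ := by
        rw [show ((e : ℝ) + f) / 2 = e / 2 + f / 2 by ring, twoPow_add (e / 2),
          twoPow_add (_ * (i : ℝ)) (_ * (k : ℝ)), twoPow_add (_ * (i : ℝ)) (e / 2),
          twoPow_add (_ * (k : ℝ)) (f / 2)]
        ring

/-- Integration in `τ` turns a convolution on `ℝ² × ℝ` into one on `ℝ²`. -/
theorem lintegral_snd_lconv {F G : Freq → ℝ≥0∞} (hF : Measurable F) (hG : Measurable G)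
    (ξ : EuclideanSpace ℝ (Fin 2)) :
    ∫⁻ τ : ℝ, lconv F G (ξ, τ) =
      ∫⁻ η, (∫⁻ τ : ℝ, F (η, τ)) * ∫⁻ τ : ℝ, G (ξ - η, τ) := by
  unfold lconv
  have hm : Measurable fun p : ℝ × Freq => F p.2 * G ((ξ, p.1) - p.2) :=
    (hF.comp measurable_snd).mul (hG.comp
      ((measurable_const.prodMk measurable_fst).sub measurable_snd))
  rw [lintegral_lintegral_swap hm.aemeasurable]
  have h1 : ∀ y : Freq, ∫⁻ τ : ℝ, F y * G ((ξ, τ) - y) = F y * ∫⁻ τ : ℝ, G (ξ - y.1, τ) := by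
    intro y
    have hg : Measurable fun τ : ℝ => G (ξ - y.1, τ) := hG.comp measurable_prodMk_left
    rw [← lintegral_sub_right_eq_self (fun τ : ℝ => G (ξ - y.1, τ)) y.2]
    exact lintegral_const_mul _ (hg.comp (measurable_id.sub_const y.2))
  simp only [h1]
  have hk : Measurable fun y : Freq => F y * ∫⁻ τ : ℝ, G (ξ - y.1, τ) :=
    hF.mul ((measurable_lintegral_snd hG).comp (measurable_const.sub measurable_fst))
  rw [Measure.volume_eq_prod, lintegral_prod _ hk.aemeasurable]
  exact lintegral_congr fun η => lintegral_mul_const (∫⁻ τ : ℝ, G (ξ - η, τ))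
    (show Measurable fun τ : ℝ => F (η, τ) from hF.comp measurable_prodMk_left)

theorem lintegral_snd_lconv_le {F G : Freq → ℝ≥0∞} (hF : Measurable F) (hG : Measurable G)
    (ξ : EuclideanSpace ℝ (Fin 2)) : ∫⁻ τ : ℝ, lconv F G (ξ, τ) ≤ mixN F * mixN G := by
  rw [lintegral_snd_lconv hF hG, ← sq_le_sq_ennreal, mul_pow, mixN_sq, mixN_sq]
  have hF' := measurable_lintegral_snd hF
  have hG' := measurable_lintegral_snd hG
  refine (lintegral_mul_sq_le hF'.aemeasurable
    (hG'.comp (measurable_const.sub measurable_id)).aemeasurable).trans (le_of_eq ?_)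
  congr 1
  exact lintegral_sub_left_eq_self (fun η => (∫⁻ τ : ℝ, G (η, τ)) ^ 2) ξ

theorem wmul_lconv_le_of_regionK {s : ℝ} (hs : -1 < s) (hs0 : s < 0) {F G : Freq → ℝ≥0∞}
    (hFK : ∀ z, F z ≠ 0 → z ∈ regionK) (hGK : ∀ z, G z ≠ 0 → z ∈ regionK) (z : Freq) :
    wmul (fun z => bracketXi z ^ s * bracketPar z ^ (-2 : ℝ)) (lconv F G) z ≤
      ENNReal.ofReal (4 * bracketXi z ^ (-(2 + s))) *
        lconv (wmul (fun z => bracketXi z ^ s) F) (wmul (fun z => bracketXi z ^ s) G) z := by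
  unfold wmul lconv
  rw [← lintegral_const_mul' _ _ ENNReal.ofReal_ne_top,
    ← lintegral_const_mul' _ _ ENNReal.ofReal_ne_top]
  refine lintegral_mono fun y => ?_
  by_cases hy : F y = 0
  · simp [hy]
  by_cases hx : G (z - y) = 0
  · simp [hx]
  obtain ⟨g1, g2⟩ := bracketXi_le_two_mul_bracketPar (hFK y hy) (hGK _ hx)
  have ha := bracketXi_pos z
  have ha1 := bracketXi_pos y
  have ha2 := bracketXi_pos (z - y)
  have hp := bracketPar_pos z
  have key : bracketXi z ^ s * bracketPar z ^ (-2 : ℝ) ≤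
      4 * bracketXi z ^ (-(2 + s)) * (bracketXi y ^ s * bracketXi (z - y) ^ s) := by
    have g3 := rpow_le_of_le_two_mul (r := -s) (by linarith) ha1 g1
    have g4 := rpow_le_of_le_two_mul (r := -s) (by linarith) ha2 g2
    rw [neg_neg] at g3 g4
    have g5 : bracketPar z ^ (-2 - 2 * s) ≤ bracketXi z ^ (-2 - 2 * s) :=
      bracketPar_rpow_le_bracketXi (by linarith) z
    have g6 : (2 : ℝ) ^ (-s) * 2 ^ (-s) ≤ 4 := by
      rw [← Real.rpow_add two_pos]
      calc (2 : ℝ) ^ (-s + -s) ≤ 2 ^ (2 : ℝ) :=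
            Real.rpow_le_rpow_of_exponent_le one_le_two (by linarith)
        _ = 4 := by norm_num
    have P1 : 0 ≤ bracketXi z ^ s := Real.rpow_nonneg ha.le _
    have P2 : 0 ≤ bracketXi y ^ s := Real.rpow_nonneg ha1.le _
    have P3 : 0 ≤ bracketXi (z - y) ^ s := Real.rpow_nonneg ha2.le _
    have P4 : 0 ≤ bracketPar z ^ s := Real.rpow_nonneg hp.le _
    have P5 : 0 ≤ bracketXi z ^ (-2 - 2 * s) := Real.rpow_nonneg ha.le _
    have P6 : 0 ≤ bracketXi z ^ (-(2 + s)) := Real.rpow_nonneg ha.le _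
    calc bracketXi z ^ s * bracketPar z ^ (-2 : ℝ)
        = bracketXi z ^ s * ((bracketPar z ^ s * bracketPar z ^ s) *
            bracketPar z ^ (-2 - 2 * s)) := by
          rw [← Real.rpow_add hp, ← Real.rpow_add hp]; congr 2; ring
      _ ≤ bracketXi z ^ s * (((2 ^ (-s) * bracketXi y ^ s) * (2 ^ (-s) * bracketXi (z - y) ^ s)) *
            bracketXi z ^ (-2 - 2 * s)) := by gcongr
      _ = (2 ^ (-s) * 2 ^ (-s)) * ((bracketXi z ^ s * bracketXi z ^ (-2 - 2 * s)) *
            (bracketXi y ^ s * bracketXi (z - y) ^ s)) := by ring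
      _ = (2 ^ (-s) * 2 ^ (-s)) * (bracketXi z ^ (-(2 + s)) *
            (bracketXi y ^ s * bracketXi (z - y) ^ s)) := by
          rw [← Real.rpow_add ha]; congr 3; ring
      _ ≤ 4 * (bracketXi z ^ (-(2 + s)) * (bracketXi y ^ s * bracketXi (z - y) ^ s)) := by gcongr
      _ = _ := by ring
  have h := ENNReal.ofReal_le_ofReal key
  rw [ENNReal.ofReal_mul (mul_nonneg (by norm_num) (Real.rpow_nonneg ha.le _)),
    ENNReal.ofReal_mul (Real.rpow_nonneg ha1.le _)] at h
  calc _ ≤ _ * (F y * G (z - y)) := mul_le_mul_left h _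
    _ = _ := by ring

/-- The `L²_ξ L¹_τ` part of the output off `K`. -/
theorem exists_mixN_lconv_le {s : ℝ} (hs : -1 < s) (hs0 : s < 0) : ∃ C : ℝ≥0,
    ∀ F G : Freq → ℝ≥0∞, Measurable F → Measurable G → (∀ z, F z ≠ 0 → z ∈ regionK) →
      (∀ z, G z ≠ 0 → z ∈ regionK) →
      mixN (wmul (fun z => bracketXi z ^ s * bracketPar z ^ (-2 : ℝ)) (lconv F G)) ≤
        C * (xN s F * xN s G) := by
  obtain ⟨D, hD⟩ := exists_lintegral_rpow_mul_rpow_le (p := 2 + s) (q := 2 + s) (by linarith)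
    (by linarith) (by linarith)
  refine ⟨(4 * (1 + D)) * 4, fun F G hF hG hFK hGK => ?_⟩
  let f := wmul (fun z => bracketXi z ^ s) F
  let g := wmul (fun z => bracketXi z ^ s) G
  have hf : Measurable f := measurable_wmul (measurable_bracketXi_rpow s) hF
  have hg : Measurable g := measurable_wmul (measurable_bracketXi_rpow s) hG
  let u : EuclideanSpace ℝ (Fin 2) → ℝ≥0∞ := fun ξ => ENNReal.ofReal (4 * (1 + ‖ξ‖) ^ (-(2 + s)))
  have h1 : mixN (wmul (fun z => bracketXi z ^ s * bracketPar z ^ (-2 : ℝ)) (lconv F G)) ≤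
      4 * (1 + D) * (mixN f * mixN g) := by
    rw [← sq_le_sq_ennreal, mixN_sq]
    calc _ ≤ ∫⁻ ξ, (u ξ * (mixN f * mixN g)) ^ 2 := by
          refine lintegral_mono fun ξ => pow_le_pow_left' ?_ 2
          calc _ ≤ ∫⁻ τ : ℝ, u ξ * lconv f g (ξ, τ) := by
                refine lintegral_mono fun τ => ?_
                have := wmul_lconv_le_of_regionK hs hs0 hFK hGK (ξ, τ)
                simp only [bracketXi_eq] at this ⊢
                simpa only [f, g, u, bracketXi_eq] using this
            _ = u ξ * ∫⁻ τ : ℝ, lconv f g (ξ, τ) := lintegral_const_mul' _ _ ENNReal.ofReal_ne_top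
            _ ≤ _ := mul_le_mul_right (lintegral_snd_lconv_le hf hg ξ) _
      _ = (∫⁻ ξ, u ξ ^ 2) * (mixN f * mixN g) ^ 2 := by
          simp only [mul_pow _ (mixN f * mixN g)]
          refine lintegral_mul_const _ ?_
          simp only [u]
          fun_prop
      _ ≤ (16 * D) * (mixN f * mixN g) ^ 2 := by
          refine mul_le_mul_left ?_ _
          calc ∫⁻ ξ, u ξ ^ 2 = ∫⁻ ξ : EuclideanSpace ℝ (Fin 2), ENNReal.ofReal 16 *
                ENNReal.ofReal ((1 + ‖ξ‖) ^ (-(2 + s)) * (1 + ‖ξ - 0‖) ^ (-(2 + s))) := by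
                refine lintegral_congr fun ξ => ?_
                have : 0 ≤ (1 + ‖ξ‖) ^ (-(2 + s)) := by positivity
                rw [← ENNReal.ofReal_mul (by norm_num), ← ENNReal.ofReal_pow (by positivity),
                  sub_zero]
                congr 1; ring
            _ = ENNReal.ofReal 16 * _ := lintegral_const_mul' _ _ ENNReal.ofReal_ne_top
            _ ≤ ENNReal.ofReal 16 * D := mul_le_mul_right (hD 0) _
            _ = 16 * D := by norm_num
      _ ≤ (4 * (1 + D)) ^ 2 * (mixN f * mixN g) ^ 2 := by
          refine mul_le_mul_left ?_ _
          calc (16 : ℝ≥0∞) * D ≤ 16 * (1 + D) := by gcongr; exact le_add_self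
            _ = 16 * ((1 + D) * 1) := by ring
            _ ≤ 16 * ((1 + D) * (1 + D)) := by gcongr; exact le_self_add
            _ = _ := by ring
      _ = _ := (mul_pow _ _ 2).symm
  refine h1.trans ?_
  calc _ ≤ 4 * (1 + D) * ((2 * xN s F) * (2 * xN s G)) := by
        gcongr
        · exact mixN_wmul_le_xN hs0.le hF
        · exact mixN_wmul_le_xN hs0.le hG
    _ = _ := by push_cast; ring

/-- The interaction of two functions supported in `K`, with output in `Z^s`. -/
theorem exists_pN_weightedConv_regionK_le {s : ℝ} (hs : -1 < s) (hs0 : s < 0) : ∃ C : ℝ≥0,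
    ∀ F G : Freq → ℝ≥0∞, Measurable F → Measurable G → (∀ z, F z ≠ 0 → z ∈ regionK) →
      (∀ z, G z ≠ 0 → z ∈ regionK) →
      pN s (wmul (fun z => (bracketMod z)⁻¹) (weightedConv F G)) ≤ C * (xN s F * xN s G) := by
  obtain ⟨C₁, h₁⟩ := exists_xN_weightedConv_regionK_le hs hs0
  obtain ⟨C₂, h₂⟩ := exists_mixN_lconv_le hs hs0
  obtain ⟨C₃, h₃⟩ := exists_l2_bracketPar_lconv_le hs hs0
  refine ⟨C₁ + (130 * C₂ + 130 * C₃), fun F G hF hG hFK hGK => ?_⟩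
  have hw := measurable_weightedConv hF hG
  have hle := weightedConv_le_of_regionK (G := G) hFK
  have k1 := h₁ F G hF hG hFK hGK
  have k2 := (mixN_compl_div_le (s := s) hw).trans (mul_le_mul_right
    ((mixN_mono_ae (Filter.Eventually.of_forall fun z => wmul_mono (hle z))).trans
      (h₂ F G hF hG hFK hGK)) _)
  have k3 := (l2_compl_div_le (s := s) hw).trans (mul_le_mul_right
    ((l2_mono fun z => wmul_mono (hle z)).trans (h₃ F G hF hG hFK hGK)) _)
  unfold pN yN
  refine (add_le_add k1 (add_le_add k2 k3)).trans (le_of_eq ?_)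
  push_cast
  ring

/-! ### Pointwise convergence and the passage to complex-valued functions -/

theorem lconv_le_l2 {F G : Freq → ℝ≥0∞} (hF : Measurable F) (hG : Measurable G) (z : Freq) :
    lconv F G z ≤ l2 F * l2 G := by
  unfold lconv
  refine (lintegral_mul_le_l2 hF.aemeasurable
    (hG.comp (measurable_const.sub measurable_id)).aemeasurable).trans (le_of_eq ?_)
  congr 1
  unfold l2
  congr 1
  exact lintegral_sub_left_eq_self (fun y => G y ^ 2) z

theorem weightedConv_comm (F G : Freq → ℝ≥0∞) (z : Freq) :
    weightedConv F G z = weightedConv G F z := by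
  unfold weightedConv bil
  rw [← lintegral_sub_left_eq_self _ z]
  refine lintegral_congr fun y => ?_
  dsimp only
  rw [sub_sub_cancel, mul_comm (weight (z - y)), mul_comm (F (z - y))]

theorem weightedConv_add_left {F F' G : Freq → ℝ≥0∞} (hF : Measurable F) (hG : Measurable G)
    (z : Freq) :
    weightedConv (fun y => F y + F' y) G z = weightedConv F G z + weightedConv F' G z := by
  unfold weightedConv bil
  rw [← lintegral_add_left]
  · simp only [add_mul, mul_add]
  · exact (measurable_weightRatio.comp measurable_prodMk_left).mul (hF.mul
      (hG.comp (measurable_const.sub measurable_id)))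

theorem weightedConv_add_right {F G G' : Freq → ℝ≥0∞} (hF : Measurable F) (hG : Measurable G)
    (z : Freq) :
    weightedConv F (fun y => G y + G' y) z = weightedConv F G z + weightedConv F G' z := by
  rw [weightedConv_comm, weightedConv_add_left hG hF, weightedConv_comm G, weightedConv_comm G']

theorem l2_le_wmul_bracketPar {r : ℝ} (hr : 0 ≤ r) (F : Freq → ℝ≥0∞) :
    l2 F ≤ l2 (wmul (fun z => bracketPar z ^ r) F) := by
  refine l2_mono fun z => le_mul_of_one_le_left zero_le ?_
  rw [ENNReal.one_le_ofReal]
  exact Real.one_le_rpow (one_le_bracketPar z) hr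

/-- Convergence of the convolution integral for two functions in the `L²` part of `Y^s`. -/
theorem weightedConv_ne_top {s : ℝ} (hs : -1 < s) {F G : Freq → ℝ≥0∞} (hF : Measurable F)
    (hG : Measurable G) (h1 : l2 (wmul (fun z => bracketPar z ^ (s + 1)) F) ≠ ⊤)
    (h2 : l2 (wmul (fun z => bracketPar z ^ (s + 1)) G) ≠ ⊤) (z : Freq) :
    weightedConv F G z ≠ ⊤ := by
  refine ne_top_of_le_ne_top ?_ ((weightedConv_le F G z).trans
    (mul_le_mul_right (lconv_le_l2 hF hG z) _))
  exact ENNReal.mul_ne_top ENNReal.ofReal_ne_top (ENNReal.mul_ne_top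
    (ne_top_of_le_ne_top h1 (l2_le_wmul_bracketPar (by linarith) F))
    (ne_top_of_le_ne_top h2 (l2_le_wmul_bracketPar (by linarith) G)))

/-- When one factor lies in `K`, the weights recover its negative power of the spatial frequency. -/
theorem weightedConv_le_wmul_left {s : ℝ} (hs : -1 < s) (hs0 : s < 0) {F G : Freq → ℝ≥0∞}
    (hFK : ∀ z, F z ≠ 0 → z ∈ regionK) (z : Freq) :
    weightedConv F G z ≤ ENNReal.ofReal (4 * bracketPar z ^ (-s)) *
      lconv (wmul (fun z => bracketXi z ^ s) F) G z := by
  unfold weightedConv bil lconv wmul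
  rw [← lintegral_const_mul' _ _ ENNReal.ofReal_ne_top]
  refine lintegral_mono fun y => ?_
  by_cases hy : F y = 0
  · simp [hy]
  have ha := bracketXi_pos y
  have h := weightRatio_mul_rpow_le (z := z) (hFK y hy) (θ := -s) (by linarith) (by linarith)
  have h' : weight z / (weight y * weight (z - y)) ≤
      4 * bracketPar z ^ (-s) * bracketXi y ^ s := by
    have e : bracketXi y ^ (-s) * bracketXi y ^ s = 1 := by
      rw [← Real.rpow_add ha, neg_add_cancel, Real.rpow_zero]
    have := mul_le_mul_of_nonneg_right h (Real.rpow_nonneg ha.le s)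
    rwa [mul_assoc, e, mul_one] at this
  have h'' := ENNReal.ofReal_le_ofReal h'
  rw [ENNReal.ofReal_mul (mul_nonneg (by norm_num) (Real.rpow_nonneg (bracketPar_pos z).le _))] at h''
  calc _ ≤ _ * (F y * G (z - y)) := mul_le_mul_left h'' _
    _ = _ := by ring

/-- Convergence of the convolution integral for a function supported in `K` and one in the `L²`
part of `Y^s`. -/
theorem weightedConv_ne_top_of_left {s : ℝ} (hs : -1 < s) (hs0 : s < 0) {F G : Freq → ℝ≥0∞}
    (hF : Measurable F) (hG : Measurable G) (hFK : ∀ z, F z ≠ 0 → z ∈ regionK)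
    (h1 : xN s F ≠ ⊤) (h2 : l2 (wmul (fun z => bracketPar z ^ (s + 1)) G) ≠ ⊤) (z : Freq) :
    weightedConv F G z ≠ ⊤ := by
  have hF' := measurable_wmul (measurable_bracketXi_rpow s) hF
  refine ne_top_of_le_ne_top ?_ ((weightedConv_le_wmul_left hs hs0 hFK z).trans
    (mul_le_mul_right (lconv_le_l2 hF' hG z) _))
  exact ENNReal.mul_ne_top ENNReal.ofReal_ne_top (ENNReal.mul_ne_top
    (ne_top_of_le_ne_top (ENNReal.mul_ne_top ENNReal.ofNat_ne_top h1)
      (l2_wmul_bracketXi_le_xN hs0.le hF))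
    (ne_top_of_le_ne_top h2 (l2_le_wmul_bracketPar (by linarith) G)))

/-- Convergence of the convolution integral for two functions supported in `K`: both negative
powers of the spatial frequencies are recovered from the frequency of the output. -/
theorem weightedConv_ne_top_of_regionK {s : ℝ} (hs0 : s < 0) {F G : Freq → ℝ≥0∞}
    (hF : Measurable F) (hG : Measurable G) (hFK : ∀ z, F z ≠ 0 → z ∈ regionK)
    (hGK : ∀ z, G z ≠ 0 → z ∈ regionK) (h1 : xN s F ≠ ⊤) (h2 : xN s G ≠ ⊤) (z : Freq) :
    weightedConv F G z ≠ ⊤ := by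
  have hF' := measurable_wmul (measurable_bracketXi_rpow s) hF
  have hG' := measurable_wmul (measurable_bracketXi_rpow s) hG
  have key : lconv F G z ≤
      ENNReal.ofReal ((2 ^ (-s) * 2 ^ (-s)) * (bracketPar z ^ (-s) * bracketPar z ^ (-s))) *
      lconv (wmul (fun z => bracketXi z ^ s) F) (wmul (fun z => bracketXi z ^ s) G) z := by
    unfold lconv wmul
    rw [← lintegral_const_mul' _ _ ENNReal.ofReal_ne_top]
    refine lintegral_mono fun y => ?_
    by_cases hy : F y = 0
    · simp [hy]
    by_cases hx : G (z - y) = 0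
    · simp [hx]
    obtain ⟨g1, g2⟩ := bracketXi_le_two_mul_bracketPar (hFK y hy) (hGK _ hx)
    have hp := bracketPar_pos z
    have one_le : ∀ x : ℝ, 0 < x → x ≤ 2 * bracketPar z →
        1 ≤ 2 ^ (-s) * bracketPar z ^ (-s) * x ^ s := by
      intro x hx0 hx
      rw [← Real.mul_rpow two_pos.le hp.le]
      calc (1 : ℝ) = x ^ (-s) * x ^ s := by
            rw [← Real.rpow_add hx0, neg_add_cancel, Real.rpow_zero]
        _ ≤ _ := mul_le_mul_of_nonneg_right (Real.rpow_le_rpow hx0.le hx (by linarith))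
            (Real.rpow_nonneg hx0.le s)
    have k1 := one_le _ (bracketXi_pos y) g1
    have k2 := one_le _ (bracketXi_pos (z - y)) g2
    have k3 : (1 : ℝ) ≤ (2 ^ (-s) * 2 ^ (-s)) * (bracketPar z ^ (-s) * bracketPar z ^ (-s)) *
        (bracketXi y ^ s * bracketXi (z - y) ^ s) :=
      (one_le_mul_of_one_le_of_one_le k1 k2).trans (le_of_eq (by ring))
    have k4 := ENNReal.ofReal_le_ofReal k3
    rw [ENNReal.ofReal_one, ENNReal.ofReal_mul (by positivity),
      ENNReal.ofReal_mul (Real.rpow_nonneg (bracketXi_pos y).le _)] at k4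
    calc F y * G (z - y) = 1 * (F y * G (z - y)) := (one_mul _).symm
      _ ≤ _ * (F y * G (z - y)) := mul_le_mul_left k4 _
      _ = _ := by ring
  refine ne_top_of_le_ne_top ?_ (((weightedConv_le_of_regionK hFK z).trans key).trans
    (mul_le_mul_right (lconv_le_l2 hF' hG' z) _))
  exact ENNReal.mul_ne_top ENNReal.ofReal_ne_top (ENNReal.mul_ne_top
    (ne_top_of_le_ne_top (ENNReal.mul_ne_top ENNReal.ofNat_ne_top h1)
      (l2_wmul_bracketXi_le_xN hs0.le hF))
    (ne_top_of_le_ne_top (ENNReal.mul_ne_top ENNReal.ofNat_ne_top h2)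
      (l2_wmul_bracketXi_le_xN hs0.le hG)))

theorem enorm_divW (U : Freq → ℂ) (z : Freq) :
    ‖divW U z‖ₑ = ENNReal.ofReal (weight z)⁻¹ * ‖U z‖ₑ := by
  have hw := weight_pos z
  rw [divW, div_eq_inv_mul, enorm_mul, ← Complex.ofReal_inv, ← ofReal_norm, Complex.norm_real,
    Real.norm_of_nonneg (inv_nonneg.2 hw.le)]

theorem measurable_divW {U : Freq → ℂ} (hU : Measurable U) : Measurable (divW U) :=
  hU.div (Complex.continuous_ofReal.comp continuous_weight).measurable

theorem weightedConv_eq (U V : Freq → ℂ) (z : Freq) :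
    weightedConv (fun y => ‖U y‖ₑ) (fun y => ‖V y‖ₑ) z =
      ENNReal.ofReal (weight z) * ∫⁻ y, ‖divW U y‖ₑ * ‖divW V (z - y)‖ₑ := by
  unfold weightedConv bil
  rw [← lintegral_const_mul' _ _ ENNReal.ofReal_ne_top]
  refine lintegral_congr fun y => ?_
  dsimp only
  rw [enorm_divW, enorm_divW, div_eq_mul_inv, mul_inv, ENNReal.ofReal_mul (weight_pos z).le,
    ENNReal.ofReal_mul (inv_nonneg.2 (weight_pos y).le)]
  ring

theorem convDefined_divW {U V : Freq → ℂ} (hU : Measurable U) (hV : Measurable V)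
    (h : ∀ z, weightedConv (fun y => ‖U y‖ₑ) (fun y => ‖V y‖ₑ) z ≠ ⊤) :
    ConvDefined (divW U) (divW V) := by
  intro z
  have hm : Measurable fun y => divW U y * divW V (z - y) :=
    (measurable_divW hU).mul ((measurable_divW hV).comp (measurable_const.sub measurable_id))
  refine ⟨hm.aestronglyMeasurable, ?_⟩
  have h1 := h z
  rw [weightedConv_eq] at h1
  have h2 : (∫⁻ y, ‖divW U y‖ₑ * ‖divW V (z - y)‖ₑ) ≠ ⊤ := by
    refine ne_top_of_le_ne_top h1 (le_mul_of_one_le_left zero_le ?_)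
    rw [ENNReal.one_le_ofReal]
    exact one_le_weight z
  refine lt_of_le_of_lt (lintegral_mono fun y => ?_) h2.lt_top
  simp [enorm_mul]

theorem aestronglyMeasurable_conv {u v : Freq → ℂ} (hu : Measurable u) (hv : Measurable v) :
    AEStronglyMeasurable (conv u v) volume := by
  have hm : Measurable fun p : Freq × Freq => u p.2 * v (p.1 - p.2) :=
    (hu.comp measurable_snd).mul (hv.comp (measurable_fst.sub measurable_snd))
  exact hm.stronglyMeasurable.integral_prod_right'.aestronglyMeasurable

theorem aestronglyMeasurable_wConv {U V : Freq → ℂ} (hU : Measurable U) (hV : Measurable V) :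
    AEStronglyMeasurable (wConv U V) volume := by
  refine AEStronglyMeasurable.mul ?_
    (aestronglyMeasurable_conv (measurable_divW hU) (measurable_divW hV))
  exact (Complex.continuous_ofReal.measurable.comp (continuous_weight.measurable.div
    continuous_bracketMod.measurable)).aestronglyMeasurable

theorem enorm_wConv_le (U V : Freq → ℂ) (z : Freq) :
    ‖wConv U V z‖ₑ ≤ wmul (fun z => (bracketMod z)⁻¹)
      (weightedConv (fun y => ‖U y‖ₑ) fun y => ‖V y‖ₑ) z := by
  have hw := weight_pos z
  have hb := bracketMod_pos z
  have h1 : ‖conv (divW U) (divW V) z‖ₑ ≤ ∫⁻ y, ‖divW U y‖ₑ * ‖divW V (z - y)‖ₑ := by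
    refine (enorm_integral_le_lintegral_enorm _).trans (lintegral_mono fun y => ?_)
    simp [enorm_mul]
  unfold wConv
  rw [wmul, weightedConv_eq, enorm_mul, ← mul_assoc, ← ENNReal.ofReal_mul (inv_nonneg.2 hb.le),
    ← ofReal_norm ((weight z / bracketMod z : ℝ) : ℂ), Complex.norm_real,
    Real.norm_of_nonneg (div_nonneg hw.le hb.le), inv_mul_eq_div]
  exact mul_le_mul_right h1 _

theorem zNorm_wConv_le {s : ℝ} {U V : Freq → ℂ} (hU : Measurable U) (hV : Measurable V) :
    zNorm s (wConv U V) ≤ pN s (wmul (fun z => (bracketMod z)⁻¹)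
      (weightedConv (fun y => ‖U y‖ₑ) fun y => ‖V y‖ₑ)) :=
  (zNorm_le_pN (aestronglyMeasurable_wConv hU hV)).trans
    (pN_mono_ae (Filter.Eventually.of_forall (enorm_wConv_le U V)) s)

theorem measurable_cut {S : Set Freq} (hS : MeasurableSet S) {f : Freq → ℝ} (hf : Measurable f) :
    Measurable (cut S f) :=
  (Complex.continuous_ofReal.measurable.comp hf).indicator hS

theorem mem_of_enorm_cut {S : Set Freq} {f : Freq → ℝ} {z : Freq} (h : ‖cut S f z‖ₑ ≠ 0) :
    z ∈ S := by
  by_contra hz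
  exact h (by simp [cut, hz])

theorem aestronglyMeasurable_of_zNorm_ne_top {s : ℝ} {f : Freq → ℂ} (h : zNorm s f ≠ ⊤) :
    AEStronglyMeasurable f volume := by
  by_contra hf
  refine h ?_
  simp only [zNorm, iInf_eq_top]
  intro f₁ f₂ h₁ h₂ he
  exact absurd ((h₁.add h₂).congr he.symm) hf

theorem l2_le_yN (s : ℝ) (F : Freq → ℝ≥0∞) :
    l2 (wmul (fun z => bracketPar z ^ (s + 1)) F) ≤ yN s F := le_add_self

/-- The estimates of the interactions of the pieces in and off `K`, combined. -/
theorem exists_pN_weightedConv_le_pN {s : ℝ} (hs : -1 < s) (hs0 : s < 0) : ∃ C : ℝ≥0,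
    ∀ F G : Freq → ℝ≥0∞, Measurable F → Measurable G →
      pN s (wmul (fun z => (bracketMod z)⁻¹) (weightedConv F G)) ≤ C * (pN s F * pN s G) ∧
        (pN s F ≠ ⊤ → pN s G ≠ ⊤ → ∀ z, weightedConv F G z ≠ ⊤) := by
  obtain ⟨C₁, h₁⟩ := exists_pN_weightedConv_le hs hs0
  obtain ⟨C₂, h₂⟩ := exists_pN_weightedConv_regionK_le hs hs0
  obtain ⟨C₃, h₃⟩ := exists_xN_weightedConv_le hs hs0
  obtain ⟨C₄, h₄⟩ := exists_yN_weightedConv_le hs hs0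
  refine ⟨4 * (C₂ + (C₃ + C₄) + ((C₃ + C₄) + C₁)), fun F G hF hG => ?_⟩
  have hK := measurableSet_regionK
  set F₁ := regionK.indicator F with hF₁
  set F₂ := regionKᶜ.indicator F with hF₂
  set G₁ := regionK.indicator G with hG₁
  set G₂ := regionKᶜ.indicator G with hG₂
  have mF₁ : Measurable F₁ := hF.indicator hK
  have mF₂ : Measurable F₂ := hF.indicator hK.compl
  have mG₁ : Measurable G₁ := hG.indicator hK
  have mG₂ : Measurable G₂ := hG.indicator hK.compl
  have sF : ∀ z, F₁ z ≠ 0 → z ∈ regionK := fun z hz => Set.mem_of_indicator_ne_zero hz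
  have sG : ∀ z, G₁ z ≠ 0 → z ∈ regionK := fun z hz => Set.mem_of_indicator_ne_zero hz
  have eF : F = fun z => F₁ z + F₂ z := (Set.indicator_self_add_compl regionK F).symm
  have eG : G = fun z => G₁ z + G₂ z := (Set.indicator_self_add_compl regionK G).symm
  have xF : xN s F₁ ≤ pN s F := le_self_add
  have xG : xN s G₁ ≤ pN s G := le_self_add
  have yF : l2 (wmul (fun z => bracketPar z ^ (s + 1)) F₂) ≤ pN s F :=
    (l2_le_yN s F₂).trans le_add_self
  have yG : l2 (wmul (fun z => bracketPar z ^ (s + 1)) G₂) ≤ pN s G :=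
    (l2_le_yN s G₂).trans le_add_self
  have hdec : ∀ z, weightedConv F G z = (weightedConv F₁ G₁ z + weightedConv F₁ G₂ z) +
      (weightedConv G₁ F₂ z + weightedConv F₂ G₂ z) := by
    intro z
    conv_lhs => rw [eF, eG]
    rw [weightedConv_add_left mF₁ (show Measurable fun z => G₁ z + G₂ z from mG₁.add mG₂),
      weightedConv_add_right mF₁ mG₁,
      weightedConv_add_right mF₂ mG₁, weightedConv_comm F₂ G₁]
  have hb : Measurable fun z : Freq => (bracketMod z)⁻¹ := continuous_bracketMod.measurable.inv
  have mul_div : ∀ {A B : Freq → ℝ≥0∞}, Measurable A → Measurable B →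
      Measurable (wmul (fun z => (bracketMod z)⁻¹) (weightedConv A B)) := fun hA hB =>
    measurable_wmul hb (measurable_weightedConv hA hB)
  constructor
  · have k1 : pN s (wmul (fun z => (bracketMod z)⁻¹) (weightedConv F₁ G₁)) ≤
        C₂ * (pN s F * pN s G) :=
      (h₂ F₁ G₁ mF₁ mG₁ sF sG).trans (mul_le_mul_right (mul_le_mul' xF xG) _)
    have k2 : pN s (wmul (fun z => (bracketMod z)⁻¹) (weightedConv F₁ G₂)) ≤
        (C₃ + C₄) * (pN s F * pN s G) := by
      refine (add_le_add (h₃ F₁ G₂ mF₁ mG₂ sF) (h₄ F₁ G₂ mF₁ mG₂ sF)).trans ?_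
      rw [← add_mul]
      exact mul_le_mul_right (mul_le_mul' xF yG) _
    have k3 : pN s (wmul (fun z => (bracketMod z)⁻¹) (weightedConv G₁ F₂)) ≤
        (C₃ + C₄) * (pN s F * pN s G) := by
      refine (add_le_add (h₃ G₁ F₂ mG₁ mF₂ sG) (h₄ G₁ F₂ mG₁ mF₂ sG)).trans ?_
      rw [← add_mul, mul_comm (pN s F)]
      exact mul_le_mul_right (mul_le_mul' xG yF) _
    have k4 : pN s (wmul (fun z => (bracketMod z)⁻¹) (weightedConv F₂ G₂)) ≤
        C₁ * (pN s F * pN s G) :=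
      (h₁ F₂ G₂ mF₂ mG₂).trans (mul_le_mul_right (mul_le_mul' yF yG) _)
    have e : wmul (fun z => (bracketMod z)⁻¹) (weightedConv F G) = fun z =>
        (wmul (fun z => (bracketMod z)⁻¹) (weightedConv F₁ G₁) z +
          wmul (fun z => (bracketMod z)⁻¹) (weightedConv F₁ G₂) z) +
        (wmul (fun z => (bracketMod z)⁻¹) (weightedConv G₁ F₂) z +
          wmul (fun z => (bracketMod z)⁻¹) (weightedConv F₂ G₂) z) := by
      funext z
      simp only [wmul, hdec z, mul_add]
    rw [e]
    refine (pN_add_le ((mul_div mF₁ mG₁).add (mul_div mF₁ mG₂))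
      ((mul_div mG₁ mF₂).add (mul_div mF₂ mG₂)) s).trans ?_
    calc _ ≤ 2 * (2 * (C₂ * (pN s F * pN s G) + (C₃ + C₄) * (pN s F * pN s G)) +
          2 * ((C₃ + C₄) * (pN s F * pN s G) + C₁ * (pN s F * pN s G))) := by
          refine mul_le_mul_right (add_le_add ?_ ?_) _
          · exact (pN_add_le (mul_div mF₁ mG₁) (mul_div mF₁ mG₂) s).trans
              (mul_le_mul_right (add_le_add k1 k2) _)
          · exact (pN_add_le (mul_div mG₁ mF₂) (mul_div mF₂ mG₂) s).trans
              (mul_le_mul_right (add_le_add k3 k4) _)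
      _ = _ := by push_cast; ring
  · intro hPF hPG z
    rw [hdec z]
    have a1 := ne_top_of_le_ne_top hPF xF
    have a2 := ne_top_of_le_ne_top hPG xG
    have a3 := ne_top_of_le_ne_top hPF yF
    have a4 := ne_top_of_le_ne_top hPG yG
    exact ENNReal.add_ne_top.2 ⟨ENNReal.add_ne_top.2
      ⟨weightedConv_ne_top_of_regionK hs0 mF₁ mG₁ sF sG a1 a2 z,
        weightedConv_ne_top_of_left hs hs0 mF₁ mG₂ sF a1 a4 z⟩, ENNReal.add_ne_top.2
      ⟨weightedConv_ne_top_of_left hs hs0 mG₁ mF₂ sG a2 a3 z,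
        weightedConv_ne_top hs mF₂ mG₂ a3 a4 z⟩⟩

/-- A function of finite `W^s` norm has a measurable representative of the form `U / w`. -/
theorem exists_divW_of_wNorm_ne_top {s : ℝ} {f : Freq → ℂ} (hf : wNorm s f ≠ ⊤) :
    ∃ U : Freq → ℂ, Measurable U ∧ f =ᵐ[volume] divW U ∧
      (fun z => (weight z : ℂ) * f z) =ᵐ[volume] U := by
  have h := aestronglyMeasurable_of_zNorm_ne_top hf
  refine ⟨h.mk _, h.stronglyMeasurable_mk.measurable, ?_, h.ae_eq_mk⟩
  filter_upwards [h.ae_eq_mk] with z hz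
  have hw : (weight z : ℂ) ≠ 0 := by exact_mod_cast (weight_pos z).ne'
  rw [divW, ← hz, mul_div_cancel_left₀ _ hw]

theorem ae_eq_sub_left {v v' : Freq → ℂ} (h : v =ᵐ[volume] v') (z : Freq) :
    (fun y => v (z - y)) =ᵐ[volume] fun y => v' (z - y) :=
  (Measure.measurePreserving_sub_left volume z).quasiMeasurePreserving.ae_eq_comp h

theorem convDefined_congr {u u' v v' : Freq → ℂ} (hu : u =ᵐ[volume] u') (hv : v =ᵐ[volume] v')
    (h : ConvDefined u' v') : ConvDefined u v := by
  intro z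
  refine Integrable.congr (h z) ?_
  filter_upwards [hu, ae_eq_sub_left hv z] with y h1 h2
  simp [h1, h2]

theorem conv_congr {u u' v v' : Freq → ℂ} (hu : u =ᵐ[volume] u') (hv : v =ᵐ[volume] v') :
    conv u v = conv u' v' := by
  funext z
  refine integral_congr_ae ?_
  filter_upwards [hu, ae_eq_sub_left hv z] with y h1 h2
  simp [h1, h2]

theorem exists_wNorm_conv_le {s : ℝ} (hs : -1 < s) (hs0 : s < 0) : ∃ C : ℝ≥0, ∀ f g : Freq → ℂ,
    wNorm s f ≠ ⊤ → wNorm s g ≠ ⊤ → ConvDefined f g ∧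
      wNorm s (fun z => ((bracketMod z)⁻¹ : ℂ) * conv f g z) ≤ C * wNorm s f * wNorm s g := by
  obtain ⟨C, hC⟩ := exists_pN_weightedConv_le_pN hs hs0
  obtain ⟨D, hD⟩ := exists_pN_le_zNorm hs hs0
  refine ⟨C * (D * D), fun f g hf hg => ?_⟩
  obtain ⟨U, mU, hfU, hwU⟩ := exists_divW_of_wNorm_ne_top hf
  obtain ⟨V, mV, hgV, hwV⟩ := exists_divW_of_wNorm_ne_top hg
  have pU : pN s (fun z => ‖U z‖ₑ) ≤ D * wNorm s f := by
    refine le_trans (le_of_eq (pN_congr_ae ?_ s)) (hD _)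
    filter_upwards [hwU] with z hz
    rw [hz]
  have pV : pN s (fun z => ‖V z‖ₑ) ≤ D * wNorm s g := by
    refine le_trans (le_of_eq (pN_congr_ae ?_ s)) (hD _)
    filter_upwards [hwV] with z hz
    rw [hz]
  obtain ⟨h1, h2⟩ := hC _ _ mU.enorm mV.enorm
  constructor
  · exact convDefined_congr hfU hgV (convDefined_divW mU mV
      (h2 (ne_top_of_le_ne_top (ENNReal.mul_ne_top ENNReal.coe_ne_top hf) pU)
        (ne_top_of_le_ne_top (ENNReal.mul_ne_top ENNReal.coe_ne_top hg) pV)))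
  · have e : (fun z => (weight z : ℂ) * (((bracketMod z)⁻¹ : ℂ) * conv f g z)) = wConv U V := by
      funext z
      rw [wConv, conv_congr hfU hgV, div_eq_mul_inv]
      push_cast
      ring
    unfold wNorm at pU pV ⊢
    rw [e]
    calc zNorm s (wConv U V) ≤ _ := zNorm_wConv_le mU mV
      _ ≤ C * ((D * zNorm s fun z => (weight z : ℂ) * f z) *
            (D * zNorm s fun z => (weight z : ℂ) * g z)) :=
          h1.trans (mul_le_mul_right (mul_le_mul' pU pV) _)
      _ = _ := by push_cast; ring

end QNLS

end

theorem proposition2p2 (s : ℝ) (hs : -1 < s) (hs0 : s < 0) :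
    (∃ C : ℝ≥0, ∀ f g : QNLS.Freq → ℝ,
      ContDiff ℝ ((⊤ : ℕ∞) : WithTop ℕ∞) f → ContDiff ℝ ((⊤ : ℕ∞) : WithTop ℕ∞) g →
      (∀ z, 0 ≤ f z) → (∀ z, 0 ≤ g z) →
      -- the interaction `K^c × K^c → Z^s`
      ((QNLS.yNorm s (QNLS.cut QNLS.regionKᶜ f) ≠ ⊤ →
          QNLS.yNorm s (QNLS.cut QNLS.regionKᶜ g) ≠ ⊤ →
          QNLS.ConvDefined (QNLS.divW (QNLS.cut QNLS.regionKᶜ f))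
            (QNLS.divW (QNLS.cut QNLS.regionKᶜ g))) ∧
        QNLS.zNorm s (QNLS.wConv (QNLS.cut QNLS.regionKᶜ f) (QNLS.cut QNLS.regionKᶜ g)) ≤
          C * QNLS.yNorm s (QNLS.cut QNLS.regionKᶜ f) *
            QNLS.yNorm s (QNLS.cut QNLS.regionKᶜ g)) ∧
      -- the interaction `K × K → Z^s`
      ((QNLS.xNorm s (1 / 2) (QNLS.cut QNLS.regionK f) ≠ ⊤ →
          QNLS.xNorm s (1 / 2) (QNLS.cut QNLS.regionK g) ≠ ⊤ →
          QNLS.ConvDefined (QNLS.divW (QNLS.cut QNLS.regionK f))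
            (QNLS.divW (QNLS.cut QNLS.regionK g))) ∧
        QNLS.zNorm s (QNLS.wConv (QNLS.cut QNLS.regionK f) (QNLS.cut QNLS.regionK g)) ≤
          C * QNLS.xNorm s (1 / 2) (QNLS.cut QNLS.regionK f) *
            QNLS.xNorm s (1 / 2) (QNLS.cut QNLS.regionK g)) ∧
      -- the interaction `K × K^c`, with output in `X̂^{s,1/2,1}` on `K` and in `Y^s` off `K`
      ((QNLS.xNorm s (1 / 2) (QNLS.cut QNLS.regionK f) ≠ ⊤ →
          QNLS.yNorm s (QNLS.cut QNLS.regionKᶜ g) ≠ ⊤ →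
          QNLS.ConvDefined (QNLS.divW (QNLS.cut QNLS.regionK f))
            (QNLS.divW (QNLS.cut QNLS.regionKᶜ g))) ∧
        QNLS.xNorm s (1 / 2) (QNLS.regionK.indicator
            (QNLS.wConv (QNLS.cut QNLS.regionK f) (QNLS.cut QNLS.regionKᶜ g))) ≤
          C * QNLS.xNorm s (1 / 2) (QNLS.cut QNLS.regionK f) *
            QNLS.yNorm s (QNLS.cut QNLS.regionKᶜ g) ∧
        QNLS.yNorm s (QNLS.regionKᶜ.indicator
            (QNLS.wConv (QNLS.cut QNLS.regionK f) (QNLS.cut QNLS.regionKᶜ g))) ≤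
          C * QNLS.xNorm s (1 / 2) (QNLS.cut QNLS.regionK f) *
            QNLS.yNorm s (QNLS.cut QNLS.regionKᶜ g))) ∧
    -- the resulting bilinear estimate in `W^s`
    (∃ C : ℝ≥0, ∀ f g : QNLS.Freq → ℂ, QNLS.wNorm s f ≠ ⊤ → QNLS.wNorm s g ≠ ⊤ →
      QNLS.ConvDefined f g ∧
        QNLS.wNorm s (fun z => ((QNLS.bracketMod z)⁻¹ : ℂ) * QNLS.conv f g z) ≤
          C * QNLS.wNorm s f * QNLS.wNorm s g) := by
  refine ⟨?_, QNLS.exists_wNorm_conv_le hs hs0⟩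
  obtain ⟨C₁, h₁⟩ := QNLS.exists_pN_weightedConv_le hs hs0
  obtain ⟨C₂, h₂⟩ := QNLS.exists_pN_weightedConv_regionK_le hs hs0
  obtain ⟨C₃, h₃⟩ := QNLS.exists_xN_weightedConv_le hs hs0
  obtain ⟨C₄, h₄⟩ := QNLS.exists_yN_weightedConv_le hs hs0
  refine ⟨C₁ + C₂ + C₃ + C₄, fun f g hf hg _ _ => ?_⟩
  have hK := QNLS.measurableSet_regionK
  have mf := QNLS.measurable_cut hK hf.continuous.measurable
  have mg := QNLS.measurable_cut hK hg.continuous.measurable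
  have mf' := QNLS.measurable_cut hK.compl hf.continuous.measurable
  have mg' := QNLS.measurable_cut hK.compl hg.continuous.measurable
  have sf : ∀ z, ‖QNLS.cut QNLS.regionK f z‖ₑ ≠ 0 → z ∈ QNLS.regionK := fun z =>
    QNLS.mem_of_enorm_cut
  have sg : ∀ z, ‖QNLS.cut QNLS.regionK g z‖ₑ ≠ 0 → z ∈ QNLS.regionK := fun z =>
    QNLS.mem_of_enorm_cut
  -- each of the four constants is at most their sum
  have hconst : ∀ {D : ℝ≥0} {A x y : ℝ≥0∞}, D ≤ C₁ + C₂ + C₃ + C₄ → A ≤ D * (x * y) →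
      A ≤ ((C₁ + C₂ + C₃ + C₄ : ℝ≥0) : ℝ≥0∞) * x * y := fun hD hA => by
    rw [mul_assoc]
    exact hA.trans (mul_le_mul_left (ENNReal.coe_le_coe.2 hD) _)
  have le1 : C₁ ≤ C₁ + C₂ + C₃ + C₄ := by
    rw [add_assoc, add_assoc]; exact le_self_add
  have le2 : C₂ ≤ C₁ + C₂ + C₃ + C₄ := by
    rw [add_assoc (C₁ + C₂)]; exact le_add_self.trans le_self_add
  have le3 : C₃ ≤ C₁ + C₂ + C₃ + C₄ := le_add_self.trans le_self_add
  have le4 : C₄ ≤ C₁ + C₂ + C₃ + C₄ := le_add_self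
  simp only [QNLS.xNorm_eq, QNLS.yNorm_eq, QNLS.indicator_enorm]
  refine ⟨⟨fun a b => ?_, ?_⟩, ⟨fun a b => ?_, ?_⟩, fun a b => ?_, ?_, ?_⟩
  · exact QNLS.convDefined_divW mf' mg' (QNLS.weightedConv_ne_top hs mf'.enorm mg'.enorm
      (ne_top_of_le_ne_top a (QNLS.l2_le_yN s _)) (ne_top_of_le_ne_top b (QNLS.l2_le_yN s _)))
  · exact hconst le1 ((QNLS.zNorm_wConv_le mf' mg').trans ((h₁ _ _ mf'.enorm mg'.enorm).trans
      (mul_le_mul_right (mul_le_mul' (QNLS.l2_le_yN s _) (QNLS.l2_le_yN s _)) _)))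
  · exact QNLS.convDefined_divW mf mg
      (QNLS.weightedConv_ne_top_of_regionK hs0 mf.enorm mg.enorm sf sg a b)
  · exact hconst le2 ((QNLS.zNorm_wConv_le mf mg).trans (h₂ _ _ mf.enorm mg.enorm sf sg))
  · exact QNLS.convDefined_divW mf mg' (QNLS.weightedConv_ne_top_of_left hs hs0 mf.enorm mg'.enorm
      sf a (ne_top_of_le_ne_top b (QNLS.l2_le_yN s _)))
  · refine hconst le3 (le_trans (QNLS.xN_mono_ae (Filter.Eventually.of_forall fun z =>
      Set.indicator_le_indicator (QNLS.enorm_wConv_le _ _ z)) s)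
      ((h₃ _ _ mf.enorm mg'.enorm sf).trans
        (mul_le_mul_right (mul_le_mul_right (QNLS.l2_le_yN s _) _) _)))
  · refine hconst le4 (le_trans (QNLS.yN_mono_ae (Filter.Eventually.of_forall fun z =>
      Set.indicator_le_indicator (QNLS.enorm_wConv_le _ _ z)) s)
      ((h₄ _ _ mf.enorm mg'.enorm sf).trans
        (mul_le_mul_right (mul_le_mul_right (QNLS.l2_le_yN s _) _) _)))
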